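/- **Conventions.** Let $k$ be a field. A *quasi-Hopf algebra* over $k$ is a unital associative $k$-algebra $H$ with unital algebra morphisms $\Delta:H\to H\otimes H$, $\epsilon:H\to k$, an invertible element $\phi\in H^{\otimes 3}$, an invertible unital linear antimultiplicative map $S:H\to H$, and elements $\alpha,\beta\in H$ such that $$(\mathrm{id}\otimes\Delta)(\Delta(a))\,\phi=\phi\,(\Delta\otimes\mathrm{id})(\Delta(a)),\qquad (\epsilon\otimes\mathrm{id})\Delta=\mathrm{id}=(\mathrm{id}\otimes\epsilon)\Delta,$$ $$(\mathrm{id}\otimes\mathrm{id}\otimes\Delta)(\phi)\,(\Delta\otimes\mathrm{id}\otimes\mathrm{id})(\phi)=(1\otimes\phi)\,(\mathrm{id}\otimes\Delta\otimes\mathrm{id})(\phi)\,(\phi\otimes1),\qquad (\mathrm{id}\otimes\epsilon\otimes\mathrm{id})(\phi)=1\otimes1,$$ $$S(a_{(1)})\alpha a_{(2)}=\epsilon(a)\alpha,\quad a_{(1)}\beta S(a_{(2)})=\epsilon(a)\beta,\quad X\beta S(Y)\alpha Z=1=S(\bar X)\alpha\bar Y\beta S(\bar Z)$$ for all $a\in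 H$. Here $\Delta(a)=a_{(1)}\otimes a_{(2)}$, $\phi=X\otimes Y\otimes Z$, $\phi^{-1}=\bar X\otimes\bar Y\otimes\bar Z$, summation being understood throughout. For $t=t^1\otimes t^2\in H\otimes H$ write $t^{21}=t^2\otimes t^1$, and $\Delta^{op}(a)=\Delta(a)^{21}$. Put $$q_R=X\otimes S^{-1}(\alpha Z)Y,\qquad p_R=\bar X\otimes\bar Y\beta S(\bar Z),$$ $$\gamma=(S(U')\otimes S(T'))(\alpha\otimes\alpha)(V'\otimes W')\quad\text{where } T'\otimes U'\otimes V'\otimes W'=(1\otimes\phi^{-1})(\mathrm{id}\otimes\mathrm{id}\otimes\Delta)(\phi),$$ $$f=(S\otimes S)(\Delta^{op}(\bar X))\,\gamma\,\Delta(\bar Y\beta S(\bar Z)),\qquad h=(S^{-1}\otimes S^{-1})(f^{21});$$ the element $f$ (Drinfeld's twist) is invertible in $H\otimes H$. Put further $$U=f^{-1}(S\otimes S)(q_R^{21}),\qquad V=(S^{-1}\otimes S^{-1})(p_R^{21})\,h,\qquad \bar\Delta(a)=V\Delta(a)U.$$ Let $H$ be finite-dimensional. The *dual quasi-Hopf bimodule*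 $H^*=\mathrm{Hom}_k(H,k)$ is $H^*$ with the $H$-bimodule structure $\langle a\cdot\psi\cdot b,\,x\rangle=\langle\psi,\,S^{-1}(a)\,x\,S(b)\rangle$ and the right coaction $\rho:H^*\to H^*\otimes H\cong\mathrm{Hom}_k(H,H)$, $[\rho(\psi)](x)=(\mathrm{id}\otimes\psi)(\bar\Delta(x))$. With $\rho(\psi)=\psi_{(0)}\otimes\psi_{(1)}$ and $q_R=q^1\otimes q^2$, let $E:H^*\to H^*$, $$E(\psi)=q^1\cdot\psi_{(0)}\cdot\beta S(q^2\psi_{(1)}).$$ The space of *left cointegrals* on $H$ is the space of coinvariants $\mathcal L=E(H^*)$ of $H^*$. A functional $\omega\in H^*$ is *nondegenerate* if the bilinear form $(a,b)\mapsto\omega(ab)$ on $H$ is nondegenerate, and $H$ is *Frobenius* if it admits a nondegenerate functional. A *left* (resp. *right*) *integral* in $H$ is an element $l\in H$ with $al=\epsilon(a)l$ (resp. $la=\epsilon(a)l$) for all $a\in H$. **Theorem.** Let $H$ be a finite-dimensional quasi-Hopf algebra over a field. Then $\dim_k\mathcal L=1$, and every nonzero left cointegral on $H$ is nondegenerate.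 In particular $H$ is a Frobenius algebra, and the space of left integrals in $H$ and the space of right integrals in $H$ are both one-dimensional. -/

import Mathlib

open scoped TensorProduct

noncomputable section

/-- A quasi-bialgebra structure on a unital associative `k`-algebra `H`: a coproduct and a counit
(unital algebra morphisms) and an invertible reassociator `φ`.  Triple and fourfold tensor powers
of `H` are bracketed to the right. -/
structure QuasiBialgebra (k : Type*) (H : Type*) [Field k] [Ring H] [Algebra k H] where
  comul : H →ₐ[k] H ⊗[k] H
  counit : H →ₐ[k] k
  φ : (H ⊗[k] (H ⊗[k] H))ˣ
  /-- `(id ⊗ Δ)(Δ a) φ = φ (Δ ⊗ id)(Δ a)` -/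
  quasi_coassoc : ∀ a : H,
    Algebra.TensorProduct.map (AlgHom.id k H) comul (comul a) * (φ : H ⊗[k] (H ⊗[k] H)) =
      (φ : H ⊗[k] (H ⊗[k] H)) *
        TensorProduct.assoc k H H H
          (Algebra.TensorProduct.map comul (AlgHom.id k H) (comul a))
  /-- `(id ⊗ id ⊗ Δ)(φ) (Δ ⊗ id ⊗ id)(φ) = (1 ⊗ φ) (id ⊗ Δ ⊗ id)(φ) (φ ⊗ 1)` -/
  pentagon :
    Algebra.TensorProduct.map (AlgHom.id k H)
        (Algebra.TensorProduct.map (AlgHom.id k H) comul) (φ : H ⊗[k] (H ⊗[k] H)) *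
      TensorProduct.assoc k H H (H ⊗[k] H)
        (Algebra.TensorProduct.map comul (AlgHom.id k (H ⊗[k] H)) (φ : H ⊗[k] (H ⊗[k] H))) =
    ((1 : H) ⊗ₜ[k] (φ : H ⊗[k] (H ⊗[k] H))) *
      TensorProduct.map LinearMap.id (TensorProduct.assoc k H H H).toLinearMap
        (Algebra.TensorProduct.map (AlgHom.id k H)
          (Algebra.TensorProduct.map comul (AlgHom.id k H)) (φ : H ⊗[k] (H ⊗[k] H))) *
      TensorProduct.map LinearMap.id (TensorProduct.assoc k H H H).toLinearMap
        (TensorProduct.assoc k H (H ⊗[k] H) H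
          ((φ : H ⊗[k] (H ⊗[k] H)) ⊗ₜ[k] (1 : H)))
  /-- `(ε ⊗ id) ∘ Δ = id` -/
  counit_comul : ∀ a : H,
    TensorProduct.lid k H (TensorProduct.map counit.toLinearMap LinearMap.id (comul a)) = a
  /-- `(id ⊗ ε) ∘ Δ = id` -/
  comul_counit : ∀ a : H,
    TensorProduct.rid k H (TensorProduct.map LinearMap.id counit.toLinearMap (comul a)) = a
  /-- `(id ⊗ ε ⊗ id)(φ) = 1 ⊗ 1` -/
  counit_φ :
    TensorProduct.map LinearMap.id
        ((TensorProduct.lid k H).toLinearMap ∘ₗ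
          TensorProduct.map counit.toLinearMap LinearMap.id)
        (φ : H ⊗[k] (H ⊗[k] H)) = (1 : H ⊗[k] H)

/-- The linear map `x ⊗ y ↦ x c y` on an algebra `A`. -/
def sandwich (k : Type*) {A : Type*} [Field k] [Ring A] [Algebra k A] (c : A) :
    A ⊗[k] A →ₗ[k] A :=
  LinearMap.mul' k A ∘ₗ TensorProduct.map LinearMap.id (LinearMap.mulLeft k c)

theorem sandwich_tmul (k : Type*) {A : Type*} [Field k] [Ring A] [Algebra k A] (c x y : A) :
    sandwich k c (x ⊗ₜ[k] y) = x * c * y := by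
  simp [sandwich, mul_assoc]

/-- A quasi-Hopf algebra: a quasi-bialgebra with an invertible linear antimultiplicative
antipode `S` and elements `α`, `β`. -/
structure QuasiHopfAlgebra (k : Type*) (H : Type*) [Field k] [Ring H] [Algebra k H]
    extends QuasiBialgebra k H where
  S : H ≃ₗ[k] H
  S_one : S 1 = 1
  S_mul : ∀ a b : H, S (a * b) = S b * S a
  α : H
  β : H
  /-- `S(a₁) α a₂ = ε(a) α` -/
  S_α : ∀ a : H,
    sandwich k α (TensorProduct.map S.toLinearMap LinearMap.id (comul a)) = counit a • α
  /-- `a₁ β S(a₂) = ε(a) β` -/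
  β_S : ∀ a : H,
    sandwich k β (TensorProduct.map LinearMap.id S.toLinearMap (comul a)) = counit a • β
  /-- `X β S(Y) α Z = 1` for `φ = X ⊗ Y ⊗ Z` -/
  φ_β_α :
    sandwich k β (TensorProduct.map LinearMap.id
      (sandwich k α ∘ₗ TensorProduct.map S.toLinearMap LinearMap.id)
      (φ : H ⊗[k] (H ⊗[k] H))) = 1
  /-- `S(X̄) α Ȳ β S(Z̄) = 1` for `φ⁻¹ = X̄ ⊗ Ȳ ⊗ Z̄` -/
  φinv_α_β :
    sandwich k α (TensorProduct.map S.toLinearMap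
      (sandwich k β ∘ₗ TensorProduct.map LinearMap.id S.toLinearMap)
      ((φ⁻¹ : (H ⊗[k] (H ⊗[k] H))ˣ) : H ⊗[k] (H ⊗[k] H))) = 1

/-- An `H`-bimodule `M` with a linear map `coaction : M → M ⊗ H`; `left a m` is `a · m` and
`right b m` is `m · b`.  (Compatibility of the coaction with the remaining structure is not part
of the data.) -/
structure CoactedBimodule (k : Type*) (H : Type*) (M : Type*) [Field k] [Ring H] [Algebra k H]
    [AddCommGroup M] [Module k M] where
  left : H →ₗ[k] M →ₗ[k] M
  right : H →ₗ[k] M →ₗ[k] M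
  left_one : ∀ m : M, left 1 m = m
  left_mul : ∀ (a b : H) (m : M), left (a * b) m = left a (left b m)
  right_one : ∀ m : M, right 1 m = m
  right_mul : ∀ (a b : H) (m : M), right (a * b) m = right b (right a m)
  left_right : ∀ (a b : H) (m : M), left a (right b m) = right b (left a m)
  coaction : M →ₗ[k] M ⊗[k] H

namespace QuasiHopfAlgebra

variable {k : Type*} {H : Type*} [Field k] [Ring H] [Algebra k H] (Q : QuasiHopfAlgebra k H)

/-- The inverse of the reassociator, `φ⁻¹ = X̄ ⊗ Ȳ ⊗ Z̄`. -/
def φinv : H ⊗[k] (H ⊗[k] H) := ((Q.φ⁻¹ : (H ⊗[k] (H ⊗[k] H))ˣ) : H ⊗[k] (H ⊗[k] H))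

/-- The inverse antipode. -/
def Sinv : H →ₗ[k] H := Q.S.symm.toLinearMap

/-- `x ⊗ y ↦ S(y) ⊗ S(x)`. -/
def SSop : H ⊗[k] H →ₗ[k] H ⊗[k] H :=
  TensorProduct.map Q.S.toLinearMap Q.S.toLinearMap ∘ₗ (TensorProduct.comm k H H).toLinearMap

/-- `x ⊗ y ↦ S⁻¹(y) ⊗ S⁻¹(x)`. -/
def SSinvop : H ⊗[k] H →ₗ[k] H ⊗[k] H :=
  TensorProduct.map Q.Sinv Q.Sinv ∘ₗ (TensorProduct.comm k H H).toLinearMap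

/-- `x ⊗ y ↦ x β S(y)`. -/
def mulβS : H ⊗[k] H →ₗ[k] H :=
  sandwich k Q.β ∘ₗ TensorProduct.map LinearMap.id Q.S.toLinearMap

/-- `y ⊗ z ↦ S⁻¹(α z) y`. -/
def Sinvαmul : H ⊗[k] H →ₗ[k] H :=
  LinearMap.mul' k H ∘ₗ
    TensorProduct.map (Q.Sinv ∘ₗ LinearMap.mulLeft k Q.α) LinearMap.id ∘ₗ
    (TensorProduct.comm k H H).toLinearMap

/-- `q_R = X ⊗ S⁻¹(α Z) Y`. -/
def qR : H ⊗[k] H :=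
  TensorProduct.map LinearMap.id Q.Sinvαmul (Q.φ : H ⊗[k] (H ⊗[k] H))

/-- `p_R = X̄ ⊗ Ȳ β S(Z̄)`. -/
def pR : H ⊗[k] H := TensorProduct.map LinearMap.id Q.mulβS Q.φinv

/-- `T ⊗ U ⊗ V ⊗ W = (1 ⊗ φ⁻¹) (id ⊗ id ⊗ Δ)(φ)`. -/
def TUVW : H ⊗[k] (H ⊗[k] (H ⊗[k] H)) :=
  ((1 : H) ⊗ₜ[k] Q.φinv) *
    Algebra.TensorProduct.map (AlgHom.id k H)
      (Algebra.TensorProduct.map (AlgHom.id k H) Q.comul) (Q.φ : H ⊗[k] (H ⊗[k] H))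

/-- The linear map `t ⊗ u ⊗ v ⊗ w ↦ (S(u) ⊗ S(t)) (α ⊗ α) (v ⊗ w)`. -/
def γmap : H ⊗[k] (H ⊗[k] (H ⊗[k] H)) →ₗ[k] H ⊗[k] H :=
  sandwich k (Q.α ⊗ₜ[k] Q.α) ∘ₗ
    TensorProduct.map Q.SSop LinearMap.id ∘ₗ
    (TensorProduct.assoc k H H (H ⊗[k] H)).symm.toLinearMap

/-- `γ = (S(U) ⊗ S(T)) (α ⊗ α) (V ⊗ W)`. -/
def γ : H ⊗[k] H := Q.γmap Q.TUVW

/-- The linear map `x ⊗ y ⊗ z ↦ (S ⊗ S)(Δᵒᵖ(x)) γ Δ(y β S(z))`. -/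
def fmap : H ⊗[k] (H ⊗[k] H) →ₗ[k] H ⊗[k] H :=
  sandwich k Q.γ ∘ₗ
    TensorProduct.map (Q.SSop ∘ₗ Q.comul.toLinearMap) (Q.comul.toLinearMap ∘ₗ Q.mulβS)

/-- Drinfeld's twist `f = (S ⊗ S)(Δᵒᵖ(X̄)) γ Δ(Ȳ β S(Z̄))`. -/
def f : H ⊗[k] H := Q.fmap Q.φinv

/-- `h = (S⁻¹ ⊗ S⁻¹)(f²¹)`. -/
def h : H ⊗[k] H := Q.SSinvop Q.f

/-- `U = f⁻¹ (S ⊗ S)(q_R²¹)`. (The element `f` is invertible in every quasi-Hopf algebra.) -/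
def U : H ⊗[k] H := Ring.inverse Q.f * Q.SSop Q.qR

/-- `V = (S⁻¹ ⊗ S⁻¹)(p_R²¹) h`. -/
def V : H ⊗[k] H := Q.SSinvop Q.pR * Q.h

/-- The deformed coproduct `Δ̄(a) = V Δ(a) U`. -/
def comulBar : H →ₗ[k] H ⊗[k] H :=
  LinearMap.mulLeft k Q.V ∘ₗ LinearMap.mulRight k Q.U ∘ₗ Q.comul.toLinearMap

/-! The formulas above on pure tensors. -/

theorem Sinvαmul_tmul (y z : H) : Q.Sinvαmul (y ⊗ₜ[k] z) = Q.Sinv (Q.α * z) * y := by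
  simp [Sinvαmul]

theorem mulβS_tmul (y z : H) : Q.mulβS (y ⊗ₜ[k] z) = y * Q.β * Q.S z := by
  simp [mulβS, sandwich_tmul]

theorem γmap_tmul (t u v w : H) :
    Q.γmap (t ⊗ₜ[k] (u ⊗ₜ[k] (v ⊗ₜ[k] w))) =
      (Q.S u ⊗ₜ[k] Q.S t) * (Q.α ⊗ₜ[k] Q.α) * (v ⊗ₜ[k] w) := by
  simp [γmap, SSop, sandwich_tmul]

theorem fmap_tmul (x y z : H) :
    Q.fmap (x ⊗ₜ[k] (y ⊗ₜ[k] z)) =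
      Q.SSop (Q.comul x) * Q.γ * Q.comul (y * Q.β * Q.S z) := by
  simp [fmap, sandwich_tmul, mulβS_tmul]

theorem comulBar_apply (a : H) : Q.comulBar a = Q.V * Q.comul a * Q.U := by
  simp [comulBar, mul_assoc]

section Coinvariants

variable {M : Type*} [AddCommGroup M] [Module k M] (B : CoactedBimodule k H M)

/-- `m ⊗ a ↦ m · β S(a)`. -/
def rightβS : M ⊗[k] H →ₗ[k] M :=
  TensorProduct.lift
    (B.right ∘ₗ LinearMap.mulLeft k Q.β ∘ₗ Q.S.toLinearMap).flip

/-- `E(m) = q_R¹ · m₍₀₎ · β S(q_R² m₍₁₎)`, where `ρ(m) = m₍₀₎ ⊗ m₍₁₎` is the coaction. -/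
def E : M →ₗ[k] M :=
  Q.rightβS B ∘ₗ TensorProduct.map₂ B.left (LinearMap.mul k H) Q.qR ∘ₗ B.coaction

/-- The space of coinvariants `M^{coH} = E(M)`. -/
def coinvariants : Submodule k M := LinearMap.range (Q.E B)

/-- The contribution of pure tensors `q¹ ⊗ q²` and `m ⊗ a` to the formula for `E`. -/
theorem E_tmul (q₁ q₂ a : H) (m : M) :
    Q.rightβS B (TensorProduct.map₂ B.left (LinearMap.mul k H) (q₁ ⊗ₜ[k] q₂) (m ⊗ₜ[k] a)) =
      B.right (Q.β * Q.S (q₂ * a)) (B.left q₁ m) := by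
  simp [rightβS]

end Coinvariants

section Dual

variable [FiniteDimensional k H]

/-- The right coaction on `H^* = Hom(H, k)`, with `H^* ⊗ H` identified with `Hom(H, H)`:
`ρ(ψ)` is the map `a ↦ (id ⊗ ψ)(Δ̄(a))`. -/
def dualCoaction : Module.Dual k H →ₗ[k] Module.Dual k H ⊗[k] H :=
  (dualTensorHomEquiv k H H).symm.toLinearMap ∘ₗ
    { toFun := fun ψ =>
        (TensorProduct.rid k H).toLinearMap ∘ₗ TensorProduct.map LinearMap.id ψ ∘ₗ Q.comulBar
      map_add' := by
        intro ψ χ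
        ext a
        simp [TensorProduct.map_add_right]
      map_smul' := by
        intro c ψ
        ext a
        simp [TensorProduct.map_smul_right] }

theorem dualTensorHom_dualCoaction (ψ : Module.Dual k H) (a : H) :
    dualTensorHomEquiv k H H (Q.dualCoaction ψ) a =
      TensorProduct.rid k H (TensorProduct.map LinearMap.id ψ (Q.V * Q.comul a * Q.U)) := by
  simp [dualCoaction, comulBar_apply]

/-- The dual `H^*` of `H` (viewed as a left quasi-Hopf bimodule over itself by multiplication and
coproduct): `⟨a · ψ · b, x⟩ = ⟨ψ, S⁻¹(a) x S(b)⟩`, with the coaction `dualCoaction`. -/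
def dualBimodule : CoactedBimodule k H (Module.Dual k H) where
  left := LinearMap.mk₂ k (fun a ψ => ψ ∘ₗ LinearMap.mulLeft k (Q.S.symm a))
    (by intros; ext; simp [add_mul]) (by intros; ext; simp)
    (by intros; ext; simp) (by intros; ext; simp)
  right := LinearMap.mk₂ k (fun b ψ => ψ ∘ₗ LinearMap.mulRight k (Q.S b))
    (by intros; ext; simp [mul_add]) (by intros; ext; simp)
    (by intros; ext; simp) (by intros; ext; simp)
  left_one := by
    intro ψ
    have h1 : Q.S.symm 1 = 1 := by rw [LinearEquiv.symm_apply_eq, Q.S_one]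
    ext x
    simp [h1]
  left_mul := by
    intro a b ψ
    have h1 : Q.S.symm (a * b) = Q.S.symm b * Q.S.symm a := by
      rw [LinearEquiv.symm_apply_eq, Q.S_mul]; simp
    ext x
    simp [h1, mul_assoc]
  right_one := by
    intro ψ
    ext x
    simp [Q.S_one]
  right_mul := by
    intro a b ψ
    ext x
    simp [Q.S_mul, mul_assoc]
  left_right := by
    intro a b ψ
    ext x
    simp [mul_assoc]
  coaction := Q.dualCoaction

/-- The space of left cointegrals on `H`: the coinvariants of `H^*`. -/
def leftCointegrals : Submodule k (Module.Dual k H) := Q.coinvariants Q.dualBimodule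

end Dual

/-- Left integrals: `a l = ε(a) l` for all `a`. -/
def leftIntegrals : Submodule k H where
  carrier := {l | ∀ a : H, a * l = Q.counit a • l}
  add_mem' := by
    intro x y hx hy a
    rw [mul_add, hx a, hy a, smul_add]
  zero_mem' := by
    intro a
    simp
  smul_mem' := by
    intro c x hx a
    rw [mul_smul_comm, hx a, smul_comm]

/-- Right integrals: `r a = ε(a) r` for all `a`. -/
def rightIntegrals : Submodule k H where
  carrier := {r | ∀ a : H, r * a = Q.counit a • r}
  add_mem' := by
    intro x y hx hy a
    rw [add_mul, hx a, hy a, smul_add]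
  zero_mem' := by
    intro a
    simp
  smul_mem' := by
    intro c x hx a
    rw [smul_mul_assoc, hx a, smul_comm]

end QuasiHopfAlgebra

/-- A functional `ω` on an algebra `A` is nondegenerate if the bilinear form `(a, b) ↦ ω(a b)`
is nondegenerate (in both arguments). -/
def IsNondegenerateFunctional {k A : Type*} [Field k] [Ring A] [Algebra k A]
    (ω : Module.Dual k A) : Prop :=
  ((LinearMap.mul k A).compr₂ ω).Nondegenerate

/-- A Frobenius algebra: a finite-dimensional algebra admitting a nondegenerate functional. -/
def IsFrobeniusAlgebra (k A : Type*) [Field k] [Ring A] [Algebra k A] : Prop :=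
  FiniteDimensional k A ∧ ∃ ω : Module.Dual k A, IsNondegenerateFunctional ω

end

/-!
The space of left cointegrals is computed from the structure theorem for quasi-Hopf bimodules:
if `M` is an `H`-bimodule with a coaction `ρ : M → M ⊗ H` that is a bimodule map, counital, and
coassociative up to conjugation by `φ`, then `l ⊗ a ↦ l · a` is an isomorphism `E(M) ⊗ H ≃ M`
(`IsQuasiHopfBimodule.coinvariantsTensorEquiv`). For `M = H^*` a comparison of dimensions gives
`dim 𝓛 = 1`. Injectivity on a line `l ⊗ H` says that `l(x S(a)) = 0` for all `x` forces `a = 0`,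
so that `l` is nondegenerate. Given a nondegenerate `ω`, the bijections `l ↦ ω(· l)` and
`l ↦ ω(l ·)` from `H` to `H^*` carry the left and the right integrals onto the line spanned
by `ε`.

What has to be shown is that `H^*` is a quasi-Hopf bimodule (`isQuasiHopfBimodule_dual`), that is,
that the deformation `V Δ(·) U` turns the axioms of `Δ` and `φ` into those of a coaction.

* Drinfeld's twist `f` compares two antipodes for the algebra morphism `Δ : H → H ⊗ H`: the
  image `Δ ∘ S` of the antipode of `H`, with `Δ(α)` and `Δ(β)`, and the map
  `a ↦ (S ⊗ S)(Δᵒᵖ(a))`, with `γ` and its counterpart `δ` (`isAntipodeAlong_comul'`). Any two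
  antipodes along the same morphism are conjugate (`IsAntipodeAlong.twist_mul` and the lemmas after
  it), which gives the properties of `f` and its invertibility. Most of these identities arise
  by contracting the pentagon with antipodes, which absorb the factors where `Δ` is applied to
  `φ` (`collapse₁₂_left` and its variants).
* `U` is the only element of `H ⊗ H` with `Δ(S(a₁)) U (a₂ ⊗ 1) = U (1 ⊗ S(a))` for all `a` and
  `U (1 ⊗ α) = Δ(S(X) α) (Y ⊗ Z)`, and there is a similar characterization of `V`. This
  uniqueness (`eq_of_mul_S`, `eq_of_Sinv_mul`) reduces an identity for `U` or `V` to a check of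
  the equivariance and of the value at `α` or `β`. It yields the counit identities `εl_U`, `εl_V`
  and the compatibility of `U` and `V` with `φ` (`φinv_mul_Δ₂₃_U`, `Δ₂₃_V_mul_Φ`), on which the
  coassociativity of the coaction rests.

Identities in tensor powers of `H` are handled through the contractions `con₂`, `con₃`, `con₄`,
such as `x ⊗ y ⊗ z ↦ F₁(x) F₂(y) F₃(z)`, which replace Sweedler-style expressions.
-/

open scoped TensorProduct

set_option maxSynthPendingDepth 3
set_option linter.unusedSimpArgs false

noncomputable section

/-! ### Contractions of tensors -/

section Contractions

variable {k H B : Type*} [Field k] [Ring H] [Algebra k H] [Ring B] [Algebra k B]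

/-- To prove a property of a threefold tensor it suffices to treat pure tensors. -/
theorem tensor_induction₃ {M N P : Type*} [AddCommGroup M] [Module k M] [AddCommGroup N]
    [Module k N] [AddCommGroup P] [Module k P]
    {p : M ⊗[k] (N ⊗[k] P) → Prop} (zero : p 0) (add : ∀ s t, p s → p t → p (s + t))
    (tmul : ∀ x y z, p (x ⊗ₜ[k] (y ⊗ₜ[k] z))) (t : M ⊗[k] (N ⊗[k] P)) : p t := by
  induction t using TensorProduct.induction_on with
  | zero => exact zero
  | add s t hs ht => exact add s t hs ht
  | tmul x t =>
    induction t using TensorProduct.induction_on with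
    | zero => simpa using zero
    | add s t hs ht => rw [TensorProduct.tmul_add]; exact add _ _ hs ht
    | tmul y z => exact tmul x y z

/-- To prove a property of a fourfold tensor it suffices to treat pure tensors. -/
theorem tensor_induction₄ {p : H ⊗[k] (H ⊗[k] (H ⊗[k] H)) → Prop} (zero : p 0)
    (add : ∀ s t, p s → p t → p (s + t))
    (tmul : ∀ x y z w, p (x ⊗ₜ[k] (y ⊗ₜ[k] (z ⊗ₜ[k] w))))
    (t : H ⊗[k] (H ⊗[k] (H ⊗[k] H))) : p t := by
  induction t using tensor_induction₃ with
  | zero => exact zero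
  | add s t hs ht => exact add s t hs ht
  | tmul x y t =>
    induction t using TensorProduct.induction_on with
    | zero => simpa using zero
    | add s t hs ht => rw [TensorProduct.tmul_add, TensorProduct.tmul_add]; exact add _ _ hs ht
    | tmul z w => exact tmul x y z w

/-- The contraction `x ⊗ y ↦ F x * G y`. -/
def con₂ {M N : Type*} [AddCommGroup M] [Module k M] [AddCommGroup N] [Module k N]
    (F : M →ₗ[k] B) (G : N →ₗ[k] B) : M ⊗[k] N →ₗ[k] B :=
  LinearMap.mul' k B ∘ₗ TensorProduct.map F G

@[simp]
theorem con₂_tmul {M N : Type*} [AddCommGroup M] [Module k M] [AddCommGroup N] [Module k N]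
    (F : M →ₗ[k] B) (G : N →ₗ[k] B) (x : M) (y : N) : con₂ F G (x ⊗ₜ[k] y) = F x * G y := by
  simp [con₂]

/-- The contraction `x ⊗ y ⊗ z ↦ F₁ x * F₂ y * F₃ z`. -/
def con₃ (F₁ F₂ F₃ : H →ₗ[k] B) : H ⊗[k] (H ⊗[k] H) →ₗ[k] B := con₂ F₁ (con₂ F₂ F₃)

@[simp]
theorem con₃_tmul (F₁ F₂ F₃ : H →ₗ[k] B) (x y z : H) :
    con₃ F₁ F₂ F₃ (x ⊗ₜ[k] (y ⊗ₜ[k] z)) = F₁ x * (F₂ y * F₃ z) := by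
  simp [con₃]

/-- The contraction `x ⊗ y ⊗ z ⊗ w ↦ F₁ x * F₂ y * F₃ z * F₄ w`. -/
def con₄ (F₁ F₂ F₃ F₄ : H →ₗ[k] B) : H ⊗[k] (H ⊗[k] (H ⊗[k] H)) →ₗ[k] B :=
  con₂ F₁ (con₃ F₂ F₃ F₄)

@[simp]
theorem con₄_tmul (F₁ F₂ F₃ F₄ : H →ₗ[k] B) (x y z w : H) :
    con₄ F₁ F₂ F₃ F₄ (x ⊗ₜ[k] (y ⊗ₜ[k] (z ⊗ₜ[k] w))) = F₁ x * (F₂ y * (F₃ z * F₄ w)) := by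
  simp [con₄]

end Contractions

namespace QuasiHopfAlgebra

variable {k H : Type*} [Field k] [Ring H] [Algebra k H] (Q : QuasiHopfAlgebra k H)

/-! ### Coherence of the reassociator -/

/-- `Δ ⊗ id` on `H ⊗ H`. -/
def Δ₁₂ : H ⊗[k] H →ₐ[k] H ⊗[k] (H ⊗[k] H) :=
  (Algebra.TensorProduct.assoc k k k H H H).toAlgHom.comp
    (Algebra.TensorProduct.map Q.comul (AlgHom.id k H))

/-- `id ⊗ Δ` on `H ⊗ H`. -/
def Δ₂₃ : H ⊗[k] H →ₐ[k] H ⊗[k] (H ⊗[k] H) :=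
  Algebra.TensorProduct.map (AlgHom.id k H) Q.comul

/-- `Δ ⊗ id ⊗ id` on `H ⊗ H ⊗ H`. -/
def Δ₁₂' : H ⊗[k] (H ⊗[k] H) →ₐ[k] H ⊗[k] (H ⊗[k] (H ⊗[k] H)) :=
  (Algebra.TensorProduct.assoc k k k H H (H ⊗[k] H)).toAlgHom.comp
    (Algebra.TensorProduct.map Q.comul (AlgHom.id k (H ⊗[k] H)))

/-- `id ⊗ Δ ⊗ id` on `H ⊗ H ⊗ H`. -/
def Δ₂₃' : H ⊗[k] (H ⊗[k] H) →ₐ[k] H ⊗[k] (H ⊗[k] (H ⊗[k] H)) :=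
  Algebra.TensorProduct.map (AlgHom.id k H) Q.Δ₁₂

/-- `id ⊗ id ⊗ Δ` on `H ⊗ H ⊗ H`. -/
def Δ₃₄' : H ⊗[k] (H ⊗[k] H) →ₐ[k] H ⊗[k] (H ⊗[k] (H ⊗[k] H)) :=
  Algebra.TensorProduct.map (AlgHom.id k H) Q.Δ₂₃

variable (k H) in
/-- `t ↦ t ⊗ 1` from `H ⊗ H` to `H ⊗ H ⊗ H`. -/
def ι₁₂ : H ⊗[k] H →ₐ[k] H ⊗[k] (H ⊗[k] H) :=
  (Algebra.TensorProduct.assoc k k k H H H).toAlgHom.comp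
    Algebra.TensorProduct.includeLeft

variable (k H) in
/-- `t ↦ 1 ⊗ t` from `H ⊗ H` to `H ⊗ H ⊗ H`. -/
def ι₂₃ : H ⊗[k] H →ₐ[k] H ⊗[k] (H ⊗[k] H) := Algebra.TensorProduct.includeRight

variable (k H) in
/-- `t ↦ t ⊗ 1` from `H ⊗ H ⊗ H` to `H ⊗ H ⊗ H ⊗ H`. -/
def ι₁₂₃ : H ⊗[k] (H ⊗[k] H) →ₐ[k] H ⊗[k] (H ⊗[k] (H ⊗[k] H)) :=
  Algebra.TensorProduct.map (AlgHom.id k H) (ι₁₂ k H)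

variable (k H) in
/-- `t ↦ 1 ⊗ t` from `H ⊗ H ⊗ H` to `H ⊗ H ⊗ H ⊗ H`. -/
def ι₂₃₄ : H ⊗[k] (H ⊗[k] H) →ₐ[k] H ⊗[k] (H ⊗[k] (H ⊗[k] H)) :=
  Algebra.TensorProduct.includeRight

theorem Δ₁₂_tmul (x y : H) :
    Q.Δ₁₂ (x ⊗ₜ y) = TensorProduct.assoc k H H H (Q.comul x ⊗ₜ y) := rfl

theorem Δ₂₃_tmul (x y : H) : Q.Δ₂₃ (x ⊗ₜ[k] y) = x ⊗ₜ Q.comul y := rfl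

theorem Δ₁₂'_tmul (x : H) (t : H ⊗[k] H) :
    Q.Δ₁₂' (x ⊗ₜ t) = TensorProduct.assoc k H H (H ⊗[k] H) (Q.comul x ⊗ₜ t) := rfl

theorem Δ₂₃'_tmul (x : H) (t : H ⊗[k] H) : Q.Δ₂₃' (x ⊗ₜ[k] t) = x ⊗ₜ Q.Δ₁₂ t := rfl

theorem Δ₃₄'_tmul (x : H) (t : H ⊗[k] H) : Q.Δ₃₄' (x ⊗ₜ[k] t) = x ⊗ₜ Q.Δ₂₃ t := rfl

@[simp]
theorem ι₁₂_tmul (x y : H) : ι₁₂ k H (x ⊗ₜ y) = x ⊗ₜ (y ⊗ₜ 1) := rfl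

@[simp]
theorem ι₂₃_apply (t : H ⊗[k] H) : ι₂₃ k H t = 1 ⊗ₜ t := rfl

@[simp]
theorem ι₁₂₃_tmul (x y z : H) : ι₁₂₃ k H (x ⊗ₜ (y ⊗ₜ z)) = x ⊗ₜ (y ⊗ₜ (z ⊗ₜ 1)) := rfl

@[simp]
theorem ι₂₃₄_apply (t : H ⊗[k] (H ⊗[k] H)) : ι₂₃₄ k H t = 1 ⊗ₜ t := rfl

/-- The reassociator as an element of `H ⊗ H ⊗ H`. -/
def Φ : H ⊗[k] (H ⊗[k] H) := Q.φ

@[simp]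
theorem Φ_mul_φinv : Q.Φ * Q.φinv = 1 := Q.φ.mul_inv

@[simp]
theorem φinv_mul_Φ : Q.φinv * Q.Φ = 1 := Q.φ.inv_mul

theorem map_Φ_mul_map_φinv {A : Type*} [Ring A] [Algebra k A] (F : H ⊗[k] (H ⊗[k] H) →ₐ[k] A) :
    F Q.Φ * F Q.φinv = 1 := by
  rw [← map_mul, Φ_mul_φinv, map_one]

theorem map_φinv_mul_map_Φ {A : Type*} [Ring A] [Algebra k A] (F : H ⊗[k] (H ⊗[k] H) →ₐ[k] A) :
    F Q.φinv * F Q.Φ = 1 := by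
  rw [← map_mul, φinv_mul_Φ, map_one]

theorem Δ₂₃_comul_mul_Φ (a : H) :
    Q.Δ₂₃ (Q.comul a) * Q.Φ = Q.Φ * Q.Δ₁₂ (Q.comul a) :=
  Q.quasi_coassoc a

theorem φinv_mul_Δ₂₃_comul (a : H) :
    Q.φinv * Q.Δ₂₃ (Q.comul a) = Q.Δ₁₂ (Q.comul a) * Q.φinv := by
  calc Q.φinv * Q.Δ₂₃ (Q.comul a)
      = Q.φinv * (Q.Δ₂₃ (Q.comul a) * Q.Φ) * Q.φinv := by
        rw [mul_assoc, mul_assoc, Φ_mul_φinv, mul_one]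
    _ = Q.φinv * Q.Φ * Q.Δ₁₂ (Q.comul a) * Q.φinv := by
        rw [Δ₂₃_comul_mul_Φ]
        simp only [mul_assoc]
    _ = _ := by rw [φinv_mul_Φ, one_mul]

/-- The pentagon axiom in terms of the algebra morphisms `Δᵢⱼ'` and `ι`. -/
theorem pentagon' :
    Q.Δ₃₄' Q.Φ * Q.Δ₁₂' Q.Φ = ι₂₃₄ k H Q.Φ * Q.Δ₂₃' Q.Φ * ι₁₂₃ k H Q.Φ := by
  have h1 : ∀ t : H ⊗[k] (H ⊗[k] H), TensorProduct.map LinearMap.id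
      (TensorProduct.assoc k H H H).toLinearMap
        (Algebra.TensorProduct.map (AlgHom.id k H)
          (Algebra.TensorProduct.map Q.comul (AlgHom.id k H)) t) = Q.Δ₂₃' t := by
    intro t
    induction t using TensorProduct.induction_on with
    | zero => simp
    | add s t hs ht => simp only [map_add, hs, ht]
    | tmul x t => rfl
  have h2 : ∀ t : H ⊗[k] (H ⊗[k] H), TensorProduct.map LinearMap.id
      (TensorProduct.assoc k H H H).toLinearMap
        (TensorProduct.assoc k H (H ⊗[k] H) H (t ⊗ₜ[k] (1 : H))) = ι₁₂₃ k H t := by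
    intro t
    induction t using TensorProduct.induction_on with
    | zero => simp
    | add s t hs ht => simp only [map_add, TensorProduct.add_tmul, hs, ht]
    | tmul x t => rfl
  have := Q.pentagon
  rw [h1, h2] at this
  exact this

/-- `ε ⊗ id ⊗ id`. -/
def ε₁ : H ⊗[k] (H ⊗[k] H) →ₐ[k] H ⊗[k] H :=
  (Algebra.TensorProduct.lid k (H ⊗[k] H)).toAlgHom.comp
    (Algebra.TensorProduct.map Q.counit (AlgHom.id k (H ⊗[k] H)))

/-- `ε ⊗ id`. -/
def εl : H ⊗[k] H →ₐ[k] H :=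
  (Algebra.TensorProduct.lid k H).toAlgHom.comp
    (Algebra.TensorProduct.map Q.counit (AlgHom.id k H))

/-- `id ⊗ ε`. -/
def εr : H ⊗[k] H →ₐ[k] H :=
  (Algebra.TensorProduct.rid k k H).toAlgHom.comp
    (Algebra.TensorProduct.map (AlgHom.id k H) Q.counit)

/-- `id ⊗ ε ⊗ id`. -/
def ε₂ : H ⊗[k] (H ⊗[k] H) →ₐ[k] H ⊗[k] H :=
  Algebra.TensorProduct.map (AlgHom.id k H) Q.εl

/-- `id ⊗ id ⊗ ε`. -/
def ε₃ : H ⊗[k] (H ⊗[k] H) →ₐ[k] H ⊗[k] H :=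
  Algebra.TensorProduct.map (AlgHom.id k H) Q.εr

@[simp]
theorem εl_tmul (x y : H) : Q.εl (x ⊗ₜ[k] y) = Q.counit x • y := by simp [εl]

@[simp]
theorem εr_tmul (x y : H) : Q.εr (x ⊗ₜ[k] y) = Q.counit y • x := by simp [εr]

@[simp]
theorem ε₁_tmul (x : H) (t : H ⊗[k] H) : Q.ε₁ (x ⊗ₜ[k] t) = Q.counit x • t := by simp [ε₁]

@[simp]
theorem ε₂_tmul (x : H) (t : H ⊗[k] H) : Q.ε₂ (x ⊗ₜ[k] t) = x ⊗ₜ Q.εl t := rfl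

@[simp]
theorem ε₃_tmul (x : H) (t : H ⊗[k] H) : Q.ε₃ (x ⊗ₜ[k] t) = x ⊗ₜ Q.εr t := rfl

@[simp]
theorem εl_comul (x : H) : Q.εl (Q.comul x) = x := Q.counit_comul x

@[simp]
theorem εr_comul (x : H) : Q.εr (Q.comul x) = x := Q.comul_counit x

@[simp]
theorem ε₂_Φ : Q.ε₂ Q.Φ = 1 := Q.counit_φ

/-- `(ε ⊗ id ⊗ id)(φ) = 1`, obtained by applying `id ⊗ ε ⊗ id ⊗ id` to the pentagon. -/
@[simp]
theorem ε₁_Φ : Q.ε₁ Q.Φ = 1 := by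
  let F : H ⊗[k] (H ⊗[k] (H ⊗[k] H)) →ₐ[k] H ⊗[k] (H ⊗[k] H) :=
    Algebra.TensorProduct.map (AlgHom.id k H) Q.ε₁
  have hF : ∀ x t, F (x ⊗ₜ t) = x ⊗ₜ Q.ε₁ t := fun _ _ => rfl
  have h1 : ∀ t, F (Q.Δ₃₄' t) = Q.Δ₂₃ (Q.ε₂ t) := by
    intro t
    induction t using tensor_induction₃ with
    | zero => simp
    | add s t hs ht => simp only [map_add, hs, ht]
    | tmul x y z => simp [hF, Δ₃₄'_tmul, Δ₂₃_tmul]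
  have h2 : ∀ t, F (Q.Δ₁₂' t) = t := by
    intro t
    induction t using TensorProduct.induction_on with
    | zero => simp
    | add s t hs ht => simp only [map_add, hs, ht]
    | tmul x t =>
      have : ∀ w : H ⊗[k] H, F (TensorProduct.assoc k H H (H ⊗[k] H) (w ⊗ₜ t)) = Q.εr w ⊗ₜ t := by
        intro w
        induction w using TensorProduct.induction_on with
        | zero => simp
        | add s t hs ht => simp only [map_add, TensorProduct.add_tmul, hs, ht]
        | tmul a b => simp [hF, TensorProduct.smul_tmul']
      rw [Δ₁₂'_tmul, this, εr_comul]
  have h3 : ∀ t, F (Q.Δ₂₃' t) = t := by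
    intro t
    induction t using tensor_induction₃ with
    | zero => simp
    | add s t hs ht => simp only [map_add, hs, ht]
    | tmul x y z =>
      have : ∀ w : H ⊗[k] H, Q.ε₁ (TensorProduct.assoc k H H H (w ⊗ₜ z)) = Q.εl w ⊗ₜ z := by
        intro w
        induction w using TensorProduct.induction_on with
        | zero => simp
        | add s t hs ht => simp only [map_add, TensorProduct.add_tmul, hs, ht]
        | tmul a b => simp [TensorProduct.smul_tmul']
      rw [Δ₂₃'_tmul, hF, Δ₁₂_tmul, this, εl_comul]
  have h4 : ∀ t, F (ι₁₂₃ k H t) = ι₁₂ k H (Q.ε₂ t) := by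
    intro t
    induction t using tensor_induction₃ with
    | zero => simp
    | add s t hs ht => simp only [map_add, hs, ht]
    | tmul x y z => simp [hF]
  have h := congrArg F Q.pentagon'
  rw [map_mul, map_mul, map_mul, h1, h2, h3, h4, ε₂_Φ, map_one, map_one, one_mul, mul_one,
    ι₂₃₄_apply, hF] at h
  have h5 : (1 : H) ⊗ₜ[k] Q.ε₁ Q.Φ = 1 := by
    calc (1 : H) ⊗ₜ[k] Q.ε₁ Q.Φ = (1 : H) ⊗ₜ[k] Q.ε₁ Q.Φ * Q.Φ * Q.φinv := by
          rw [mul_assoc, Φ_mul_φinv, mul_one]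
      _ = 1 := by rw [← h, Φ_mul_φinv]
  simpa using congrArg Q.ε₁ h5

/-- `(id ⊗ id ⊗ ε)(φ) = 1`, obtained by applying `id ⊗ id ⊗ ε ⊗ id` to the pentagon. -/
@[simp]
theorem ε₃_Φ : Q.ε₃ Q.Φ = 1 := by
  let F : H ⊗[k] (H ⊗[k] (H ⊗[k] H)) →ₐ[k] H ⊗[k] (H ⊗[k] H) :=
    Algebra.TensorProduct.map (AlgHom.id k H) Q.ε₂
  have hF : ∀ x t, F (x ⊗ₜ t) = x ⊗ₜ Q.ε₂ t := fun _ _ => rfl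
  have h1 : ∀ t, F (Q.Δ₃₄' t) = t := by
    intro t
    induction t using tensor_induction₃ with
    | zero => simp
    | add s t hs ht => simp only [map_add, hs, ht]
    | tmul x y z => simp [hF, Δ₃₄'_tmul, Δ₂₃_tmul]
  have h2 : ∀ t, F (Q.Δ₁₂' t) = Q.Δ₁₂ (Q.ε₂ t) := by
    intro t
    induction t using tensor_induction₃ with
    | zero => simp
    | add s t hs ht => simp only [map_add, hs, ht]
    | tmul x y z =>
      rw [Δ₁₂'_tmul, ε₂_tmul, Δ₁₂_tmul, εl_tmul]
      generalize Q.comul x = w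
      induction w using TensorProduct.induction_on with
      | zero => simp
      | add s t hs ht => simp only [map_add, TensorProduct.add_tmul, hs, ht]
      | tmul a b => simp [hF]
  have h3 : ∀ t, F (Q.Δ₂₃' t) = t := by
    intro t
    induction t using tensor_induction₃ with
    | zero => simp
    | add s t hs ht => simp only [map_add, hs, ht]
    | tmul x y z =>
      have : ∀ w : H ⊗[k] H, Q.ε₂ (TensorProduct.assoc k H H H (w ⊗ₜ z)) = Q.εr w ⊗ₜ z := by
        intro w
        induction w using TensorProduct.induction_on with
        | zero => simp
        | add s t hs ht => simp only [map_add, TensorProduct.add_tmul, hs, ht]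
        | tmul a b => simp [TensorProduct.smul_tmul']
      rw [Δ₂₃'_tmul, hF, Δ₁₂_tmul, this, εr_comul]
  have h4 : ∀ t, F (ι₁₂₃ k H t) = ι₁₂ k H (Q.ε₃ t) := by
    intro t
    induction t using tensor_induction₃ with
    | zero => simp
    | add s t hs ht => simp only [map_add, hs, ht]
    | tmul x y z => simp [hF]
  have h := congrArg F Q.pentagon'
  rw [map_mul, map_mul, map_mul, h1, h2, h3, h4, ε₂_Φ, map_one, ι₂₃₄_apply, hF, ε₂_Φ,
    ← Algebra.TensorProduct.one_def, one_mul, mul_one] at h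
  have h5 : ι₁₂ k H (Q.ε₃ Q.Φ) = 1 := by
    calc ι₁₂ k H (Q.ε₃ Q.Φ) = Q.φinv * (Q.Φ * ι₁₂ k H (Q.ε₃ Q.Φ)) := by
          rw [← mul_assoc, φinv_mul_Φ, one_mul]
      _ = 1 := by rw [← h, φinv_mul_Φ]
  have h6 : ∀ t, Q.ε₃ (ι₁₂ k H t) = t := by
    intro t
    induction t using TensorProduct.induction_on with
    | zero => simp
    | add s t hs ht => simp only [map_add, hs, ht]
    | tmul x y => simp
  rw [← h6 (Q.ε₃ Q.Φ), h5, map_one]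

theorem map_φinv_eq_one {A : Type*} [Ring A] [Algebra k A] (F : H ⊗[k] (H ⊗[k] H) →ₐ[k] A)
    (h : F Q.Φ = 1) : F Q.φinv = 1 := by
  simpa [h] using Q.map_Φ_mul_map_φinv F

end QuasiHopfAlgebra

namespace QuasiHopfAlgebra

variable {k H : Type*} [Field k] [Ring H] [Algebra k H] (Q : QuasiHopfAlgebra k H)
variable {B : Type*} [Ring B] [Algebra k B]

/-! ### Collapsing a coproduct inside a contraction -/

/-- `t ↦ 1 ⊗ 1 ⊗ t`. -/
def ι₃₄' : H ⊗[k] H →ₐ[k] H ⊗[k] (H ⊗[k] (H ⊗[k] H)) := (ι₂₃₄ k H).comp (ι₂₃ k H)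

/-- `t ↦ 1 ⊗ t ⊗ 1`. -/
def ι₂₃' : H ⊗[k] H →ₐ[k] H ⊗[k] (H ⊗[k] (H ⊗[k] H)) := (ι₂₃₄ k H).comp (ι₁₂ k H)

/-- `t ↦ t ⊗ 1 ⊗ 1`. -/
def ι₁₂' : H ⊗[k] H →ₐ[k] H ⊗[k] (H ⊗[k] (H ⊗[k] H)) := (ι₁₂₃ k H).comp (ι₁₂ k H)

/-- `x ⊗ y ↦ x ⊗ 1 ⊗ 1 ⊗ y`. -/
def ι₁₄' : H ⊗[k] H →ₐ[k] H ⊗[k] (H ⊗[k] (H ⊗[k] H)) :=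
  Algebra.TensorProduct.map (AlgHom.id k H) ((ι₂₃ k H).comp Algebra.TensorProduct.includeRight)

@[simp]
theorem ι₃₄'_apply (t : H ⊗[k] H) : ι₃₄' t = (1 : H) ⊗ₜ ((1 : H) ⊗ₜ t) := rfl

@[simp]
theorem ι₂₃'_tmul (x y : H) : ι₂₃' (x ⊗ₜ[k] y) = 1 ⊗ₜ (x ⊗ₜ (y ⊗ₜ 1)) := rfl

@[simp]
theorem ι₁₂'_tmul (x y : H) : ι₁₂' (x ⊗ₜ[k] y) = x ⊗ₜ (y ⊗ₜ (1 ⊗ₜ 1)) := rfl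

@[simp]
theorem ι₁₄'_tmul (x y : H) : ι₁₄' (x ⊗ₜ[k] y) = x ⊗ₜ (1 ⊗ₜ (1 ⊗ₜ y)) := rfl

theorem Δ₁₂'_tmul_eq_left (x : H) (t : H ⊗[k] H) :
    Q.Δ₁₂' (x ⊗ₜ t) = ι₁₂' (Q.comul x) * ι₃₄' t := by
  rw [Δ₁₂'_tmul]
  generalize Q.comul x = w
  induction w using TensorProduct.induction_on with
  | zero => simp
  | add s t hs ht => simp only [map_add, TensorProduct.add_tmul, hs, ht, add_mul]
  | tmul a b => simp [← Algebra.TensorProduct.one_def]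

theorem Δ₁₂'_tmul_eq_right (x : H) (t : H ⊗[k] H) :
    Q.Δ₁₂' (x ⊗ₜ t) = ι₃₄' t * ι₁₂' (Q.comul x) := by
  rw [Δ₁₂'_tmul]
  generalize Q.comul x = w
  induction w using TensorProduct.induction_on with
  | zero => simp
  | add s t hs ht => simp only [map_add, TensorProduct.add_tmul, hs, ht, mul_add]
  | tmul a b => simp [← Algebra.TensorProduct.one_def]

theorem Δ₂₃'_tmul_eq_left (x y z : H) :
    Q.Δ₂₃' (x ⊗ₜ (y ⊗ₜ z)) = ι₂₃' (Q.comul y) * ι₁₄' (x ⊗ₜ[k] z) := by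
  rw [Δ₂₃'_tmul, Δ₁₂_tmul]
  generalize Q.comul y = w
  induction w using TensorProduct.induction_on with
  | zero => simp
  | add s t hs ht =>
    simp only [map_add, TensorProduct.add_tmul, TensorProduct.tmul_add, hs, ht, add_mul]
  | tmul a b => simp

theorem Δ₂₃'_tmul_eq_right (x y z : H) :
    Q.Δ₂₃' (x ⊗ₜ (y ⊗ₜ z)) = ι₁₄' (x ⊗ₜ[k] z) * ι₂₃' (Q.comul y) := by
  rw [Δ₂₃'_tmul, Δ₁₂_tmul]
  generalize Q.comul y = w
  induction w using TensorProduct.induction_on with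
  | zero => simp
  | add s t hs ht =>
    simp only [map_add, TensorProduct.add_tmul, TensorProduct.tmul_add, hs, ht, mul_add]
  | tmul a b => simp

theorem Δ₃₄'_tmul_eq_left (x y z : H) :
    Q.Δ₃₄' (x ⊗ₜ (y ⊗ₜ z)) = ι₃₄' (Q.comul z) * ι₁₂' (x ⊗ₜ[k] y) := by
  simp [Δ₃₄'_tmul, Δ₂₃_tmul, ← Algebra.TensorProduct.one_def]

theorem Δ₃₄'_tmul_eq_right (x y z : H) :
    Q.Δ₃₄' (x ⊗ₜ (y ⊗ₜ z)) = ι₁₂' (x ⊗ₜ[k] y) * ι₃₄' (Q.comul z) := by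
  simp [Δ₃₄'_tmul, Δ₂₃_tmul, ← Algebra.TensorProduct.one_def]

section Collapse

variable {Q}
variable {Ω : H ⊗[k] (H ⊗[k] (H ⊗[k] H)) →ₗ[k] B}

/-- If a linear map `Ω` on fourfold tensors absorbs `Δ(x) ⊗ 1 ⊗ 1` multiplied from the left, then it
absorbs every `(Δ ⊗ id ⊗ id)(t)` with `(ε ⊗ id ⊗ id)(t) = 1`, in particular those with
`t = φ^{±1}`. The lemmas below are the variants for the other sides and tensor factors. -/
theorem collapse₁₂_left
    (hΩ : ∀ x u, Ω (ι₁₂' (Q.comul x) * u) = Q.counit x • Ω u)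
    {t : H ⊗[k] (H ⊗[k] H)} (ht : Q.ε₁ t = 1) (u) : Ω (Q.Δ₁₂' t * u) = Ω u := by
  have key : Ω (Q.Δ₁₂' t * u) = Ω (ι₃₄' (Q.ε₁ t) * u) := by
    clear ht
    induction t using TensorProduct.induction_on with
    | zero => simp
    | add s t hs ht => simp only [map_add, add_mul, hs, ht]
    | tmul x t => rw [Δ₁₂'_tmul_eq_left, mul_assoc, hΩ, ε₁_tmul, map_smul, smul_mul_assoc, map_smul]
  rw [key, ht, map_one, one_mul]

theorem collapse₁₂_right
    (hΩ : ∀ x u, Ω (u * ι₁₂' (Q.comul x)) = Q.counit x • Ω u)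
    {t : H ⊗[k] (H ⊗[k] H)} (ht : Q.ε₁ t = 1) (u) : Ω (u * Q.Δ₁₂' t) = Ω u := by
  have key : Ω (u * Q.Δ₁₂' t) = Ω (u * ι₃₄' (Q.ε₁ t)) := by
    clear ht
    induction t using TensorProduct.induction_on with
    | zero => simp
    | add s t hs ht => simp only [map_add, mul_add, hs, ht]
    | tmul x t =>
      rw [Δ₁₂'_tmul_eq_right, ← mul_assoc, hΩ, ε₁_tmul, map_smul, mul_smul_comm, map_smul]
  rw [key, ht, map_one, mul_one]

theorem collapse₂₃_left
    (hΩ : ∀ x u, Ω (ι₂₃' (Q.comul x) * u) = Q.counit x • Ω u)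
    {t : H ⊗[k] (H ⊗[k] H)} (ht : Q.ε₂ t = 1) (u) : Ω (Q.Δ₂₃' t * u) = Ω u := by
  have key : Ω (Q.Δ₂₃' t * u) = Ω (ι₁₄' (Q.ε₂ t) * u) := by
    clear ht
    induction t using tensor_induction₃ with
    | zero => simp
    | add s t hs ht => simp only [map_add, add_mul, hs, ht]
    | tmul x y z =>
      rw [Δ₂₃'_tmul_eq_left, mul_assoc, hΩ, ε₂_tmul, εl_tmul, TensorProduct.tmul_smul, map_smul,
        smul_mul_assoc, map_smul]
  rw [key, ht, map_one, one_mul]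

theorem collapse₂₃_right
    (hΩ : ∀ x u, Ω (u * ι₂₃' (Q.comul x)) = Q.counit x • Ω u)
    {t : H ⊗[k] (H ⊗[k] H)} (ht : Q.ε₂ t = 1) (u) : Ω (u * Q.Δ₂₃' t) = Ω u := by
  have key : Ω (u * Q.Δ₂₃' t) = Ω (u * ι₁₄' (Q.ε₂ t)) := by
    clear ht
    induction t using tensor_induction₃ with
    | zero => simp
    | add s t hs ht => simp only [map_add, mul_add, hs, ht]
    | tmul x y z =>
      rw [Δ₂₃'_tmul_eq_right, ← mul_assoc, hΩ, ε₂_tmul, εl_tmul, TensorProduct.tmul_smul,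
        map_smul, mul_smul_comm, map_smul]
  rw [key, ht, map_one, mul_one]

theorem collapse₃₄_left
    (hΩ : ∀ x u, Ω (ι₃₄' (Q.comul x) * u) = Q.counit x • Ω u)
    {t : H ⊗[k] (H ⊗[k] H)} (ht : Q.ε₃ t = 1) (u) : Ω (Q.Δ₃₄' t * u) = Ω u := by
  have key : Ω (Q.Δ₃₄' t * u) = Ω (ι₁₂' (Q.ε₃ t) * u) := by
    clear ht
    induction t using tensor_induction₃ with
    | zero => simp
    | add s t hs ht => simp only [map_add, add_mul, hs, ht]
    | tmul x y z =>
      rw [Δ₃₄'_tmul_eq_left, mul_assoc, hΩ, ε₃_tmul, εr_tmul, TensorProduct.tmul_smul, map_smul,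
        smul_mul_assoc, map_smul]
  rw [key, ht, map_one, one_mul]

theorem collapse₃₄_right
    (hΩ : ∀ x u, Ω (u * ι₃₄' (Q.comul x)) = Q.counit x • Ω u)
    {t : H ⊗[k] (H ⊗[k] H)} (ht : Q.ε₃ t = 1) (u) : Ω (u * Q.Δ₃₄' t) = Ω u := by
  have key : Ω (u * Q.Δ₃₄' t) = Ω (u * ι₁₂' (Q.ε₃ t)) := by
    clear ht
    induction t using tensor_induction₃ with
    | zero => simp
    | add s t hs ht => simp only [map_add, mul_add, hs, ht]
    | tmul x y z =>
      rw [Δ₃₄'_tmul_eq_right, ← mul_assoc, hΩ, ε₃_tmul, εr_tmul, TensorProduct.tmul_smul,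
        map_smul, mul_smul_comm, map_smul]
  rw [key, ht, map_one, mul_one]

end Collapse

/-! ### Rearrangements of the pentagon -/

/-- The pentagon solved for `φ⁻¹ ⊗ 1`. -/
theorem pentagon_ι₁₂₃_inv :
    ι₁₂₃ k H Q.φinv =
      Q.Δ₁₂' Q.φinv * (Q.Δ₃₄' Q.φinv * (ι₂₃₄ k H Q.Φ * Q.Δ₂₃' Q.Φ)) := by
  have h := congrArg (fun t => Q.Δ₁₂' Q.φinv * (Q.Δ₃₄' Q.φinv * t) * ι₁₂₃ k H Q.φinv) Q.pentagon'
  simp only [mul_assoc, map_Φ_mul_map_φinv, mul_one] at h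
  rw [← mul_assoc (Q.Δ₃₄' Q.φinv), map_φinv_mul_map_Φ, one_mul, ← mul_assoc (Q.Δ₁₂' Q.φinv),
    map_φinv_mul_map_Φ, one_mul] at h
  exact h

/-- The pentagon solved for `1 ⊗ φ⁻¹`. -/
theorem pentagon_ι₂₃₄_inv :
    ι₂₃₄ k H Q.φinv =
      Q.Δ₂₃' Q.Φ * ι₁₂₃ k H Q.Φ * Q.Δ₁₂' Q.φinv * Q.Δ₃₄' Q.φinv := by
  have h := congrArg (fun t => ι₂₃₄ k H Q.φinv * t * Q.Δ₁₂' Q.φinv * Q.Δ₃₄' Q.φinv) Q.pentagon'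
  simp only [mul_assoc] at h
  rw [← mul_assoc (Q.Δ₁₂' Q.Φ), map_Φ_mul_map_φinv, one_mul, map_Φ_mul_map_φinv, mul_one,
    ← mul_assoc (ι₂₃₄ k H Q.φinv), map_φinv_mul_map_Φ, one_mul] at h
  simpa only [mul_assoc] using h

/-- The contraction `x ⊗ y ↦ F x * G y` absorbs a coproduct multiplied from the left. -/
def AbsorbsLeft (F G : H →ₗ[k] B) : Prop :=
  ∀ x y z, con₂ F G (Q.comul x * (y ⊗ₜ z)) = Q.counit x • (F y * G z)

/-- The contraction `x ⊗ y ↦ F x * G y` absorbs a coproduct multiplied from the right. -/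
def AbsorbsRight (F G : H →ₗ[k] B) : Prop :=
  ∀ x y z, con₂ F G ((y ⊗ₜ z) * Q.comul x) = Q.counit x • (F y * G z)

section Con₄

variable {Q}
variable {F₁ F₂ F₃ F₄ : H →ₗ[k] B}

theorem con₄_collapse₁₂_left (h : Q.AbsorbsLeft F₁ F₂)
    {t : H ⊗[k] (H ⊗[k] H)} (ht : Q.ε₁ t = 1) (u) :
    con₄ F₁ F₂ F₃ F₄ (Q.Δ₁₂' t * u) = con₄ F₁ F₂ F₃ F₄ u := by
  refine collapse₁₂_left (fun c u => ?_) ht u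
  induction u using tensor_induction₄ with
  | zero => simp
  | add s t hs ht => simp only [map_add, add_mul, mul_add, hs, ht, smul_add]
  | tmul x y z w =>
    have : ∀ v : H ⊗[k] H, con₄ F₁ F₂ F₃ F₄ (ι₁₂' v * (x ⊗ₜ (y ⊗ₜ (z ⊗ₜ w)))) =
        con₂ F₁ F₂ (v * (x ⊗ₜ y)) * (F₃ z * F₄ w) := by
      intro v
      induction v using TensorProduct.induction_on with
      | zero => simp
      | add s t hs ht => simp only [map_add, add_mul, mul_add, hs, ht]
      | tmul a b => simp [mul_assoc]
    rw [this, h]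
    simp [mul_assoc]

theorem con₄_collapse₂₃_left (h : Q.AbsorbsLeft F₂ F₃)
    {t : H ⊗[k] (H ⊗[k] H)} (ht : Q.ε₂ t = 1) (u) :
    con₄ F₁ F₂ F₃ F₄ (Q.Δ₂₃' t * u) = con₄ F₁ F₂ F₃ F₄ u := by
  refine collapse₂₃_left (fun c u => ?_) ht u
  induction u using tensor_induction₄ with
  | zero => simp
  | add s t hs ht => simp only [map_add, add_mul, mul_add, hs, ht, smul_add]
  | tmul x y z w =>
    have : ∀ v : H ⊗[k] H, con₄ F₁ F₂ F₃ F₄ (ι₂₃' v * (x ⊗ₜ (y ⊗ₜ (z ⊗ₜ w)))) =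
        F₁ x * (con₂ F₂ F₃ (v * (y ⊗ₜ z)) * F₄ w) := by
      intro v
      induction v using TensorProduct.induction_on with
      | zero => simp
      | add s t hs ht => simp only [map_add, add_mul, mul_add, hs, ht]
      | tmul a b => simp [mul_assoc]
    rw [this, h]
    simp [mul_assoc]

theorem con₄_collapse₃₄_left (h : Q.AbsorbsLeft F₃ F₄)
    {t : H ⊗[k] (H ⊗[k] H)} (ht : Q.ε₃ t = 1) (u) :
    con₄ F₁ F₂ F₃ F₄ (Q.Δ₃₄' t * u) = con₄ F₁ F₂ F₃ F₄ u := by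
  refine collapse₃₄_left (fun c u => ?_) ht u
  induction u using tensor_induction₄ with
  | zero => simp
  | add s t hs ht => simp only [map_add, add_mul, mul_add, hs, ht, smul_add]
  | tmul x y z w =>
    have : ∀ v : H ⊗[k] H, con₄ F₁ F₂ F₃ F₄ (ι₃₄' v * (x ⊗ₜ (y ⊗ₜ (z ⊗ₜ w)))) =
        F₁ x * (F₂ y * con₂ F₃ F₄ (v * (z ⊗ₜ w))) := by
      intro v
      induction v using TensorProduct.induction_on with
      | zero => simp
      | add s t hs ht => simp only [map_add, add_mul, mul_add, hs, ht]
      | tmul a b => simp [mul_assoc]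
    rw [this, h]
    simp [mul_assoc]

theorem con₄_collapse₁₂_right (h : Q.AbsorbsRight F₁ F₂)
    {t : H ⊗[k] (H ⊗[k] H)} (ht : Q.ε₁ t = 1) (u) :
    con₄ F₁ F₂ F₃ F₄ (u * Q.Δ₁₂' t) = con₄ F₁ F₂ F₃ F₄ u := by
  refine collapse₁₂_right (fun c u => ?_) ht u
  induction u using tensor_induction₄ with
  | zero => simp
  | add s t hs ht => simp only [map_add, add_mul, mul_add, hs, ht, smul_add]
  | tmul x y z w =>
    have : ∀ v : H ⊗[k] H, con₄ F₁ F₂ F₃ F₄ ((x ⊗ₜ (y ⊗ₜ (z ⊗ₜ w))) * ι₁₂' v) =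
        con₂ F₁ F₂ ((x ⊗ₜ y) * v) * (F₃ z * F₄ w) := by
      intro v
      induction v using TensorProduct.induction_on with
      | zero => simp
      | add s t hs ht => simp only [map_add, add_mul, mul_add, hs, ht]
      | tmul a b => simp [mul_assoc]
    rw [this, h]
    simp [mul_assoc]

theorem con₄_collapse₂₃_right (h : Q.AbsorbsRight F₂ F₃)
    {t : H ⊗[k] (H ⊗[k] H)} (ht : Q.ε₂ t = 1) (u) :
    con₄ F₁ F₂ F₃ F₄ (u * Q.Δ₂₃' t) = con₄ F₁ F₂ F₃ F₄ u := by
  refine collapse₂₃_right (fun c u => ?_) ht u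
  induction u using tensor_induction₄ with
  | zero => simp
  | add s t hs ht => simp only [map_add, add_mul, mul_add, hs, ht, smul_add]
  | tmul x y z w =>
    have : ∀ v : H ⊗[k] H, con₄ F₁ F₂ F₃ F₄ ((x ⊗ₜ (y ⊗ₜ (z ⊗ₜ w))) * ι₂₃' v) =
        F₁ x * (con₂ F₂ F₃ ((y ⊗ₜ z) * v) * F₄ w) := by
      intro v
      induction v using TensorProduct.induction_on with
      | zero => simp
      | add s t hs ht => simp only [map_add, add_mul, mul_add, hs, ht]
      | tmul a b => simp [mul_assoc]
    rw [this, h]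
    simp [mul_assoc]

theorem con₄_collapse₃₄_right (h : Q.AbsorbsRight F₃ F₄)
    {t : H ⊗[k] (H ⊗[k] H)} (ht : Q.ε₃ t = 1) (u) :
    con₄ F₁ F₂ F₃ F₄ (u * Q.Δ₃₄' t) = con₄ F₁ F₂ F₃ F₄ u := by
  refine collapse₃₄_right (fun c u => ?_) ht u
  induction u using tensor_induction₄ with
  | zero => simp
  | add s t hs ht => simp only [map_add, add_mul, mul_add, hs, ht, smul_add]
  | tmul x y z w =>
    have : ∀ v : H ⊗[k] H, con₄ F₁ F₂ F₃ F₄ ((x ⊗ₜ (y ⊗ₜ (z ⊗ₜ w))) * ι₃₄' v) =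
        F₁ x * (F₂ y * con₂ F₃ F₄ ((z ⊗ₜ w) * v)) := by
      intro v
      induction v using TensorProduct.induction_on with
      | zero => simp
      | add s t hs ht => simp only [map_add, add_mul, mul_add, hs, ht]
      | tmul a b => simp [mul_assoc]
    rw [this, h]
    simp [mul_assoc]

end Con₄

end QuasiHopfAlgebra

namespace QuasiHopfAlgebra

variable {k H : Type*} [Field k] [Ring H] [Algebra k H] (Q : QuasiHopfAlgebra k H)
variable {B : Type*} [Ring B] [Algebra k B]

/-! ### Antipodes along an algebra morphism -/

/-- The linear map `x ↦ a * j x * b`. -/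
def mid (a : B) (j : H →ₐ[k] B) (b : B) : H →ₗ[k] B :=
  LinearMap.mulLeft k a ∘ₗ LinearMap.mulRight k b ∘ₗ j.toLinearMap

@[simp]
theorem mid_apply (a : B) (j : H →ₐ[k] B) (b : B) (x : H) : mid a j b x = a * (j x * b) := rfl

/-- `s` together with `a`, `b` plays the role of the antipode (with `α`, `β`) for the algebra
morphism `j : H → B`: it is antimultiplicative, `s(x₁) a j(x₂) = ε(x) a`,
`j(x₁) b s(x₂) = ε(x) b` and `j(X) b s(Y) a j(Z) = 1`. -/
structure IsAntipodeAlong (j : H →ₐ[k] B) (s : H →ₗ[k] B) (a b : B) : Prop where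
  antimul : ∀ x y, s (x * y) = s y * s x
  left : ∀ x, con₂ s (mid a j 1) (Q.comul x) = Q.counit x • a
  right : ∀ x, con₂ (mid 1 j b) s (Q.comul x) = Q.counit x • b
  zigzag : con₃ (mid 1 j b) s
    (mid a j 1) Q.Φ = 1

/-- The element `s'(X̄) a' j(Ȳ) b s(Z̄)` comparing two antipodes along `j`. -/
def twist (j : H →ₐ[k] B) (s' : H →ₗ[k] B) (a' b : B) (s : H →ₗ[k] B) : B :=
  con₃ s' (mid a' j b) s Q.φinv

namespace IsAntipodeAlong

variable {Q}
variable {j : H →ₐ[k] B} {s s' : H →ₗ[k] B} {a b a' b' : B}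

/-- The comparison element intertwines the two antipodes; this is quasi-coassociativity contracted by
`x ⊗ y ⊗ z ↦ s'(x) a' j(y) b s(z)`. -/
theorem twist_mul (h : Q.IsAntipodeAlong j s a b) (h' : Q.IsAntipodeAlong j s' a' b') (x : H) :
    Q.twist j s' a' b s * s x = s' x * Q.twist j s' a' b s := by
  set Ω := con₃ s' (mid a' j b) s with hΩ
  have h1 : ∀ w t, Ω (Q.Δ₁₂ w * t) = Ω t * s (Q.εl w) := by
    intro w t
    induction t using tensor_induction₃ with
    | zero => simp
    | add u v hu hv => simp only [map_add, mul_add, add_mul, hu, hv]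
    | tmul x y z =>
      induction w using TensorProduct.induction_on with
      | zero => simp
      | add u v hu hv => simp only [map_add, mul_add, add_mul, hu, hv]
      | tmul c d =>
        have : ∀ v, Ω (TensorProduct.assoc k H H H (v ⊗ₜ d) * x ⊗ₜ (y ⊗ₜ z)) =
            s' x * con₂ s' (mid a' j 1) v *
              (j y * (b * (s z * s d))) := by
          intro v
          induction v using TensorProduct.induction_on with
          | zero => simp
          | add u v hu hv =>
            simp only [map_add, mul_add, add_mul, hu, hv, TensorProduct.add_tmul]
          | tmul e f => simp [hΩ, h.antimul, h'.antimul, mul_assoc]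
        rw [Δ₁₂_tmul, this, h'.left]
        simp [hΩ, mul_assoc]
  have h2 : ∀ w t, Ω (t * Q.Δ₂₃ w) = s' (Q.εr w) * Ω t := by
    intro w t
    induction t using tensor_induction₃ with
    | zero => simp
    | add u v hu hv => simp only [map_add, mul_add, add_mul, hu, hv]
    | tmul x y z =>
      induction w using TensorProduct.induction_on with
      | zero => simp
      | add u v hu hv => simp only [map_add, mul_add, add_mul, hu, hv]
      | tmul c d =>
        have : ∀ v, Ω ((x ⊗ₜ (y ⊗ₜ z)) * c ⊗ₜ v) =
            s' c * (s' x * (a' * j y)) *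
              con₂ (mid 1 j b) s v * s z := by
          intro v
          induction v using TensorProduct.induction_on with
          | zero => simp
          | add u v hu hv =>
            simp only [map_add, mul_add, add_mul, hu, hv, TensorProduct.tmul_add]
          | tmul e f => simp [hΩ, h.antimul, h'.antimul, mul_assoc]
        rw [Δ₂₃_tmul, this, h.right]
        simp [hΩ, mul_assoc]
  have h3 := congrArg Ω (Q.φinv_mul_Δ₂₃_comul x)
  rw [h1, h2, εl_comul, εr_comul] at h3
  exact h3.symm

theorem absorbsLeft (h : Q.IsAntipodeAlong j s a b) (c : B) : Q.AbsorbsLeft s (mid a j c) := by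
  intro x y z
  have : ∀ v : H ⊗[k] H, con₂ s (mid a j c) (v * (y ⊗ₜ z)) =
      s y * (con₂ s (mid a j 1) v * (j z * c)) := by
    intro v
    induction v using TensorProduct.induction_on with
    | zero => simp
    | add s t hs ht => simp only [map_add, add_mul, mul_add, hs, ht]
    | tmul e f => simp [mul_assoc, h.antimul]
  rw [this, h.left]
  simp

theorem absorbsRight (h : Q.IsAntipodeAlong j s a b) (c : B) : Q.AbsorbsRight (mid c j b) s := by
  intro x y z
  have : ∀ v : H ⊗[k] H, con₂ (mid c j b) s ((y ⊗ₜ z) * v) =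
      c * j y * (con₂ (mid 1 j b) s v * s z) := by
    intro v
    induction v using TensorProduct.induction_on with
    | zero => simp
    | add s t hs ht => simp only [map_add, add_mul, mul_add, hs, ht]
    | tmul e f => simp [mul_assoc, h.antimul]
  rw [this, h.right]
  simp [mul_assoc]

theorem comp (h : Q.IsAntipodeAlong j s a b) {C : Type*} [Ring C] [Algebra k C] (g : B →ₐ[k] C) :
    Q.IsAntipodeAlong (g.comp j) (g.toLinearMap ∘ₗ s) (g a) (g b) where
  antimul x y := by simp [h.antimul]
  left x := by
    have : ∀ v, con₂ (g.toLinearMap ∘ₗ s) (mid (g a) (g.comp j) 1) v =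
        g (con₂ s (mid a j 1) v) := by
      intro v
      induction v using TensorProduct.induction_on with
      | zero => simp
      | add s t hs ht => simp only [map_add, hs, ht]
      | tmul e f => simp
    rw [this, h.left, map_smul]
  right x := by
    have : ∀ v, con₂ (mid 1 (g.comp j) (g b)) (g.toLinearMap ∘ₗ s) v =
        g (con₂ (mid 1 j b) s v) := by
      intro v
      induction v using TensorProduct.induction_on with
      | zero => simp
      | add s t hs ht => simp only [map_add, hs, ht]
      | tmul e f => simp
    rw [this, h.right, map_smul]
  zigzag := by
    have : ∀ v, con₃ (mid 1 (g.comp j) (g b)) (g.toLinearMap ∘ₗ s) (mid (g a) (g.comp j) 1) v =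
        g (con₃ (mid 1 j b) s (mid a j 1) v) := by
      intro v
      induction v using tensor_induction₃ with
      | zero => simp
      | add s t hs ht => simp only [map_add, hs, ht]
      | tmul e f g => simp
    rw [this, h.zigzag, map_one]

/-- The comparison element carries `a` to `a'`. In the expression of `φ⁻¹ ⊗ 1` through the pentagon
the contraction `s'(·) a' j(·) b s(·) a j(·)` absorbs all factors but `1 ⊗ φ`. -/
theorem twist_mul_left (h : Q.IsAntipodeAlong j s a b) (h' : Q.IsAntipodeAlong j s' a' b')
    (h1' : s' 1 = 1) :
    Q.twist j s' a' b s * a = a' := by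
  set Ω := con₄ s' (mid a' j b) s (mid a j 1) with hΩ
  have h1 : ∀ t, Ω (ι₁₂₃ k H t) = con₃ s' (mid a' j b) s t * a := by
    intro t
    induction t using tensor_induction₃ with
    | zero => simp
    | add s t hs ht => simp only [map_add, add_mul, hs, ht]
    | tmul x y z => simp [hΩ, mul_assoc]
  have h2 : ∀ t, Ω (ι₂₃₄ k H t) = a' * con₃ (mid 1 j b) s (mid a j 1) t := by
    intro t
    induction t using tensor_induction₃ with
    | zero => simp
    | add s t hs ht =>
      rw [map_add, map_add, map_add, mul_add, hs, ht]
    | tmul x y z => simp [hΩ, mul_assoc, h1']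
  rw [twist, ← h1, pentagon_ι₁₂₃_inv,
    con₄_collapse₁₂_left (h'.absorbsLeft b) (Q.map_φinv_eq_one _ Q.ε₁_Φ),
    con₄_collapse₃₄_left (h.absorbsLeft 1) (Q.map_φinv_eq_one _ Q.ε₃_Φ),
    con₄_collapse₂₃_right (h.absorbsRight a') Q.ε₂_Φ, h2, h.zigzag, mul_one]

/-- The comparison element carries `b'` to `b`. In the expression of `1 ⊗ φ⁻¹` through the pentagon
the contraction `j(·) b' s'(·) a' j(·) b s(·)` absorbs all factors but `φ ⊗ 1`. -/
theorem mul_twist (h : Q.IsAntipodeAlong j s a b) (h' : Q.IsAntipodeAlong j s' a' b')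
    (h1 : s 1 = 1) :
    b' * Q.twist j s' a' b s = b := by
  set Ω := con₄ (mid 1 j b') s' (mid a' j b) s with hΩ
  have h3 : ∀ t, Ω (ι₁₂₃ k H t) = con₃ (mid 1 j b') s' (mid a' j 1) t * b := by
    intro t
    induction t using tensor_induction₃ with
    | zero => simp
    | add s t hs ht => simp only [map_add, add_mul, hs, ht]
    | tmul x y z => simp [hΩ, mul_assoc, h1]
  have h2 : ∀ t, Ω (ι₂₃₄ k H t) = b' * con₃ s' (mid a' j b) s t := by
    intro t
    induction t using tensor_induction₃ with
    | zero => simp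
    | add s t hs ht =>
      rw [map_add, map_add, map_add, mul_add, hs, ht]
    | tmul x y z => simp [hΩ, mul_assoc]
  rw [twist, ← h2, pentagon_ι₂₃₄_inv,
    con₄_collapse₃₄_right (h.absorbsRight a') (Q.map_φinv_eq_one _ Q.ε₃_Φ),
    con₄_collapse₁₂_right (h'.absorbsRight 1) (Q.map_φinv_eq_one _ Q.ε₁_Φ),
    con₄_collapse₂₃_left (h'.absorbsLeft b) Q.ε₂_Φ, h3, h'.zigzag, one_mul]

/-- If moreover `s(X̄) a j(Ȳ) b s(Z̄) = 1`, then the comparison element has a left inverse. -/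
theorem twist_mul_twist (h : Q.IsAntipodeAlong j s a b) (h' : Q.IsAntipodeAlong j s' a' b')
    (h1 : s 1 = 1) (hs : con₃ s (mid a j b) s Q.φinv = 1) :
    Q.twist j s a b' s' * Q.twist j s' a' b s = 1 := by
  have : ∀ t, con₃ s (mid a j b') s' t * Q.twist j s' a' b s = con₃ s (mid a j b) s t := by
    intro t
    induction t using tensor_induction₃ with
    | zero => simp
    | add s t hs ht => simp only [map_add, add_mul, hs, ht]
    | tmul x y z =>
      simp only [con₃_tmul, mid_apply, mul_assoc]
      rw [← h.twist_mul h', ← mul_assoc b', h.mul_twist h' h1]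
  rw [twist, this, hs]

end IsAntipodeAlong

end QuasiHopfAlgebra

namespace QuasiHopfAlgebra

variable {k H : Type*} [Field k] [Ring H] [Algebra k H] (Q : QuasiHopfAlgebra k H)

/-! ### Canonical elements and Drinfeld's twist -/

theorem isAntipodeAlong_id : Q.IsAntipodeAlong (AlgHom.id k H) Q.S.toLinearMap Q.α Q.β where
  antimul := Q.S_mul
  left x := by
    have h : con₂ Q.S.toLinearMap (mid Q.α (AlgHom.id k H) 1) =
        sandwich k Q.α ∘ₗ TensorProduct.map Q.S.toLinearMap LinearMap.id := by
      ext a b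
      simp [sandwich_tmul, mul_assoc]
    rw [h, LinearMap.comp_apply, Q.S_α]
  right x := by
    have h : con₂ (mid 1 (AlgHom.id k H) Q.β) Q.S.toLinearMap =
        sandwich k Q.β ∘ₗ TensorProduct.map LinearMap.id Q.S.toLinearMap := by
      ext a b
      simp [sandwich_tmul, mul_assoc]
    rw [h, LinearMap.comp_apply, Q.β_S]
  zigzag := by
    have h : con₃ (mid 1 (AlgHom.id k H) Q.β) Q.S.toLinearMap (mid Q.α (AlgHom.id k H) 1) =
        sandwich k Q.β ∘ₗ TensorProduct.map LinearMap.id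
          (sandwich k Q.α ∘ₗ TensorProduct.map Q.S.toLinearMap LinearMap.id) := by
      ext a b c
      simp [sandwich_tmul, mul_assoc]
    rw [h, LinearMap.comp_apply, Φ, Q.φ_β_α]

theorem con₃_S_φinv :
    con₃ Q.S.toLinearMap (mid Q.α (AlgHom.id k H) Q.β) Q.S.toLinearMap Q.φinv = 1 := by
  have h : con₃ Q.S.toLinearMap (mid Q.α (AlgHom.id k H) Q.β) Q.S.toLinearMap =
      sandwich k Q.α ∘ₗ TensorProduct.map Q.S.toLinearMap
        (sandwich k Q.β ∘ₗ TensorProduct.map LinearMap.id Q.S.toLinearMap) := by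
    ext a b c
    simp [sandwich_tmul, mul_assoc]
  rw [h, LinearMap.comp_apply, φinv, Q.φinv_α_β]

variable (k H) in
/-- `x ↦ x ⊗ 1`. -/
def jL : H →ₐ[k] H ⊗[k] H := Algebra.TensorProduct.includeLeft

variable (k H) in
/-- `x ↦ 1 ⊗ x`. -/
def jR : H →ₐ[k] H ⊗[k] H := Algebra.TensorProduct.includeRight

@[simp] theorem jL_apply (x : H) : jL k H x = x ⊗ₜ 1 := rfl

@[simp] theorem jR_apply (x : H) : jR k H x = 1 ⊗ₜ x := rfl

/-- `x ↦ S x ⊗ 1`. -/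
def SL : H →ₗ[k] H ⊗[k] H := (jL k H).toLinearMap ∘ₗ Q.S.toLinearMap

/-- `x ↦ 1 ⊗ S x`. -/
def SR : H →ₗ[k] H ⊗[k] H := (jR k H).toLinearMap ∘ₗ Q.S.toLinearMap

@[simp] theorem SL_apply (x : H) : Q.SL x = Q.S x ⊗ₜ 1 := rfl

@[simp] theorem SR_apply (x : H) : Q.SR x = 1 ⊗ₜ Q.S x := rfl

theorem isAntipodeAlong_jL : Q.IsAntipodeAlong (jL k H) Q.SL (jL k H Q.α) (jL k H Q.β) :=
  Q.isAntipodeAlong_id.comp (jL k H)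

theorem isAntipodeAlong_jR : Q.IsAntipodeAlong (jR k H) Q.SR (jR k H Q.α) (jR k H Q.β) :=
  Q.isAntipodeAlong_id.comp (jR k H)

theorem isAntipodeAlong_comul :
    Q.IsAntipodeAlong Q.comul (Q.comul.toLinearMap ∘ₗ Q.S.toLinearMap)
      (Q.comul Q.α) (Q.comul Q.β) :=
  Q.isAntipodeAlong_id.comp Q.comul

@[simp] theorem SSop_tmul (x y : H) : Q.SSop (x ⊗ₜ y) = Q.S y ⊗ₜ Q.S x := rfl

theorem SSop_mul (s t : H ⊗[k] H) : Q.SSop (s * t) = Q.SSop t * Q.SSop s := by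
  induction s using TensorProduct.induction_on with
  | zero => simp
  | add s s' hs hs' => simp only [add_mul, mul_add, map_add, hs, hs']
  | tmul x y =>
    induction t using TensorProduct.induction_on with
    | zero => simp
    | add s s' hs hs' => simp only [add_mul, mul_add, map_add, hs, hs']
    | tmul z w => simp [Q.S_mul]

@[simp] theorem SSop_one : Q.SSop 1 = 1 := by
  simp [Algebra.TensorProduct.one_def, Q.S_one]

/-- The map `x ↦ S(x₂) ⊗ S(x₁)`. -/
def SSΔ : H →ₗ[k] H ⊗[k] H := Q.SSop ∘ₗ Q.comul.toLinearMap

@[simp] theorem SSΔ_apply (x : H) : Q.SSΔ x = Q.SSop (Q.comul x) := rfl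

/-- `q_L = S(X̄) α Ȳ ⊗ Z̄`. -/
def qL : H ⊗[k] H := con₃ Q.SL (mid (jL k H Q.α) (jL k H) 1) (jR k H).toLinearMap Q.φinv

/-- `(S ⊗ S)(q_R²¹) = S(Y) α Z ⊗ S(X)`. -/
def Sq : H ⊗[k] H := con₃ Q.SR Q.SL (mid (jL k H Q.α) (jL k H) 1) Q.Φ

theorem SSop_qR : Q.SSop Q.qR = Q.Sq := by
  rw [qR, Sq, ← LinearMap.comp_apply, Φ]
  congr 1
  ext x y z
  simp [Sinvαmul_tmul, Sinv, Q.S_mul, mul_assoc]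

theorem pR_eq_con₃ :
    Q.pR = con₃ (jL k H).toLinearMap (mid 1 (jR k H) (jR k H Q.β)) Q.SR Q.φinv := by
  rw [pR]
  congr 1
  ext x y z
  simp [mulβS_tmul, mul_assoc]

/-- `Δ(a₁) p_R (1 ⊗ S(a₂)) = p_R (a ⊗ 1)`. -/
theorem comul_mul_pR (a : H) :
    con₂ Q.comul.toLinearMap (LinearMap.mulLeft k Q.pR ∘ₗ Q.SR) (Q.comul a) =
      Q.pR * (a ⊗ₜ 1) := by
  set π := con₃ (jL k H).toLinearMap (mid 1 (jR k H) (jR k H Q.β)) Q.SR with hπ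
  have h1 : ∀ w t, π (Q.Δ₁₂ w * t) =
      con₂ Q.comul.toLinearMap (LinearMap.mulLeft k (π t) ∘ₗ Q.SR) w := by
    intro w t
    induction w using TensorProduct.induction_on with
    | zero => simp
    | add u v hu hv => simp only [map_add, add_mul, hu, hv]
    | tmul c d =>
      rw [Δ₁₂_tmul, con₂_tmul, AlgHom.toLinearMap_apply]
      generalize Q.comul c = v
      induction v using TensorProduct.induction_on with
      | zero => simp
      | add u v hu hv => simp only [map_add, add_mul, TensorProduct.add_tmul, hu, hv]
      | tmul e f =>
        induction t using tensor_induction₃ with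
        | zero => simp
        | add u v hu hv =>
          rw [mul_add, map_add, hu, hv]
          simp [mul_add, add_mul]
        | tmul x y z => simp [hπ, Q.S_mul, mul_assoc]
  have h2 : ∀ w t, π (t * Q.Δ₂₃ w) = π t * (Q.εr w ⊗ₜ 1) := by
    intro w t
    induction w using TensorProduct.induction_on with
    | zero => simp
    | add u v hu hv => simp only [map_add, mul_add, TensorProduct.add_tmul, hu, hv]
    | tmul c d =>
      induction t using tensor_induction₃ with
      | zero => simp
      | add u v hu hv => simp only [map_add, add_mul, hu, hv]
      | tmul x y z =>
        have := Q.isAntipodeAlong_jR.absorbsRight 1 d y z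
        simp only [hπ, Δ₂₃_tmul, Algebra.TensorProduct.tmul_mul_tmul, con₃, con₂_tmul,
          AlgHom.toLinearMap_apply] at this ⊢
        rw [this]
        simp [← TensorProduct.smul_tmul']
  have h3 := congrArg π (Q.φinv_mul_Δ₂₃_comul a)
  rw [h1, h2, εr_comul, ← Q.pR_eq_con₃] at h3
  exact h3.symm

/-- `(S(a₁₂) ⊗ S(a₁₁)) (S ⊗ S)(q_R²¹) (a₂ ⊗ 1) = (S ⊗ S)(q_R²¹) (1 ⊗ S(a))`, where
`a₁₁ ⊗ a₁₂ = Δ(a₁)`. -/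
theorem SSΔ_mul_Sq (a : H) :
    con₂ Q.SSΔ (LinearMap.mulLeft k Q.Sq ∘ₗ (jL k H).toLinearMap) (Q.comul a) =
      Q.Sq * (1 ⊗ₜ Q.S a) := by
  set χ := con₃ Q.SR Q.SL (mid (jL k H Q.α) (jL k H) 1) with hχ
  have h1 : ∀ w t, χ (t * Q.Δ₁₂ w) =
      con₂ Q.SSΔ (LinearMap.mulLeft k (χ t) ∘ₗ (jL k H).toLinearMap) w := by
    intro w t
    induction w using TensorProduct.induction_on with
    | zero => simp
    | add u v hu hv => simp only [map_add, mul_add, hu, hv]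
    | tmul c d =>
      rw [Δ₁₂_tmul, con₂_tmul, SSΔ_apply]
      generalize Q.comul c = v
      induction v using TensorProduct.induction_on with
      | zero => simp
      | add u v hu hv => simp only [map_add, add_mul, mul_add, TensorProduct.add_tmul, hu, hv]
      | tmul e f =>
        induction t using tensor_induction₃ with
        | zero => simp
        | add u v hu hv =>
          rw [add_mul, map_add, hu, hv]
          simp [mul_add, add_mul]
        | tmul x y z => simp [hχ, Q.S_mul, mul_assoc]
  have h2 : ∀ w t, χ (Q.Δ₂₃ w * t) = χ t * (1 ⊗ₜ Q.S (Q.εr w)) := by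
    intro w t
    induction w using TensorProduct.induction_on with
    | zero => simp
    | add u v hu hv => simp only [map_add, add_mul, mul_add, TensorProduct.tmul_add, hu, hv]
    | tmul c d =>
      induction t using tensor_induction₃ with
      | zero => simp
      | add u v hu hv => simp only [map_add, add_mul, mul_add, hu, hv]
      | tmul x y z =>
        have := Q.isAntipodeAlong_jL.absorbsLeft 1 d y z
        simp only [hχ, Δ₂₃_tmul, Algebra.TensorProduct.tmul_mul_tmul, con₃, con₂_tmul] at this ⊢
        rw [this]
        simp [Q.S_mul]
  have h3 := congrArg χ (Q.Δ₂₃_comul_mul_Φ a)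
  rw [h1, h2, εr_comul] at h3
  exact h3.symm

/-- `(S(a₁) ⊗ 1) q_L Δ(a₂) = (1 ⊗ a) q_L`. -/
theorem SL_mul_qL (a : H) :
    con₂ Q.SL (LinearMap.mulLeft k Q.qL ∘ₗ Q.comul.toLinearMap) (Q.comul a) =
      (1 ⊗ₜ a) * Q.qL := by
  set χ := con₃ Q.SL (mid (jL k H Q.α) (jL k H) 1) (jR k H).toLinearMap with hχ
  have h1 : ∀ w t, χ (t * Q.Δ₂₃ w) =
      con₂ Q.SL (LinearMap.mulLeft k (χ t) ∘ₗ Q.comul.toLinearMap) w := by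
    intro w t
    induction w using TensorProduct.induction_on with
    | zero => simp
    | add u v hu hv => simp only [map_add, mul_add, hu, hv]
    | tmul c d =>
      rw [Δ₂₃_tmul, con₂_tmul, LinearMap.comp_apply, AlgHom.toLinearMap_apply]
      generalize Q.comul d = v
      induction v using TensorProduct.induction_on with
      | zero => simp
      | add u v hu hv => simp only [map_add, add_mul, mul_add, TensorProduct.tmul_add, hu, hv]
      | tmul e f =>
        induction t using tensor_induction₃ with
        | zero => simp
        | add u v hu hv =>
          rw [add_mul, map_add, hu, hv]
          simp [mul_add, add_mul]
        | tmul x y z => simp [hχ, Q.S_mul, mul_assoc]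
  have h2 : ∀ w t, χ (Q.Δ₁₂ w * t) = (1 ⊗ₜ (Q.εl w)) * χ t := by
    intro w t
    induction w using TensorProduct.induction_on with
    | zero => simp
    | add u v hu hv => simp only [map_add, add_mul, mul_add, TensorProduct.tmul_add, hu, hv]
    | tmul c d =>
      induction t using tensor_induction₃ with
      | zero => simp
      | add u v hu hv => simp only [map_add, add_mul, mul_add, hu, hv]
      | tmul x y z =>
        have : ∀ v, χ (TensorProduct.assoc k H H H (v ⊗ₜ d) * x ⊗ₜ (y ⊗ₜ z)) =
            con₂ Q.SL (mid (jL k H Q.α) (jL k H) 1) (v * x ⊗ₜ y) * (1 ⊗ₜ (d * z)) := by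
          intro v
          induction v using TensorProduct.induction_on with
          | zero => simp
          | add u v hu hv => simp only [map_add, add_mul, TensorProduct.add_tmul, hu, hv]
          | tmul e f => simp [hχ, Q.S_mul, mul_assoc]
        rw [Δ₁₂_tmul, this, Q.isAntipodeAlong_jL.absorbsLeft 1]
        simp [hχ]
  have h3 := congrArg χ (Q.φinv_mul_Δ₂₃_comul a)
  rw [h1, h2, εl_comul] at h3
  exact h3

/-- `Δ(X) p_R (1 ⊗ S(Y) α Z) = 1`. -/
theorem con₃_comul_pR :
    con₃ Q.comul.toLinearMap (LinearMap.mulLeft k Q.pR ∘ₗ Q.SR) (mid (jR k H Q.α) (jR k H) 1) Q.Φ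
      = 1 := by
  set Ω := con₄ (jL k H).toLinearMap (mid 1 (jR k H) (jR k H Q.β)) Q.SR
    (mid (jR k H Q.α) (jR k H) 1) with hΩ
  set π := con₃ (jL k H).toLinearMap (mid 1 (jR k H) (jR k H Q.β)) Q.SR with hπ
  have h1 : ∀ t u, Ω (Q.Δ₁₂' t * ι₁₂₃ k H u) = con₃ Q.comul.toLinearMap
      (LinearMap.mulLeft k (π u) ∘ₗ Q.SR) (mid (jR k H Q.α) (jR k H) 1) t := by
    intro t u
    induction t using tensor_induction₃ with
    | zero => simp
    | add s t hs ht => simp only [map_add, add_mul, hs, ht]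
    | tmul x y z =>
      rw [Δ₁₂'_tmul, con₃_tmul, AlgHom.toLinearMap_apply]
      generalize Q.comul x = v
      induction v using TensorProduct.induction_on with
      | zero => simp
      | add u v hu hv => simp only [map_add, add_mul, TensorProduct.add_tmul, hu, hv]
      | tmul e f =>
        induction u using tensor_induction₃ with
        | zero => simp
        | add u v hu hv =>
          rw [map_add, mul_add, map_add, hu, hv]
          simp [mul_add, add_mul]
        | tmul a b c => simp [hΩ, hπ, Q.S_mul, mul_assoc]
  have h2 : ∀ t, Ω (ι₂₃₄ k H t) =
      con₃ (mid 1 (jR k H) (jR k H Q.β)) Q.SR (mid (jR k H Q.α) (jR k H) 1) t := by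
    intro t
    induction t using tensor_induction₃ with
    | zero => simp
    | add s t hs ht => rw [map_add, map_add, map_add, hs, ht]
    | tmul x y z => simp [hΩ]
  have h3 := congrArg (fun t => Ω (Q.Δ₁₂' Q.Φ * t)) Q.pentagon_ι₁₂₃_inv
  rw [h1, ← mul_assoc, map_Φ_mul_map_φinv, one_mul,
    con₄_collapse₃₄_left (Q.isAntipodeAlong_jR.absorbsLeft 1) (Q.map_φinv_eq_one _ Q.ε₃_Φ),
    con₄_collapse₂₃_right (Q.isAntipodeAlong_jR.absorbsRight 1) Q.ε₂_Φ, h2,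
    Q.isAntipodeAlong_jR.zigzag] at h3
  rw [Q.pR_eq_con₃]
  exact h3

/-- `(X β S(Y) ⊗ 1) q_L Δ(Z) = 1`. -/
theorem con₃_qL_comul :
    con₃ (mid 1 (jL k H) (jL k H Q.β)) Q.SL (LinearMap.mulLeft k Q.qL ∘ₗ Q.comul.toLinearMap) Q.Φ
      = 1 := by
  set Ω := con₄ (mid 1 (jL k H) (jL k H Q.β)) Q.SL
    (mid (jL k H Q.α) (jL k H) 1) (jR k H).toLinearMap with hΩ
  set π := con₃ Q.SL (mid (jL k H Q.α) (jL k H) 1) (jR k H).toLinearMap with hπ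
  have h1 : ∀ t u, Ω (ι₂₃₄ k H u * Q.Δ₃₄' t) = con₃ (mid 1 (jL k H) (jL k H Q.β)) Q.SL
      (LinearMap.mulLeft k (π u) ∘ₗ Q.comul.toLinearMap) t := by
    intro t u
    induction t using tensor_induction₃ with
    | zero => simp
    | add s t hs ht => simp only [map_add, mul_add, hs, ht]
    | tmul x y z =>
      rw [Δ₃₄'_tmul, Δ₂₃_tmul, con₃_tmul, LinearMap.comp_apply, AlgHom.toLinearMap_apply]
      generalize Q.comul z = v
      induction v using TensorProduct.induction_on with
      | zero => simp
      | add u v hu hv => simp only [map_add, mul_add, TensorProduct.tmul_add, hu, hv]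
      | tmul e f =>
        induction u using tensor_induction₃ with
        | zero => simp
        | add u v hu hv =>
          rw [map_add, add_mul, map_add, hu, hv]
          simp [mul_add, add_mul]
        | tmul a b c => simp [hΩ, hπ, Q.S_mul, mul_assoc]
  have h2 : ∀ t, Ω (ι₁₂₃ k H t) =
      con₃ (mid 1 (jL k H) (jL k H Q.β)) Q.SL (mid (jL k H Q.α) (jL k H) 1) t := by
    intro t
    induction t using tensor_induction₃ with
    | zero => simp
    | add s t hs ht => rw [map_add, map_add, map_add, hs, ht]
    | tmul x y z => simp [hΩ]
  have h3 := congrArg (fun t => Ω (t * Q.Δ₃₄' Q.Φ)) Q.pentagon_ι₂₃₄_inv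
  rw [h1, mul_assoc, map_φinv_mul_map_Φ, mul_one,
    con₄_collapse₁₂_right (Q.isAntipodeAlong_jL.absorbsRight 1) (Q.map_φinv_eq_one _ Q.ε₁_Φ),
    con₄_collapse₂₃_left (Q.isAntipodeAlong_jL.absorbsLeft 1) Q.ε₂_Φ, h2,
    Q.isAntipodeAlong_jL.zigzag] at h3
  exact h3

end QuasiHopfAlgebra

namespace QuasiHopfAlgebra

variable {k H : Type*} [Field k] [Ring H] [Algebra k H] (Q : QuasiHopfAlgebra k H)

theorem SSΔ_mul (x y : H) : Q.SSΔ (x * y) = Q.SSΔ y * Q.SSΔ x := by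
  simp [SSop_mul]

theorem SSΔ_one : Q.SSΔ 1 = 1 := by simp

/-- `x ↦ 1 ⊗ S(x) α`. -/
def SRα : H →ₗ[k] H ⊗[k] H := LinearMap.mulRight k (1 ⊗ₜ Q.α) ∘ₗ Q.SR

/-- `x ↦ β S(x) ⊗ 1`. -/
def βSL : H →ₗ[k] H ⊗[k] H := LinearMap.mulLeft k (Q.β ⊗ₜ 1) ∘ₗ Q.SL

@[simp] theorem SRα_apply (x : H) : Q.SRα x = 1 ⊗ₜ (Q.S x * Q.α) := by simp [SRα]

@[simp] theorem βSL_apply (x : H) : Q.βSL x = (Q.β * Q.S x) ⊗ₜ 1 := by simp [βSL]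

/-- `x ⊗ y ⊗ z ↦ (S(y) ⊗ S(x) α) q_L Δ(z)`; its value at `φ` is `γ`. -/
def Γ : H ⊗[k] (H ⊗[k] H) →ₗ[k] H ⊗[k] H :=
  con₃ Q.SRα Q.SL (LinearMap.mulLeft k Q.qL ∘ₗ Q.comul.toLinearMap)

/-- `x ⊗ y ⊗ z ↦ Δ(x) p_R (β S(z) ⊗ S(y))`; its value at `φ` is `δ`. -/
def δmap : H ⊗[k] (H ⊗[k] H) →ₗ[k] H ⊗[k] H :=
  con₃ Q.comul.toLinearMap (LinearMap.mulLeft k Q.pR ∘ₗ Q.SR) Q.βSL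

/-- `δ = Δ(X) p_R (β S(Z) ⊗ S(Y))`, the counterpart of `γ` for `β`. -/
def δ : H ⊗[k] H := Q.δmap Q.Φ

@[simp]
theorem Γ_tmul (x y z : H) : Q.Γ (x ⊗ₜ (y ⊗ₜ z)) =
    (1 ⊗ₜ (Q.S x * Q.α)) * ((Q.S y ⊗ₜ 1) * (Q.qL * Q.comul z)) := by simp [Γ]

@[simp]
theorem δmap_tmul (x y z : H) : Q.δmap (x ⊗ₜ (y ⊗ₜ z)) =
    Q.comul x * (Q.pR * ((1 ⊗ₜ Q.S y) * ((Q.β * Q.S z) ⊗ₜ 1))) := by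
  simp only [δmap, con₃_tmul, mul_assoc, LinearMap.comp_apply, LinearMap.mulLeft_apply, SR_apply,
    βSL_apply, AlgHom.toLinearMap_apply]

theorem γmap_eq_con₄ :
    Q.γmap = con₄ Q.SR Q.SL (mid (jL k H Q.α) (jL k H) 1) (mid (jR k H Q.α) (jR k H) 1) := by
  ext x y z w
  simp [γmap_tmul, mul_assoc]

theorem γ_eq_Γ : Q.γ = Q.Γ Q.Φ := by
  have h1 : ∀ t u, Q.γmap (ι₂₃₄ k H u * Q.Δ₃₄' t) = con₃ Q.SRα Q.SL (LinearMap.mulLeft k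
      (con₃ Q.SL (mid (jL k H Q.α) (jL k H) 1) (jR k H).toLinearMap u) ∘ₗ
        Q.comul.toLinearMap) t := by
    intro t u
    induction t using tensor_induction₃ with
    | zero => simp
    | add s t hs ht => simp only [map_add, mul_add, hs, ht]
    | tmul x y z =>
      rw [Δ₃₄'_tmul, Δ₂₃_tmul, con₃_tmul, LinearMap.comp_apply, AlgHom.toLinearMap_apply]
      generalize Q.comul z = v
      induction v using TensorProduct.induction_on with
      | zero => simp
      | add u v hu hv => simp only [map_add, mul_add, TensorProduct.tmul_add, hu, hv]
      | tmul e f =>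
        induction u using tensor_induction₃ with
        | zero => simp
        | add u v hu hv =>
          rw [map_add, add_mul, map_add, hu, hv]
          simp [mul_add, add_mul]
        | tmul a b c => simp [γmap_tmul, Q.S_mul, mul_assoc]
  exact h1 Q.Φ Q.φinv

/-- `(S(X₂) ⊗ S(X₁)) γ (Y ⊗ Z) = (S ⊗ S)(q_R²¹) (1 ⊗ α)`. -/
theorem con₃_SSΔ_γ :
    con₃ Q.SSΔ (mid Q.γ (jL k H) 1) (jR k H).toLinearMap Q.Φ = Q.Sq * (1 ⊗ₜ Q.α) := by
  have h1 : ∀ t u, Q.γmap (u * Q.Δ₁₂' t) =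
      con₃ Q.SSΔ (mid (Q.γmap u) (jL k H) 1) (jR k H).toLinearMap t := by
    intro t u
    induction t using tensor_induction₃ with
    | zero => simp
    | add s t hs ht => simp only [map_add, mul_add, hs, ht]
    | tmul x y z =>
      rw [Δ₁₂'_tmul, con₃_tmul, SSΔ_apply]
      generalize Q.comul x = v
      induction v using TensorProduct.induction_on with
      | zero => simp
      | add u v hu hv =>
        simp only [map_add, add_mul, mul_add, TensorProduct.add_tmul, hu, hv]
      | tmul e f =>
        induction u using tensor_induction₄ with
        | zero => simp
        | add u v hu hv =>
          rw [add_mul, map_add, hu, hv]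
          simp [mul_add, add_mul]
        | tmul a b c d => simp [γmap_tmul, Q.S_mul, mul_assoc]
  have h2 : ∀ t, Q.γmap (ι₁₂₃ k H t) =
      con₃ Q.SR Q.SL (mid (jL k H Q.α) (jL k H) 1) t * (1 ⊗ₜ Q.α) := by
    intro t
    induction t using tensor_induction₃ with
    | zero => simp
    | add s t hs ht => simp only [map_add, add_mul, hs, ht]
    | tmul x y z => simp [γmap_tmul, mul_assoc]
  have h3 : Q.TUVW = ι₂₃₄ k H Q.φinv * Q.Δ₃₄' Q.Φ := rfl
  rw [γ, ← h1, h3, mul_assoc, pentagon', mul_assoc, ← mul_assoc (ι₂₃₄ k H Q.φinv),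
    map_φinv_mul_map_Φ, one_mul, γmap_eq_con₄,
    con₄_collapse₂₃_left (Q.isAntipodeAlong_jL.absorbsLeft 1) Q.ε₂_Φ, ← γmap_eq_con₄, h2, Sq]

theorem Γ_mul_Δ₁₂ (t : H ⊗[k] (H ⊗[k] H)) (w : H ⊗[k] H) :
    Q.Γ (t * Q.Δ₁₂ w) = con₂ Q.SSΔ (mid (Q.Γ t) Q.comul 1) w := by
  induction w using TensorProduct.induction_on with
  | zero => simp
  | add u v hu hv => simp only [map_add, mul_add, hu, hv]
  | tmul c d =>
    rw [Δ₁₂_tmul, con₂_tmul, SSΔ_apply]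
    generalize Q.comul c = v
    induction v using TensorProduct.induction_on with
    | zero => simp
    | add u v hu hv => simp only [map_add, add_mul, mul_add, TensorProduct.add_tmul, hu, hv]
    | tmul e f =>
      induction t using tensor_induction₃ with
      | zero => simp
      | add u v hu hv =>
        rw [add_mul, map_add, hu, hv]
        simp [mul_add, add_mul]
      | tmul x y z => simp [Q.S_mul, ← mul_assoc]

theorem Γ_Δ₂₃_comul_mul (a : H) (t : H ⊗[k] (H ⊗[k] H)) :
    Q.Γ (Q.Δ₂₃ (Q.comul a) * t) = Q.counit a • Q.Γ t := by
  induction t using tensor_induction₃ with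
  | zero => simp
  | add u v hu hv => simp only [map_add, mul_add, smul_add, hu, hv]
  | tmul x y z =>
    have h1 : ∀ c w, Q.Γ ((c ⊗ₜ w) * (x ⊗ₜ (y ⊗ₜ z))) = (1 ⊗ₜ (Q.S x * (Q.S c * Q.α))) *
        ((Q.S y ⊗ₜ 1) * (con₂ Q.SL (LinearMap.mulLeft k Q.qL ∘ₗ Q.comul.toLinearMap) w
          * Q.comul z)) := by
      intro c w
      induction w using TensorProduct.induction_on with
      | zero => simp
      | add u v hu hv => simp only [map_add, add_mul, mul_add, TensorProduct.tmul_add, hu, hv]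
      | tmul e f => simp [Q.S_mul, ← mul_assoc]
    have h2 : ∀ w, Q.Γ (Q.Δ₂₃ w * (x ⊗ₜ (y ⊗ₜ z))) =
        (1 ⊗ₜ (Q.S x * con₂ Q.S.toLinearMap (mid Q.α (AlgHom.id k H) 1) w)) *
          ((Q.S y ⊗ₜ 1) * (Q.qL * Q.comul z)) := by
      intro w
      induction w using TensorProduct.induction_on with
      | zero => simp
      | add u v hu hv => simp only [map_add, add_mul, mul_add, TensorProduct.tmul_add, hu, hv]
      | tmul e f =>
        rw [Δ₂₃_tmul, h1, SL_mul_qL]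
        simp [← mul_assoc]
    rw [h2, Q.isAntipodeAlong_id.left]
    simp

theorem δmap_Δ₂₃_mul (t : H ⊗[k] (H ⊗[k] H)) (w : H ⊗[k] H) :
    Q.δmap (Q.Δ₂₃ w * t) = con₂ (mid 1 Q.comul (Q.δmap t)) Q.SSΔ w := by
  induction w using TensorProduct.induction_on with
  | zero => simp
  | add u v hu hv => simp only [map_add, add_mul, hu, hv]
  | tmul c d =>
    rw [Δ₂₃_tmul, con₂_tmul, SSΔ_apply]
    generalize Q.comul d = v
    induction v using TensorProduct.induction_on with
    | zero => simp
    | add u v hu hv => simp only [map_add, add_mul, mul_add, TensorProduct.tmul_add, hu, hv]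
    | tmul e f =>
      induction t using tensor_induction₃ with
      | zero => simp
      | add u v hu hv =>
        rw [mul_add, map_add, hu, hv]
        simp [mul_add, add_mul]
      | tmul x y z => simp [Q.S_mul, mul_assoc]

theorem δmap_mul_Δ₁₂_comul (a : H) (t : H ⊗[k] (H ⊗[k] H)) :
    Q.δmap (t * Q.Δ₁₂ (Q.comul a)) = Q.counit a • Q.δmap t := by
  induction t using tensor_induction₃ with
  | zero => simp
  | add u v hu hv => simp only [map_add, add_mul, smul_add, hu, hv]
  | tmul x y z =>
    have h1 : ∀ c w, Q.δmap ((x ⊗ₜ (y ⊗ₜ z)) * TensorProduct.assoc k H H H (w ⊗ₜ c)) =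
        Q.comul x * (con₂ Q.comul.toLinearMap (LinearMap.mulLeft k Q.pR ∘ₗ Q.SR) w *
          ((1 ⊗ₜ Q.S y) * ((Q.β * (Q.S c * Q.S z)) ⊗ₜ 1))) := by
      intro c w
      induction w using TensorProduct.induction_on with
      | zero => simp
      | add u v hu hv => simp only [map_add, add_mul, mul_add, TensorProduct.add_tmul, hu, hv]
      | tmul e f => simp [Q.S_mul, mul_assoc]
    have h2 : ∀ w, Q.δmap ((x ⊗ₜ (y ⊗ₜ z)) * Q.Δ₁₂ w) =
        Q.comul x * (Q.pR * ((1 ⊗ₜ Q.S y) *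
          ((con₂ (mid 1 (AlgHom.id k H) Q.β) Q.S.toLinearMap w * Q.S z) ⊗ₜ 1))) := by
      intro w
      induction w using TensorProduct.induction_on with
      | zero => simp
      | add u v hu hv => simp only [map_add, add_mul, mul_add, TensorProduct.add_tmul, hu, hv]
      | tmul e f =>
        rw [Δ₁₂_tmul, h1, comul_mul_pR]
        simp [mul_assoc]
    rw [h2, Q.isAntipodeAlong_id.right]
    simp [← TensorProduct.smul_tmul']

/-- `Δ(X) δ (S ⊗ S)(Δᵒᵖ(Y)) γ Δ(Z) = 1`: both sides of the pentagon are contracted with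
`a ⊗ b ⊗ c ⊗ d ↦ Δ(a) p_R (1 ⊗ S(b) α) (β S(c) ⊗ 1) q_L Δ(d)`. -/
theorem zigzag_comul :
    con₃ (mid 1 Q.comul Q.δ) Q.SSΔ (mid (Q.Γ Q.Φ) Q.comul 1) Q.Φ = 1 := by
  set Ω := con₄ Q.comul.toLinearMap (LinearMap.mulLeft k Q.pR ∘ₗ Q.SRα) Q.βSL
    (LinearMap.mulLeft k Q.qL ∘ₗ Q.comul.toLinearMap) with hΩ
  have h1 : ∀ t u v, Ω (ι₂₃₄ k H u * Q.Δ₂₃' t * ι₁₂₃ k H v) =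
      con₃ (mid 1 Q.comul (Q.δmap v)) Q.SSΔ (mid (Q.Γ u) Q.comul 1) t := by
    intro t u v
    induction t using tensor_induction₃ with
    | zero => simp
    | add s t hs ht => simp only [map_add, mul_add, add_mul, hs, ht]
    | tmul x y z =>
      rw [Δ₂₃'_tmul, Δ₁₂_tmul, con₃_tmul, SSΔ_apply]
      generalize Q.comul y = w
      induction w using TensorProduct.induction_on with
      | zero => simp
      | add r s hr hs =>
        simp only [map_add, add_mul, mul_add, TensorProduct.add_tmul, TensorProduct.tmul_add,
          hr, hs]
      | tmul m n =>
        induction u using tensor_induction₃ with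
        | zero => simp
        | add r s hr hs =>
          rw [map_add, add_mul, add_mul, map_add, hr, hs]
          simp [mul_add, add_mul]
        | tmul a b c =>
          induction v using tensor_induction₃ with
          | zero => simp
          | add r s hr hs =>
            rw [map_add, mul_add, map_add, hr, hs]
            simp [mul_add, add_mul]
          | tmul d e f =>
            have h : ∀ s t : H ⊗[k] H, ∀ p q r u : H,
                s * ((p ⊗ₜ[k] q) * ((r ⊗ₜ[k] u) * t)) = s * (((p * r) ⊗ₜ[k] (q * u)) * t) := by
              intro s t p q r u
              rw [← Algebra.TensorProduct.tmul_mul_tmul, mul_assoc]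
            simp [hΩ, Q.S_mul, mul_assoc, h]
  have h2 : ∀ t u, Ω (Q.Δ₃₄' t * Q.Δ₁₂' u) =
      con₃ Q.comul.toLinearMap (LinearMap.mulLeft k Q.pR ∘ₗ Q.SR)
        (mid (jR k H Q.α) (jR k H) 1) t *
      con₃ (mid 1 (jL k H) (jL k H Q.β)) Q.SL
        (LinearMap.mulLeft k Q.qL ∘ₗ Q.comul.toLinearMap) u := by
    intro t u
    induction t using tensor_induction₃ with
    | zero => simp
    | add s t hs ht => simp only [map_add, add_mul, hs, ht]
    | tmul x y z =>
      induction u using tensor_induction₃ with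
      | zero => simp
      | add s t hs ht => simp only [map_add, mul_add, hs, ht]
      | tmul a b c =>
        have h3 : ∀ v w, Ω (x ⊗ₜ (y ⊗ₜ w) *
              TensorProduct.assoc k H H (H ⊗[k] H) (v ⊗ₜ (b ⊗ₜ c))) =
            Q.comul x *
              (con₂ Q.comul.toLinearMap (LinearMap.mulLeft k Q.pR ∘ₗ Q.SR) v *
              ((1 ⊗ₜ (Q.S y * Q.α)) * ((Q.β * Q.S b) ⊗ₜ 1)) *
              con₂ Q.SL (LinearMap.mulLeft k Q.qL ∘ₗ Q.comul.toLinearMap) w * Q.comul c) := by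
          intro v w
          induction v using TensorProduct.induction_on with
          | zero => simp
          | add r s hr hs =>
            simp only [map_add, add_mul, mul_add, TensorProduct.add_tmul, hr, hs]
          | tmul m n =>
            induction w using TensorProduct.induction_on with
            | zero => simp
            | add r s hr hs =>
              simp only [map_add, add_mul, mul_add, TensorProduct.tmul_add, hr, hs]
            | tmul p q =>
              have h : ∀ s t : H ⊗[k] H, ∀ p q r u : H,
                  s * ((p ⊗ₜ[k] q) * ((r ⊗ₜ[k] u) * t)) =
                    s * (((p * r) ⊗ₜ[k] (q * u)) * t) := by
                intro s t p q r u
                rw [← Algebra.TensorProduct.tmul_mul_tmul, mul_assoc]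
              simp [hΩ, Q.S_mul, mul_assoc, h]
        rw [Δ₃₄'_tmul, Δ₂₃_tmul, Δ₁₂'_tmul, h3, comul_mul_pR, SL_mul_qL]
        have h : ∀ s t : H ⊗[k] H, ∀ p q r u : H,
            s * ((p ⊗ₜ[k] q) * ((r ⊗ₜ[k] u) * t)) =
              s * (((p * r) ⊗ₜ[k] (q * u)) * t) := by
          intro s t p q r u
          rw [← Algebra.TensorProduct.tmul_mul_tmul, mul_assoc]
        simp [mul_assoc, h]
  have h3 := congrArg Ω Q.pentagon'
  rw [h1, h2, con₃_comul_pR, con₃_qL_comul, one_mul] at h3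
  exact h3.symm

/-- `x ↦ (S ⊗ S)(Δᵒᵖ(x))`, with `γ` and `δ`, is a second antipode along `Δ`. -/
theorem isAntipodeAlong_comul' : Q.IsAntipodeAlong Q.comul Q.SSΔ Q.γ Q.δ where
  antimul := Q.SSΔ_mul
  left x := by
    rw [γ_eq_Γ, ← Γ_mul_Δ₁₂, ← Δ₂₃_comul_mul_Φ, Γ_Δ₂₃_comul_mul]
  right x := by
    rw [δ, ← δmap_Δ₂₃_mul, Δ₂₃_comul_mul_Φ, δmap_mul_Δ₁₂_comul]
  zigzag := by
    rw [γ_eq_Γ]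
    exact Q.zigzag_comul

/-- Drinfeld's twist compares the two antipodes along `Δ`. -/
theorem f_eq_twist :
    Q.f = Q.twist Q.comul Q.SSΔ Q.γ (Q.comul Q.β) (Q.comul.toLinearMap ∘ₗ Q.S.toLinearMap) := by
  rw [f, twist]
  congr 1
  ext x y z
  simp [fmap_tmul, mul_assoc]

theorem f_mul_comul_S (a : H) : Q.f * Q.comul (Q.S a) = Q.SSop (Q.comul a) * Q.f := by
  rw [f_eq_twist]
  exact Q.isAntipodeAlong_comul.twist_mul Q.isAntipodeAlong_comul' a

theorem f_mul_comul_α : Q.f * Q.comul Q.α = Q.γ := by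
  rw [f_eq_twist]
  exact Q.isAntipodeAlong_comul.twist_mul_left Q.isAntipodeAlong_comul' Q.SSΔ_one

theorem δ_mul_f : Q.δ * Q.f = Q.comul Q.β := by
  rw [f_eq_twist]
  exact Q.isAntipodeAlong_comul.mul_twist Q.isAntipodeAlong_comul' (by simp [Q.S_one])

theorem isUnit_f [FiniteDimensional k H] : IsUnit Q.f := by
  have h : con₃ (Q.comul.toLinearMap ∘ₗ Q.S.toLinearMap)
      (mid (Q.comul Q.α) Q.comul (Q.comul Q.β))
      (Q.comul.toLinearMap ∘ₗ Q.S.toLinearMap) Q.φinv = 1 := by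
    have h1 : ∀ t, con₃ (Q.comul.toLinearMap ∘ₗ Q.S.toLinearMap)
        (mid (Q.comul Q.α) Q.comul (Q.comul Q.β)) (Q.comul.toLinearMap ∘ₗ Q.S.toLinearMap) t =
        Q.comul (con₃ Q.S.toLinearMap (mid Q.α (AlgHom.id k H) Q.β) Q.S.toLinearMap t) := by
      intro t
      induction t using tensor_induction₃ with
      | zero => simp
      | add s t hs ht => simp only [map_add, hs, ht]
      | tmul x y z => simp
    rw [h1, con₃_S_φinv, map_one]
  have := Q.isAntipodeAlong_comul.twist_mul_twist Q.isAntipodeAlong_comul'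
    (by simp [Q.S_one]) h
  rw [← f_eq_twist] at this
  -- In a finite-dimensional algebra a left inverse is two-sided.
  have hinj : Function.Injective (LinearMap.mulLeft k Q.f) := by
    intro x y hxy
    have h2 := congrArg (fun t => Q.twist Q.comul (Q.comul.toLinearMap ∘ₗ Q.S.toLinearMap)
      (Q.comul Q.α) Q.δ Q.SSΔ * t) hxy
    simpa only [LinearMap.mulLeft_apply, ← mul_assoc, this, one_mul] using h2
  obtain ⟨g, hg⟩ := (LinearMap.injective_iff_surjective.mp hinj) 1
  exact ⟨⟨Q.f, g, hg, by rwa [← left_inv_eq_right_inv this hg]⟩, rfl⟩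

end QuasiHopfAlgebra

namespace QuasiHopfAlgebra

variable {k H : Type*} [Field k] [Ring H] [Algebra k H] (Q : QuasiHopfAlgebra k H)

/-! ### The elements `U` and `V` -/

/-- The reversed contraction `x ⊗ y ↦ G y * F x`. -/
def rcon₂ {M N B : Type*} [AddCommGroup M] [Module k M] [AddCommGroup N] [Module k N]
    [Ring B] [Algebra k B] (F : M →ₗ[k] B) (G : N →ₗ[k] B) : M ⊗[k] N →ₗ[k] B :=
  con₂ G F ∘ₗ (TensorProduct.comm k M N).toLinearMap

@[simp]
theorem rcon₂_tmul {M N B : Type*} [AddCommGroup M] [Module k M] [AddCommGroup N] [Module k N]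
    [Ring B] [Algebra k B] (F : M →ₗ[k] B) (G : N →ₗ[k] B) (x : M) (y : N) :
    rcon₂ F G (x ⊗ₜ[k] y) = G y * F x := by
  simp [rcon₂]

@[simp] theorem S_Sinv (x : H) : Q.S (Q.Sinv x) = x := Q.S.apply_symm_apply x

@[simp] theorem Sinv_S (x : H) : Q.Sinv (Q.S x) = x := Q.S.symm_apply_apply x

theorem Sinv_mul (x y : H) : Q.Sinv (x * y) = Q.Sinv y * Q.Sinv x := by
  apply Q.S.injective
  simp [Q.S_mul]

@[simp] theorem Sinv_one : Q.Sinv 1 = 1 := by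
  apply Q.S.injective
  simp [Q.S_one]

@[simp] theorem SSop_SSinvop (t : H ⊗[k] H) : Q.SSop (Q.SSinvop t) = t := by
  induction t using TensorProduct.induction_on with
  | zero => simp
  | add s t hs ht => simp only [map_add, hs, ht]
  | tmul x y => simp [SSinvop]

@[simp] theorem SSinvop_SSop (t : H ⊗[k] H) : Q.SSinvop (Q.SSop t) = t := by
  induction t using TensorProduct.induction_on with
  | zero => simp
  | add s t hs ht => simp only [map_add, hs, ht]
  | tmul x y => simp [SSinvop]

theorem SSop_injective : Function.Injective Q.SSop :=
  Function.LeftInverse.injective Q.SSinvop_SSop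

theorem SSop_V : Q.SSop Q.V = Q.f * Q.pR := by
  rw [V, h, SSop_mul, SSop_SSinvop, SSop_SSinvop]

/-- `x ↦ Δ(S(x))`. -/
def ΔS : H →ₗ[k] H ⊗[k] H := Q.comul.toLinearMap ∘ₗ Q.S.toLinearMap

/-- `x ↦ Δ(S⁻¹(x))`. -/
def ΔSinv : H →ₗ[k] H ⊗[k] H := Q.comul.toLinearMap ∘ₗ Q.Sinv

@[simp] theorem ΔS_apply (x : H) : Q.ΔS x = Q.comul (Q.S x) := rfl

@[simp] theorem ΔSinv_apply (x : H) : Q.ΔSinv x = Q.comul (Q.Sinv x) := rfl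

theorem SSop_comul_Sinv_mul_f (a : H) : Q.SSop (Q.comul (Q.Sinv a)) * Q.f = Q.f * Q.comul a := by
  rw [← f_mul_comul_S, S_Sinv]

/-- `(a₂ ⊗ 1) V Δ(S⁻¹(a₁)) = (1 ⊗ S⁻¹(a)) V`. -/
theorem V_mul_ΔSinv (a : H) :
    rcon₂ Q.ΔSinv (LinearMap.mulRight k Q.V ∘ₗ (jL k H).toLinearMap) (Q.comul a) =
      (1 ⊗ₜ Q.Sinv a) * Q.V := by
  apply Q.SSop_injective
  have h1 : ∀ w, Q.SSop (rcon₂ Q.ΔSinv (LinearMap.mulRight k Q.V ∘ₗ (jL k H).toLinearMap) w) =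
      Q.f * con₂ Q.comul.toLinearMap (LinearMap.mulLeft k Q.pR ∘ₗ Q.SR) w := by
    intro w
    induction w using TensorProduct.induction_on with
    | zero => simp
    | add u v hu hv => simp only [map_add, mul_add, hu, hv]
    | tmul x y =>
      simp only [rcon₂_tmul, con₂_tmul, ΔSinv_apply, LinearMap.comp_apply,
        LinearMap.mulRight_apply, LinearMap.mulLeft_apply, SSop_mul, SSop_V]
      simp only [← mul_assoc, SSop_comul_Sinv_mul_f]
      simp [Q.S_one]
  rw [h1, comul_mul_pR, SSop_mul, SSop_V]
  simp [Q.S_one, mul_assoc]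

theorem comul_mul_δ :
    con₂ (LinearMap.mulRight k Q.δ ∘ₗ Q.comul.toLinearMap) Q.SSop Q.φinv =
      Q.pR * (Q.β ⊗ₜ 1) := by
  have h1 : ∀ t u, con₂ (LinearMap.mulRight k (Q.δmap u) ∘ₗ Q.comul.toLinearMap) Q.SSop t =
      Q.δmap (t * u) := by
    intro t u
    induction t using tensor_induction₃ with
    | zero => simp
    | add s t hs ht => simp only [map_add, add_mul, hs, ht]
    | tmul x y z =>
      induction u using tensor_induction₃ with
      | zero => simp
      | add s t hs ht =>
        rw [mul_add, map_add, map_add, ← hs, ← ht]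
        simp [mul_add, add_mul]
      | tmul a b c => simp [Q.S_mul, mul_assoc]
  rw [δ, h1, φinv_mul_Φ, Algebra.TensorProduct.one_def, Algebra.TensorProduct.one_def, δmap_tmul]
  simp [Q.S_one]

section UV

variable [FiniteDimensional k H]

theorem f_mul_U : Q.f * Q.U = Q.Sq := by
  rw [U, ← mul_assoc, Ring.mul_inverse_cancel _ Q.isUnit_f, one_mul, SSop_qR]

/-- `Δ(S(a₁)) U (a₂ ⊗ 1) = U (1 ⊗ S(a))`. -/
theorem ΔS_mul_U (a : H) :
    con₂ Q.ΔS (LinearMap.mulLeft k Q.U ∘ₗ (jL k H).toLinearMap) (Q.comul a) =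
      Q.U * (1 ⊗ₜ Q.S a) := by
  apply Q.isUnit_f.mul_left_cancel
  have h1 : ∀ w, Q.f * con₂ Q.ΔS (LinearMap.mulLeft k Q.U ∘ₗ (jL k H).toLinearMap) w =
      con₂ Q.SSΔ (LinearMap.mulLeft k Q.Sq ∘ₗ (jL k H).toLinearMap) w := by
    intro w
    induction w using TensorProduct.induction_on with
    | zero => simp
    | add u v hu hv => simp only [map_add, mul_add, hu, hv]
    | tmul x y =>
      simp only [con₂_tmul, ΔS_apply, SSΔ_apply, LinearMap.comp_apply, LinearMap.mulLeft_apply,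
        ← mul_assoc, f_mul_comul_S]
      rw [mul_assoc _ Q.f, f_mul_U]
  rw [h1, SSΔ_mul_Sq, ← mul_assoc, f_mul_U]

/-- `Δ(S(X) α) (Y ⊗ Z) = U (1 ⊗ α)`. -/
theorem ΔS_mul_α :
    con₂ (Q.ΔS) (LinearMap.mulLeft k (Q.comul Q.α)) Q.Φ = Q.U * (1 ⊗ₜ Q.α) := by
  apply Q.isUnit_f.mul_left_cancel
  have h1 : ∀ t, Q.f * con₂ (Q.ΔS) (LinearMap.mulLeft k (Q.comul Q.α)) t =
      con₃ Q.SSΔ (mid Q.γ (jL k H) 1) (jR k H).toLinearMap t := by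
    intro t
    induction t using tensor_induction₃ with
    | zero => simp
    | add u v hu hv => simp only [map_add, mul_add, hu, hv]
    | tmul x y z =>
      simp only [con₂_tmul, ΔS_apply, con₃_tmul, SSΔ_apply, LinearMap.mulLeft_apply,
        ← mul_assoc, f_mul_comul_S]
      rw [mul_assoc _ Q.f, f_mul_comul_α]
      simp [mul_assoc]
  rw [h1, con₃_SSΔ_γ, ← mul_assoc, f_mul_U]

/-- `(Ȳ ⊗ Z̄) Δ(S⁻¹(X̄ β)) = (1 ⊗ S⁻¹(β)) V`. -/
theorem mul_ΔSinv_β :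
    rcon₂ Q.ΔSinv (LinearMap.mulRight k (Q.comul (Q.Sinv Q.β))) Q.φinv =
      (1 ⊗ₜ Q.Sinv Q.β) * Q.V := by
  apply Q.SSop_injective
  have h1 : ∀ t, Q.SSop (rcon₂ Q.ΔSinv (LinearMap.mulRight k (Q.comul (Q.Sinv Q.β))) t) =
      Q.f * con₂ (LinearMap.mulRight k Q.δ ∘ₗ Q.comul.toLinearMap) Q.SSop t := by
    intro t
    induction t using tensor_induction₃ with
    | zero => simp
    | add u v hu hv => simp only [map_add, mul_add, hu, hv]
    | tmul x y z =>
      have h2 : Q.SSop (Q.comul (Q.Sinv x)) * Q.SSop (Q.comul (Q.Sinv Q.β)) =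
          Q.f * (Q.comul x * Q.δ) := by
        apply Q.isUnit_f.mul_right_cancel
        rw [mul_assoc, SSop_comul_Sinv_mul_f, ← mul_assoc, SSop_comul_Sinv_mul_f]
        simp only [mul_assoc, δ_mul_f]
      simp only [rcon₂_tmul, con₂_tmul, ΔSinv_apply, LinearMap.comp_apply,
        LinearMap.mulRight_apply, SSop_mul, AlgHom.toLinearMap_apply]
      rw [← mul_assoc, h2, mul_assoc]
  rw [h1, comul_mul_δ, SSop_mul, SSop_V]
  simp [Q.S_one, mul_assoc]

end UV

section Uniqueness

variable {Q} {B : Type*} [Ring B] [Algebra k B] {ι : H →ₐ[k] B} {L : H → B → B} {R R' : B}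

/-- An element `R` with `R ι(S(b)) = L_b(R)`, where `L_b` commutes with right multiplication by
the image of `ι`, is determined by `R ι(α)`, because `S(X̄) α Ȳ β S(Z̄) = 1`. -/
theorem eq_of_mul_S (hL : ∀ b y c, L b (y * ι c) = L b y * ι c)
    (hR : ∀ b, R * ι (Q.S b) = L b R) (hR' : ∀ b, R' * ι (Q.S b) = L b R')
    (h : R * ι Q.α = R' * ι Q.α) : R = R' := by
  have key : ∀ t, R * ι (con₃ Q.S.toLinearMap (mid Q.α (AlgHom.id k H) Q.β) Q.S.toLinearMap t) =
      R' * ι (con₃ Q.S.toLinearMap (mid Q.α (AlgHom.id k H) Q.β) Q.S.toLinearMap t) := by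
    intro t
    induction t using tensor_induction₃ with
    | zero => simp
    | add s t hs ht => simp only [map_add, mul_add, hs, ht]
    | tmul x y z =>
      have e : R * ι (Q.S x) * ι Q.α = R' * ι (Q.S x) * ι Q.α := by
        rw [hR, hR', ← hL, ← hL, h]
      simp only [con₃_tmul, mid_apply, map_mul, ← mul_assoc, LinearEquiv.coe_coe]
      rw [e]
  simpa [con₃_S_φinv] using key Q.φinv

/-- The mirror image of `eq_of_mul_S`: an element `R` with `ι(S⁻¹(b)) R = L_b(R)` is determined
by `ι(S⁻¹(β)) R`, because `S⁻¹(Z) S⁻¹(α) Y S⁻¹(β) S⁻¹(X) = 1`. -/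
theorem eq_of_Sinv_mul (hL : ∀ b y c, L b (ι c * y) = ι c * L b y)
    (hR : ∀ b, ι (Q.Sinv b) * R = L b R) (hR' : ∀ b, ι (Q.Sinv b) * R' = L b R')
    (h : ι (Q.Sinv Q.β) * R = ι (Q.Sinv Q.β) * R') : R = R' := by
  have key : ∀ t,
      ι (Q.Sinv (con₃ (mid 1 (AlgHom.id k H) Q.β) Q.S.toLinearMap
        (mid Q.α (AlgHom.id k H) 1) t)) * R =
      ι (Q.Sinv (con₃ (mid 1 (AlgHom.id k H) Q.β) Q.S.toLinearMap
        (mid Q.α (AlgHom.id k H) 1) t)) * R' := by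
    intro t
    induction t using tensor_induction₃ with
    | zero => simp
    | add s t hs ht => simp only [map_add, add_mul, hs, ht]
    | tmul x y z =>
      have e : ι (Q.Sinv Q.β) * (ι (Q.Sinv x) * R) = ι (Q.Sinv Q.β) * (ι (Q.Sinv x) * R') := by
        rw [hR, hR', ← hL, ← hL, h]
      simp only [con₃_tmul, mid_apply, map_mul, Sinv_mul, mul_assoc, LinearEquiv.coe_coe,
        AlgHom.id_apply, Sinv_one, map_one, one_mul]
      rw [e]
  simpa [Q.isAntipodeAlong_id.zigzag] using key Q.Φ

end Uniqueness

section UV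

variable [FiniteDimensional k H]

/-- `(ε ⊗ id)(U) = 1`, since both sides satisfy the conditions of `eq_of_mul_S` for `ι = id`. -/
theorem εl_U : Q.εl Q.U = 1 := by
  refine eq_of_mul_S (Q := Q) (ι := AlgHom.id k H) (L := fun b y => Q.S b * y)
    (fun b y c => by simp [mul_assoc]) (fun b => ?_) (fun b => by simp) ?_
  · have h1 : ∀ w, Q.εl (con₂ Q.ΔS (LinearMap.mulLeft k Q.U ∘ₗ (jL k H).toLinearMap) w) =
        Q.S (Q.εr w) * Q.εl Q.U := by
      intro w
      induction w using TensorProduct.induction_on with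
      | zero => simp
      | add u v hu hv => simp only [map_add, add_mul, hu, hv]
      | tmul x y => simp
    have h2 := congrArg Q.εl (Q.ΔS_mul_U b)
    rw [h1, εr_comul] at h2
    simpa using h2.symm
  · have h1 : ∀ t, Q.εl (con₂ (Q.ΔS) (LinearMap.mulLeft k (Q.comul Q.α)) t) =
        con₂ Q.S.toLinearMap (mid Q.α (AlgHom.id k H) 1) (Q.ε₂ t) := by
      intro t
      induction t using tensor_induction₃ with
      | zero => simp
      | add u v hu hv => simp only [map_add, hu, hv]
      | tmul x y z => simp
    have h2 := congrArg Q.εl Q.ΔS_mul_α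
    rw [h1, ε₂_Φ] at h2
    simpa [Algebra.TensorProduct.one_def, Q.S_one] using h2.symm

/-- `(ε ⊗ id)(V) = 1`, since both sides satisfy the conditions of `eq_of_Sinv_mul` for `ι = id`. -/
theorem εl_V : Q.εl Q.V = 1 := by
  refine eq_of_Sinv_mul (Q := Q) (ι := AlgHom.id k H) (L := fun b y => y * Q.Sinv b)
    (fun b y c => by simp [mul_assoc]) (fun b => ?_) (fun b => by simp) ?_
  · have h1 : ∀ w, Q.εl (rcon₂ Q.ΔSinv (LinearMap.mulRight k Q.V ∘ₗ (jL k H).toLinearMap) w) =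
        Q.εl Q.V * Q.Sinv (Q.εr w) := by
      intro w
      induction w using TensorProduct.induction_on with
      | zero => simp
      | add u v hu hv => simp only [map_add, mul_add, hu, hv]
      | tmul x y => simp
    have h2 := congrArg Q.εl (Q.V_mul_ΔSinv b)
    rw [h1, εr_comul] at h2
    simpa using h2.symm
  · have h1 : ∀ t, Q.εl (rcon₂ Q.ΔSinv (LinearMap.mulRight k (Q.comul (Q.Sinv Q.β))) t) =
        rcon₂ Q.Sinv (mid 1 (AlgHom.id k H) (Q.Sinv Q.β)) (Q.ε₂ t) := by
      intro t
      induction t using tensor_induction₃ with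
      | zero => simp
      | add u v hu hv => simp only [map_add, hu, hv]
      | tmul x y z => simp [mul_assoc]
    have h2 := congrArg Q.εl Q.mul_ΔSinv_β
    rw [h1, Q.map_φinv_eq_one _ Q.ε₂_Φ] at h2
    simpa [Algebra.TensorProduct.one_def, Q.S_one] using h2.symm

end UV

end QuasiHopfAlgebra

namespace QuasiHopfAlgebra

variable {k H : Type*} [Field k] [Ring H] [Algebra k H] (Q : QuasiHopfAlgebra k H)

/-! ### Compatibility of `U` and `V` with the reassociator -/

theorem Δ₁₂_jR (c : H) : Q.Δ₁₂ (1 ⊗ₜ c) = ι₂₃ k H (jR k H c) := by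
  simp [Δ₁₂_tmul, Algebra.TensorProduct.one_def]

theorem Δ₁₂_jL (c : H) : Q.Δ₁₂ (c ⊗ₜ 1) = ι₁₂ k H (Q.comul c) := rfl

theorem Δ₁₂_comul_mul_φinv (a : H) (t : H ⊗[k] (H ⊗[k] H)) :
    Q.φinv * (Q.Δ₂₃ (Q.comul a) * t) = Q.Δ₁₂ (Q.comul a) * (Q.φinv * t) := by
  rw [← mul_assoc, φinv_mul_Δ₂₃_comul, mul_assoc]

theorem mul_Δ₂₃_comul_mul_Φ (a : H) (t : H ⊗[k] (H ⊗[k] H)) :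
    t * Q.Δ₂₃ (Q.comul a) * Q.Φ = t * Q.Φ * Q.Δ₁₂ (Q.comul a) := by
  rw [mul_assoc, Δ₂₃_comul_mul_Φ, mul_assoc]

section UVCoherence

variable [FiniteDimensional k H]

/-- `φ⁻¹ (id ⊗ Δ)(U) (1 ⊗ U) = (Δ ⊗ id)(Δ(S(X)) U) (Y ⊗ Z ⊗ 1)`. -/
theorem φinv_mul_Δ₂₃_U :
    Q.φinv * (Q.Δ₂₃ Q.U * ι₂₃ k H Q.U) =
      con₂ (Q.Δ₁₂.toLinearMap ∘ₗ LinearMap.mulRight k Q.U ∘ₗ Q.ΔS) (ι₁₂ k H).toLinearMap Q.Φ := by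
  set P := con₂ (Q.Δ₁₂.toLinearMap ∘ₗ LinearMap.mulRight k Q.U ∘ₗ Q.ΔS)
    (ι₁₂ k H).toLinearMap with hP
  -- For `R` either side, `R (1 ⊗ 1 ⊗ S(b)) = (Δ ⊗ id)(Δ(S(b₁₁))) R (b₁₂ ⊗ b₂ ⊗ 1)`, where
  -- `b₁₁ ⊗ b₁₂ = Δ(b₁)`, and the values `R (1 ⊗ 1 ⊗ α)` agree by the pentagon.
  set Λ : H ⊗[k] (H ⊗[k] H) → H ⊗[k] (H ⊗[k] H) →ₗ[k] H ⊗[k] (H ⊗[k] H) := fun y =>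
    con₂ (Q.Δ₁₂.toLinearMap ∘ₗ Q.ΔS) (LinearMap.mulLeft k y ∘ₗ (ι₁₂ k H).toLinearMap) with hΛ
  refine eq_of_mul_S (Q := Q) (ι := (ι₂₃ k H).comp (jR k H))
    (L := fun b y => Λ y (Q.Δ₁₂ (Q.comul b))) (fun b y c => ?_) (fun b => ?_) (fun b => ?_) ?_
  · generalize Q.Δ₁₂ (Q.comul b) = t
    induction t using tensor_induction₃ with
    | zero => simp
    | add u v hu hv => simp only [map_add, add_mul, hu, hv]
    | tmul x y z => simp [hΛ, mul_assoc]
  · have h1 : ∀ w, Q.φinv * (Q.Δ₂₃ Q.U * ι₂₃ k H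
        (con₂ Q.ΔS (LinearMap.mulLeft k Q.U ∘ₗ (jL k H).toLinearMap) w)) =
        Λ (Q.φinv * (Q.Δ₂₃ Q.U * ι₂₃ k H Q.U)) (Q.Δ₁₂ w) := by
      intro w
      induction w using TensorProduct.induction_on with
      | zero => simp
      | add u v hu hv => simp only [map_add, mul_add, hu, hv]
      | tmul c d =>
        have h2 : ∀ v, Q.φinv * (Q.Δ₂₃
            (con₂ Q.ΔS (LinearMap.mulLeft k Q.U ∘ₗ (jL k H).toLinearMap) v) *
              ι₂₃ k H (Q.U * (d ⊗ₜ 1))) =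
            Λ (Q.φinv * (Q.Δ₂₃ Q.U * ι₂₃ k H Q.U)) (TensorProduct.assoc k H H H (v ⊗ₜ d)) := by
          intro v
          induction v using TensorProduct.induction_on with
          | zero => simp
          | add u v hu hv => simp only [map_add, add_mul, mul_add, TensorProduct.add_tmul, hu, hv]
          | tmul e f =>
            have h3 : Q.Δ₂₃ (f ⊗ₜ[k] (1 : H)) * ι₂₃ k H (Q.U * (d ⊗ₜ 1)) =
                ι₂₃ k H Q.U * ι₁₂ k H (f ⊗ₜ d) := by
              simp [Δ₂₃_tmul]
            simp only [con₂_tmul, hΛ, ΔS_apply, LinearMap.comp_apply, LinearMap.mulLeft_apply,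
              AlgHom.toLinearMap_apply, map_mul, mul_assoc, jL_apply,
              TensorProduct.assoc_tmul] at h3 ⊢
            rw [Δ₁₂_comul_mul_φinv, h3]
        rw [Δ₁₂_tmul, ← h2, ΔS_mul_U]
        simp only [con₂_tmul, ΔS_apply, LinearMap.comp_apply, LinearMap.mulLeft_apply, map_mul,
          AlgHom.toLinearMap_apply, jL_apply, mul_assoc]
        rfl
    have h2 := h1 (Q.comul b)
    rw [ΔS_mul_U, map_mul] at h2
    rw [AlgHom.comp_apply, jR_apply]
    simpa only [mul_assoc] using h2
  · have h1 : ∀ t, P t * ι₂₃ k H (jR k H (Q.S b)) = P (Q.Δ₂₃ (Q.comul b) * t) := by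
      intro t
      induction t using tensor_induction₃ with
      | zero => simp
      | add u v hu hv => simp only [map_add, add_mul, mul_add, hu, hv]
      | tmul x y z =>
        have h2 : ∀ w, Q.Δ₁₂ (Q.comul (Q.S x) *
            con₂ Q.ΔS (LinearMap.mulLeft k Q.U ∘ₗ (jL k H).toLinearMap) w) * ι₁₂ k H (y ⊗ₜ z) =
            P (Q.Δ₂₃ w * (x ⊗ₜ (y ⊗ₜ z))) := by
          intro w
          induction w using TensorProduct.induction_on with
          | zero => simp
          | add u v hu hv => simp only [map_add, add_mul, mul_add, hu, hv]
          | tmul c d =>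
            have h3 : Q.Δ₂₃ (c ⊗ₜ d) * (x ⊗ₜ (y ⊗ₜ z)) = (c * x) ⊗ₜ (Q.comul d * (y ⊗ₜ z)) := by
              simp [Δ₂₃_tmul]
            rw [h3]
            simp only [hP, con₂_tmul, ΔS_apply, LinearMap.comp_apply, LinearMap.mulLeft_apply,
              LinearMap.mulRight_apply, AlgHom.toLinearMap_apply, jL_apply, map_mul, Q.S_mul,
              mul_assoc, Δ₁₂_jL]
        have h3 : ι₁₂ k H (y ⊗ₜ z) * ι₂₃ k H (jR k H (Q.S b)) =
            Q.Δ₁₂ (1 ⊗ₜ Q.S b) * ι₁₂ k H (y ⊗ₜ z) := by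
          rw [Δ₁₂_jR]
          simp
        rw [← h2, ΔS_mul_U]
        simp only [hP, con₂_tmul, ΔS_apply, LinearMap.comp_apply, LinearMap.mulRight_apply,
          AlgHom.toLinearMap_apply, mul_assoc, h3, map_mul]
    have h2 : ∀ t s, P (t * s) = Λ (P t) s := by
      intro t s
      induction s using TensorProduct.induction_on with
      | zero => simp
      | add u v hu hv => simp only [map_add, mul_add, hu, hv]
      | tmul c n =>
        induction t using TensorProduct.induction_on with
        | zero => simp [hΛ]
        | add u v hu hv =>
          rw [add_mul, map_add, map_add, hu, hv]
          simp [hΛ, add_mul, mul_add]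
        | tmul x m => simp [hP, hΛ, Q.S_mul, mul_assoc]
    rw [AlgHom.comp_apply, h1, Δ₂₃_comul_mul_Φ, h2]
  · set F := Q.Δ₁₂.toLinearMap ∘ₗ Q.comul.toLinearMap ∘ₗ LinearMap.mulRight k Q.α ∘ₗ
      Q.S.toLinearMap with hF
    have h1 : ∀ t, Q.φinv * (Q.Δ₂₃ Q.U * ι₂₃ k H
        (con₂ (Q.ΔS) (LinearMap.mulLeft k (Q.comul Q.α)) t)) =
        con₂ F (LinearMap.mulLeft k Q.φinv) (Q.Δ₃₄' Q.Φ * Q.Δ₁₂' t) := by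
      intro t
      induction t using tensor_induction₃ with
      | zero => simp
      | add u v hu hv => simp only [map_add, mul_add, hu, hv]
      | tmul x y z =>
        have h2 : ∀ v, Q.φinv * (Q.Δ₂₃ (con₂ Q.ΔS (LinearMap.mulLeft k Q.U ∘ₗ
            (jL k H).toLinearMap) v * (1 ⊗ₜ Q.α)) * ι₂₃ k H (y ⊗ₜ z)) =
            con₂ F (LinearMap.mulLeft k Q.φinv) (Q.Δ₃₄' Q.Φ *
              TensorProduct.assoc k H H (H ⊗[k] H) (v ⊗ₜ (y ⊗ₜ z))) := by
          intro v
          induction v using TensorProduct.induction_on with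
          | zero => simp
          | add u v hu hv =>
            simp only [map_add, add_mul, mul_add, TensorProduct.add_tmul, hu, hv]
          | tmul e f =>
            have h3 : ∀ t, Q.Δ₁₂ (Q.comul (Q.S e)) * (Q.φinv * (Q.Δ₂₃
                (con₂ (Q.ΔS) (LinearMap.mulLeft k (Q.comul Q.α)) t) * (f ⊗ₜ (y ⊗ₜ z)))) =
                con₂ F (LinearMap.mulLeft k Q.φinv)
                  (Q.Δ₃₄' t * (e ⊗ₜ (f ⊗ₜ (y ⊗ₜ z)))) := by
              intro t
              induction t using TensorProduct.induction_on with
              | zero => simp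
              | add u v hu hv => simp only [map_add, add_mul, mul_add, hu, hv]
              | tmul p m =>
                simp only [con₂_tmul, hF, Δ₃₄'_tmul, Algebra.TensorProduct.tmul_mul_tmul, ΔS_apply,
                  LinearMap.comp_apply, LinearMap.mulLeft_apply, LinearMap.mulRight_apply,
                  AlgHom.toLinearMap_apply, map_mul, Q.S_mul, mul_assoc, LinearEquiv.coe_coe,
                  Δ₁₂_comul_mul_φinv]
            have h4 : Q.Δ₂₃ (f ⊗ₜ 1) * (Q.Δ₂₃ (1 ⊗ₜ Q.α) * ι₂₃ k H (y ⊗ₜ z)) =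
                Q.Δ₂₃ (1 ⊗ₜ Q.α) * (f ⊗ₜ (y ⊗ₜ z)) := by
              simp [Δ₂₃_tmul]
            rw [TensorProduct.assoc_tmul, ← h3, ΔS_mul_α]
            simp only [con₂_tmul, ΔS_apply, LinearMap.comp_apply, LinearMap.mulLeft_apply,
              AlgHom.toLinearMap_apply, map_mul, mul_assoc, jL_apply, Δ₁₂_comul_mul_φinv, h4]
        have h3 : ι₂₃ k H (Q.comul (Q.S x)) = Q.Δ₂₃ (1 ⊗ₜ Q.S x) := rfl
        have h4 : ι₂₃ k H (Q.comul Q.α) = Q.Δ₂₃ (1 ⊗ₜ Q.α) := rfl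
        rw [Δ₁₂'_tmul, ← h2, ΔS_mul_U]
        simp only [con₂_tmul, ΔS_apply, LinearMap.comp_apply, LinearMap.mulLeft_apply,
          map_mul, mul_assoc, h3, h4]
    have h2 : ∀ t, P t * ι₂₃ k H (jR k H Q.α) = con₂ F LinearMap.id (Q.Δ₂₃' Q.Φ * ι₁₂₃ k H t) := by
      intro t
      induction t using tensor_induction₃ with
      | zero => simp
      | add u v hu hv => simp only [map_add, add_mul, mul_add, hu, hv]
      | tmul x y z =>
        have h3 : ι₁₂ k H (y ⊗ₜ z) * ι₂₃ k H (jR k H Q.α) =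
            Q.Δ₁₂ (1 ⊗ₜ Q.α) * ι₁₂ k H (y ⊗ₜ z) := by
          rw [Δ₁₂_jR]
          simp
        have h4 : ∀ t, Q.Δ₁₂ (Q.comul (Q.S x) *
            con₂ (Q.ΔS) (LinearMap.mulLeft k (Q.comul Q.α)) t) * ι₁₂ k H (y ⊗ₜ z) =
            con₂ F LinearMap.id (Q.Δ₂₃' t * ι₁₂₃ k H (x ⊗ₜ (y ⊗ₜ z))) := by
          intro t
          induction t using TensorProduct.induction_on with
          | zero => simp
          | add u v hu hv => simp only [map_add, add_mul, mul_add, hu, hv]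
          | tmul p m =>
            have h5 : Q.Δ₂₃' (p ⊗ₜ m) * ι₁₂₃ k H (x ⊗ₜ (y ⊗ₜ z)) =
                (p * x) ⊗ₜ (Q.Δ₁₂ m * ι₁₂ k H (y ⊗ₜ z)) := by
              simp [Δ₂₃'_tmul]
            rw [h5]
            simp only [con₂_tmul, hF, ΔS_apply, LinearMap.comp_apply, LinearMap.mulLeft_apply,
              LinearMap.mulRight_apply, AlgHom.toLinearMap_apply, map_mul, Q.S_mul, mul_assoc,
              LinearEquiv.coe_coe, LinearMap.id_apply]
        rw [← h4, ΔS_mul_α]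
        simp only [hP, con₂_tmul, ΔS_apply, LinearMap.comp_apply, LinearMap.mulRight_apply,
          AlgHom.toLinearMap_apply, mul_assoc, h3, map_mul]
    have h3 : ∀ t, con₂ F (LinearMap.mulLeft k Q.φinv) t =
        con₂ F LinearMap.id (ι₂₃₄ k H Q.φinv * t) := by
      intro t
      induction t using TensorProduct.induction_on with
      | zero => simp
      | add u v hu hv => simp only [map_add, mul_add, hu, hv]
      | tmul x m => simp
    have h4 := h1 Q.Φ
    rw [ΔS_mul_α, map_mul] at h4
    rw [AlgHom.comp_apply, h2, jR_apply, mul_assoc, mul_assoc, h4, h3, pentagon', mul_assoc,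
      ← mul_assoc (ι₂₃₄ k H Q.φinv), map_φinv_mul_map_Φ, one_mul]

/-- `(1 ⊗ V) (id ⊗ Δ)(V) φ = (Ȳ ⊗ Z̄ ⊗ 1) (Δ ⊗ id)(V Δ(S⁻¹(X̄)))`. -/
theorem Δ₂₃_V_mul_Φ :
    ι₂₃ k H Q.V * Q.Δ₂₃ Q.V * Q.Φ =
      rcon₂ (Q.Δ₁₂.toLinearMap ∘ₗ LinearMap.mulLeft k Q.V ∘ₗ Q.ΔSinv) (ι₁₂ k H).toLinearMap
        Q.φinv := by
  set P := rcon₂ (Q.Δ₁₂.toLinearMap ∘ₗ LinearMap.mulLeft k Q.V ∘ₗ Q.ΔSinv)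
    (ι₁₂ k H).toLinearMap with hP
  set Λ : H ⊗[k] (H ⊗[k] H) → H ⊗[k] (H ⊗[k] H) →ₗ[k] H ⊗[k] (H ⊗[k] H) := fun y =>
    rcon₂ (Q.Δ₁₂.toLinearMap ∘ₗ Q.ΔSinv) (LinearMap.mulRight k y ∘ₗ (ι₁₂ k H).toLinearMap) with hΛ
  refine eq_of_Sinv_mul (Q := Q) (ι := (ι₂₃ k H).comp (jR k H))
    (L := fun b y => Λ y (Q.Δ₁₂ (Q.comul b))) (fun b y c => ?_) (fun b => ?_) (fun b => ?_) ?_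
  · generalize Q.Δ₁₂ (Q.comul b) = t
    induction t using tensor_induction₃ with
    | zero => simp
    | add u v hu hv => simp only [map_add, mul_add, hu, hv]
    | tmul x y z => simp [hΛ, ← mul_assoc]
  · have h1 : ∀ w, ι₂₃ k H (rcon₂ Q.ΔSinv (LinearMap.mulRight k Q.V ∘ₗ
        (jL k H).toLinearMap) w) * Q.Δ₂₃ Q.V * Q.Φ =
        Λ (ι₂₃ k H Q.V * Q.Δ₂₃ Q.V * Q.Φ) (Q.Δ₁₂ w) := by
      intro w
      induction w using TensorProduct.induction_on with
      | zero => simp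
      | add u v hu hv => simp only [map_add, add_mul, hu, hv]
      | tmul c d =>
        have h2 : ∀ v, ι₂₃ k H ((d ⊗ₜ 1) * Q.V) * Q.Δ₂₃
            (rcon₂ Q.ΔSinv (LinearMap.mulRight k Q.V ∘ₗ (jL k H).toLinearMap) v) * Q.Φ =
            Λ (ι₂₃ k H Q.V * Q.Δ₂₃ Q.V * Q.Φ) (TensorProduct.assoc k H H H (v ⊗ₜ d)) := by
          intro v
          induction v using TensorProduct.induction_on with
          | zero => simp
          | add u v hu hv => simp only [map_add, add_mul, mul_add, TensorProduct.add_tmul, hu, hv]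
          | tmul e f =>
            have h3 : ι₂₃ k H ((d ⊗ₜ 1) * Q.V) * Q.Δ₂₃ (f ⊗ₜ[k] (1 : H)) =
                ι₁₂ k H (f ⊗ₜ d) * ι₂₃ k H Q.V := by
              simp [Δ₂₃_tmul]
            simp only [rcon₂_tmul, hΛ, ΔSinv_apply, LinearMap.comp_apply, LinearMap.mulRight_apply,
              AlgHom.toLinearMap_apply, map_mul, ← mul_assoc, jL_apply,
              TensorProduct.assoc_tmul] at h3 ⊢
            rw [mul_Δ₂₃_comul_mul_Φ, h3]
        have h3 : ι₂₃ k H (Q.comul (Q.Sinv c)) = Q.Δ₂₃ (1 ⊗ₜ Q.Sinv c) := rfl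
        rw [Δ₁₂_tmul, ← h2, V_mul_ΔSinv]
        simp only [rcon₂_tmul, ΔSinv_apply, LinearMap.comp_apply, LinearMap.mulRight_apply, map_mul,
          AlgHom.toLinearMap_apply, jL_apply, ← mul_assoc, h3]
    have h2 := h1 (Q.comul b)
    rw [V_mul_ΔSinv, map_mul] at h2
    rw [AlgHom.comp_apply, jR_apply]
    simpa only [mul_assoc] using h2
  · have h1 : ∀ t, ι₂₃ k H (jR k H (Q.Sinv b)) * P t = P (t * Q.Δ₂₃ (Q.comul b)) := by
      intro t
      induction t using tensor_induction₃ with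
      | zero => simp
      | add u v hu hv => simp only [map_add, add_mul, mul_add, hu, hv]
      | tmul x y z =>
        have h2 : ∀ w, ι₁₂ k H (y ⊗ₜ z) * Q.Δ₁₂ (rcon₂ Q.ΔSinv (LinearMap.mulRight k Q.V ∘ₗ
            (jL k H).toLinearMap) w * Q.comul (Q.Sinv x)) =
            P ((x ⊗ₜ (y ⊗ₜ z)) * Q.Δ₂₃ w) := by
          intro w
          induction w using TensorProduct.induction_on with
          | zero => simp
          | add u v hu hv => simp only [map_add, add_mul, mul_add, hu, hv]
          | tmul c d =>
            have h3 : (x ⊗ₜ (y ⊗ₜ z)) * Q.Δ₂₃ (c ⊗ₜ d) = (x * c) ⊗ₜ ((y ⊗ₜ z) * Q.comul d) := by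
              simp [Δ₂₃_tmul]
            rw [h3]
            simp only [hP, rcon₂_tmul, ΔSinv_apply, LinearMap.comp_apply, LinearMap.mulLeft_apply,
              LinearMap.mulRight_apply, AlgHom.toLinearMap_apply, jL_apply, map_mul, Q.Sinv_mul,
              mul_assoc, Δ₁₂_jL]
        have h3 : ι₂₃ k H (jR k H (Q.Sinv b)) * ι₁₂ k H (y ⊗ₜ z) =
            ι₁₂ k H (y ⊗ₜ z) * Q.Δ₁₂ (1 ⊗ₜ Q.Sinv b) := by
          rw [Δ₁₂_jR]
          simp
        rw [← h2, V_mul_ΔSinv]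
        simp only [hP, rcon₂_tmul, ΔSinv_apply, LinearMap.comp_apply, LinearMap.mulLeft_apply,
          AlgHom.toLinearMap_apply, ← mul_assoc, h3, map_mul]
    have h2 : ∀ t s, P (s * t) = Λ (P t) s := by
      intro t s
      induction s using TensorProduct.induction_on with
      | zero => simp
      | add u v hu hv => simp only [map_add, add_mul, hu, hv]
      | tmul c n =>
        induction t using TensorProduct.induction_on with
        | zero => simp [hΛ]
        | add u v hu hv =>
          rw [mul_add, map_add, map_add, hu, hv]
          simp [hΛ, add_mul, mul_add]
        | tmul x m => simp [hP, hΛ, Q.Sinv_mul, mul_assoc]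
    rw [AlgHom.comp_apply, h1, φinv_mul_Δ₂₃_comul, h2]
  · set F := Q.Δ₁₂.toLinearMap ∘ₗ Q.comul.toLinearMap ∘ₗ LinearMap.mulLeft k (Q.Sinv Q.β) ∘ₗ
      Q.Sinv with hF
    have h1 : ∀ t, ι₂₃ k H
        (rcon₂ Q.ΔSinv (LinearMap.mulRight k (Q.comul (Q.Sinv Q.β))) t) * Q.Δ₂₃ Q.V * Q.Φ =
        rcon₂ F (LinearMap.mulRight k Q.Φ) (Q.Δ₁₂' t * Q.Δ₃₄' Q.φinv) := by
      intro t
      induction t using tensor_induction₃ with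
      | zero => simp
      | add u v hu hv => simp only [map_add, add_mul, hu, hv]
      | tmul x y z =>
        have h2 : ∀ v, ι₂₃ k H (y ⊗ₜ z) * Q.Δ₂₃ ((1 ⊗ₜ Q.Sinv Q.β) * rcon₂ Q.ΔSinv
            (LinearMap.mulRight k Q.V ∘ₗ (jL k H).toLinearMap) v) * Q.Φ =
            rcon₂ F (LinearMap.mulRight k Q.Φ)
              (TensorProduct.assoc k H H (H ⊗[k] H) (v ⊗ₜ (y ⊗ₜ z)) * Q.Δ₃₄' Q.φinv) := by
          intro v
          induction v using TensorProduct.induction_on with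
          | zero => simp
          | add u v hu hv =>
            simp only [map_add, add_mul, mul_add, TensorProduct.add_tmul, hu, hv]
          | tmul e f =>
            have h3 : ∀ t, (f ⊗ₜ (y ⊗ₜ z)) * Q.Δ₂₃
                (rcon₂ Q.ΔSinv (LinearMap.mulRight k (Q.comul (Q.Sinv Q.β))) t) * Q.Φ *
                  Q.Δ₁₂ (Q.comul (Q.Sinv e)) =
                rcon₂ F (LinearMap.mulRight k Q.Φ)
                  ((e ⊗ₜ (f ⊗ₜ (y ⊗ₜ z))) * Q.Δ₃₄' t) := by
              intro t
              induction t using TensorProduct.induction_on with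
              | zero => simp
              | add u v hu hv => simp only [map_add, add_mul, mul_add, hu, hv]
              | tmul p m =>
                simp only [rcon₂_tmul, hF, Δ₃₄'_tmul, Algebra.TensorProduct.tmul_mul_tmul,
                  ΔSinv_apply, LinearMap.comp_apply, LinearMap.mulLeft_apply,
                  LinearMap.mulRight_apply, AlgHom.toLinearMap_apply, map_mul, Q.Sinv_mul,
                  ← mul_assoc, mul_Δ₂₃_comul_mul_Φ]
            have h4 : ι₂₃ k H (y ⊗ₜ z) * Q.Δ₂₃ (1 ⊗ₜ Q.Sinv Q.β) * Q.Δ₂₃ (f ⊗ₜ 1) =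
                (f ⊗ₜ (y ⊗ₜ z)) * Q.Δ₂₃ (1 ⊗ₜ Q.Sinv Q.β) := by
              simp [Δ₂₃_tmul]
            rw [TensorProduct.assoc_tmul, ← h3, mul_ΔSinv_β]
            simp only [rcon₂_tmul, ΔSinv_apply, LinearMap.comp_apply, LinearMap.mulRight_apply,
              AlgHom.toLinearMap_apply, map_mul, ← mul_assoc, jL_apply, mul_Δ₂₃_comul_mul_Φ, h4]
        have h3 : ι₂₃ k H (Q.comul (Q.Sinv x)) = Q.Δ₂₃ (1 ⊗ₜ Q.Sinv x) := rfl
        have h4 : ι₂₃ k H (Q.comul (Q.Sinv Q.β)) = Q.Δ₂₃ (1 ⊗ₜ Q.Sinv Q.β) := rfl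
        rw [Δ₁₂'_tmul, ← h2, V_mul_ΔSinv]
        simp only [rcon₂_tmul, ΔSinv_apply, LinearMap.comp_apply, LinearMap.mulRight_apply,
          map_mul, ← mul_assoc, h3, h4]
    have h2 : ∀ t, ι₂₃ k H (jR k H (Q.Sinv Q.β)) * P t =
        rcon₂ F LinearMap.id (ι₁₂₃ k H t * Q.Δ₂₃' Q.φinv) := by
      intro t
      induction t using tensor_induction₃ with
      | zero => simp
      | add u v hu hv => simp only [map_add, add_mul, mul_add, hu, hv]
      | tmul x y z =>
        have h3 : ι₂₃ k H (jR k H (Q.Sinv Q.β)) * ι₁₂ k H (y ⊗ₜ z) =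
            ι₁₂ k H (y ⊗ₜ z) * Q.Δ₁₂ (1 ⊗ₜ Q.Sinv Q.β) := by
          rw [Δ₁₂_jR]
          simp
        have h4 : ∀ t, ι₁₂ k H (y ⊗ₜ z) * Q.Δ₁₂
            (rcon₂ Q.ΔSinv (LinearMap.mulRight k (Q.comul (Q.Sinv Q.β))) t *
              Q.comul (Q.Sinv x)) =
            rcon₂ F LinearMap.id (ι₁₂₃ k H (x ⊗ₜ (y ⊗ₜ z)) * Q.Δ₂₃' t) := by
          intro t
          induction t using TensorProduct.induction_on with
          | zero => simp
          | add u v hu hv => simp only [map_add, add_mul, mul_add, hu, hv]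
          | tmul p m =>
            have h5 : ι₁₂₃ k H (x ⊗ₜ (y ⊗ₜ z)) * Q.Δ₂₃' (p ⊗ₜ m) =
                (x * p) ⊗ₜ (ι₁₂ k H (y ⊗ₜ z) * Q.Δ₁₂ m) := by
              simp [Δ₂₃'_tmul]
            rw [h5]
            simp only [rcon₂_tmul, hF, ΔSinv_apply, LinearMap.comp_apply, LinearMap.mulLeft_apply,
              LinearMap.mulRight_apply, AlgHom.toLinearMap_apply, map_mul, Q.Sinv_mul, mul_assoc,
              LinearMap.id_apply]
        rw [← h4, mul_ΔSinv_β]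
        simp only [hP, rcon₂_tmul, ΔSinv_apply, LinearMap.comp_apply, LinearMap.mulLeft_apply,
          AlgHom.toLinearMap_apply, ← mul_assoc, h3, map_mul]
    have h3 : ∀ t, rcon₂ F (LinearMap.mulRight k Q.Φ) t =
        rcon₂ F LinearMap.id (t * ι₂₃₄ k H Q.Φ) := by
      intro t
      induction t using TensorProduct.induction_on with
      | zero => simp
      | add u v hu hv => simp only [map_add, add_mul, hu, hv]
      | tmul x m => simp
    have h4 := h1 Q.φinv
    rw [mul_ΔSinv_β, map_mul] at h4
    rw [AlgHom.comp_apply, h2, jR_apply, ← mul_assoc, ← mul_assoc, h4, h3, pentagon_ι₁₂₃_inv]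
    simp only [mul_assoc]
    rw [map_Φ_mul_map_φinv, mul_one]

end UVCoherence

end QuasiHopfAlgebra

/-! ### Quasi-Hopf bimodules -/

namespace CoactedBimodule

variable {k H M : Type*} [Field k] [Ring H] [Algebra k H] [AddCommGroup M] [Module k M]
  (B : CoactedBimodule k H M) {N : Type*} [Ring N] [Algebra k N]

/-- The left action of `H ⊗ N` on `M ⊗ N`, for an algebra `N`. -/
def lact : H ⊗[k] N →ₗ[k] M ⊗[k] N →ₗ[k] M ⊗[k] N :=
  TensorProduct.map₂ B.left (LinearMap.mul k N)

/-- The right action of `H ⊗ N` on `M ⊗ N`, for an algebra `N`. -/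
def ract : H ⊗[k] N →ₗ[k] M ⊗[k] N →ₗ[k] M ⊗[k] N :=
  TensorProduct.map₂ B.right (LinearMap.mul k N).flip

@[simp]
theorem lact_tmul (a : H) (n n' : N) (m : M) :
    B.lact (a ⊗ₜ n) (m ⊗ₜ n') = B.left a m ⊗ₜ (n * n') := rfl

@[simp]
theorem ract_tmul (a : H) (n n' : N) (m : M) :
    B.ract (a ⊗ₜ n) (m ⊗ₜ n') = B.right a m ⊗ₜ (n' * n) := rfl

theorem lact_mul (s t : H ⊗[k] N) (T : M ⊗[k] N) : B.lact (s * t) T = B.lact s (B.lact t T) := by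
  induction T using TensorProduct.induction_on with
  | zero => simp
  | add u v hu hv => simp only [map_add, hu, hv]
  | tmul m n =>
    induction s using TensorProduct.induction_on with
    | zero => simp
    | add u v hu hv => simp only [add_mul, map_add, LinearMap.add_apply, hu, hv]
    | tmul a b =>
      induction t using TensorProduct.induction_on with
      | zero => simp
      | add u v hu hv => simp only [mul_add, map_add, LinearMap.add_apply, hu, hv]
      | tmul c d => simp [B.left_mul, mul_assoc]

theorem lact_one (T : M ⊗[k] N) : B.lact 1 T = T := by
  induction T using TensorProduct.induction_on with
  | zero => simp
  | add u v hu hv => simp only [map_add, hu, hv]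
  | tmul m n => simp [Algebra.TensorProduct.one_def, B.left_one]

theorem lact_ract (s t : H ⊗[k] N) (T : M ⊗[k] N) :
    B.lact s (B.ract t T) = B.ract t (B.lact s T) := by
  induction T using TensorProduct.induction_on with
  | zero => simp
  | add u v hu hv => simp only [map_add, hu, hv]
  | tmul m n =>
    induction s using TensorProduct.induction_on with
    | zero => simp
    | add u v hu hv => simp only [map_add, LinearMap.add_apply, hu, hv]
    | tmul a b =>
      induction t using TensorProduct.induction_on with
      | zero => simp
      | add u v hu hv => simp only [map_add, LinearMap.add_apply, hu, hv]
      | tmul c d => simp [B.left_right, mul_assoc]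

end CoactedBimodule

namespace QuasiHopfAlgebra

variable {k H : Type*} [Field k] [Ring H] [Algebra k H] (Q : QuasiHopfAlgebra k H)

/-- A bimodule with a coaction `ρ` is a (right) quasi-Hopf bimodule if `ρ` is a bimodule morphism
with respect to `Δ`, coassociative up to `φ`, and counital. -/
structure IsQuasiHopfBimodule {M : Type*} [AddCommGroup M] [Module k M]
    (B : CoactedBimodule k H M) : Prop where
  coaction_left : ∀ a m, B.coaction (B.left a m) = B.lact (Q.comul a) (B.coaction m)
  coaction_right : ∀ a m, B.coaction (B.right a m) = B.ract (Q.comul a) (B.coaction m)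
  coassoc : ∀ m, B.lact Q.Φ (TensorProduct.assoc k M H H
      (TensorProduct.map B.coaction LinearMap.id (B.coaction m))) =
    B.ract Q.Φ (TensorProduct.map LinearMap.id Q.comul.toLinearMap (B.coaction m))
  counit : ∀ m, TensorProduct.rid k M
    (TensorProduct.map LinearMap.id Q.counit.toLinearMap (B.coaction m)) = m

section Dual

/-- `id ⊗ ψ : H ⊗ H → H`. -/
def slice (ψ : Module.Dual k H) : H ⊗[k] H →ₗ[k] H :=
  (TensorProduct.rid k H).toLinearMap ∘ₗ TensorProduct.map LinearMap.id ψ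

@[simp]
theorem slice_tmul (ψ : Module.Dual k H) (x y : H) : slice ψ (x ⊗ₜ y) = ψ y • x := by
  simp [slice]

/-- `id ⊗ id ⊗ ψ : H ⊗ H ⊗ H → H ⊗ H`. -/
def slice₃ (ψ : Module.Dual k H) : H ⊗[k] (H ⊗[k] H) →ₗ[k] H ⊗[k] H :=
  TensorProduct.map LinearMap.id (slice ψ)

@[simp]
theorem slice₃_tmul (ψ : Module.Dual k H) (x : H) (t : H ⊗[k] H) :
    slice₃ ψ (x ⊗ₜ t) = x ⊗ₜ slice ψ t := rfl

theorem slice_tmul_one_mul (ψ : Module.Dual k H) (c : H) (t : H ⊗[k] H) :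
    slice ψ ((c ⊗ₜ 1) * t) = c * slice ψ t := by
  induction t using TensorProduct.induction_on with
  | zero => simp
  | add u v hu hv => simp only [mul_add, map_add, hu, hv]
  | tmul x y => simp

theorem slice_mul_tmul_one (ψ : Module.Dual k H) (c : H) (t : H ⊗[k] H) :
    slice ψ (t * (c ⊗ₜ 1)) = slice ψ t * c := by
  induction t using TensorProduct.induction_on with
  | zero => simp
  | add u v hu hv => simp only [add_mul, map_add, hu, hv]
  | tmul x y => simp

theorem slice_comp_mulLeft (ψ : Module.Dual k H) (c : H) (t : H ⊗[k] H) :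
    slice (ψ ∘ₗ LinearMap.mulLeft k c) t = slice ψ ((1 ⊗ₜ c) * t) := by
  induction t using TensorProduct.induction_on with
  | zero => simp
  | add u v hu hv => simp only [mul_add, map_add, hu, hv]
  | tmul x y => simp

theorem slice_comp_mulRight (ψ : Module.Dual k H) (c : H) (t : H ⊗[k] H) :
    slice (ψ ∘ₗ LinearMap.mulRight k c) t = slice ψ (t * (1 ⊗ₜ c)) := by
  induction t using TensorProduct.induction_on with
  | zero => simp
  | add u v hu hv => simp only [add_mul, map_add, hu, hv]
  | tmul x y => simp

theorem slice₃_ι₁₂_mul (ψ : Module.Dual k H) (n : H ⊗[k] H) (t : H ⊗[k] (H ⊗[k] H)) :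
    slice₃ ψ (ι₁₂ k H n * t) = n * slice₃ ψ t := by
  induction t using tensor_induction₃ with
  | zero => simp
  | add u v hu hv => simp only [mul_add, map_add, hu, hv]
  | tmul x y z =>
    induction n using TensorProduct.induction_on with
    | zero => simp
    | add u v hu hv => simp only [add_mul, map_add, hu, hv]
    | tmul a b => simp

theorem slice₃_mul_ι₁₂ (ψ : Module.Dual k H) (n : H ⊗[k] H) (t : H ⊗[k] (H ⊗[k] H)) :
    slice₃ ψ (t * ι₁₂ k H n) = slice₃ ψ t * n := by
  induction t using tensor_induction₃ with
  | zero => simp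
  | add u v hu hv => simp only [add_mul, map_add, hu, hv]
  | tmul x y z =>
    induction n using TensorProduct.induction_on with
    | zero => simp
    | add u v hu hv => simp only [mul_add, map_add, hu, hv]
    | tmul a b => simp

theorem slice₃_Δ₁₂ (ψ : Module.Dual k H) (t : H ⊗[k] H) :
    slice₃ ψ (Q.Δ₁₂ t) = Q.comul (slice ψ t) := by
  induction t using TensorProduct.induction_on with
  | zero => simp
  | add u v hu hv => simp only [map_add, hu, hv]
  | tmul x y =>
    rw [Δ₁₂_tmul, slice_tmul, map_smul]
    generalize Q.comul x = w
    induction w using TensorProduct.induction_on with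
    | zero => simp
    | add u v hu hv =>
      simp only [map_add, TensorProduct.add_tmul, smul_add, hu, hv]
    | tmul a b => simp

theorem counit_slice (ψ : Module.Dual k H) (t : H ⊗[k] H) :
    Q.counit (slice ψ t) = ψ (Q.εl t) := by
  induction t using TensorProduct.induction_on with
  | zero => simp
  | add u v hu hv => simp only [map_add, hu, hv]
  | tmul x y => simp [mul_comm]

variable [FiniteDimensional k H]

/-- The coaction of `H^*` in `Hom(H, H)`: `ρ(ψ)(a) = (id ⊗ ψ)(V Δ(a) U)`. -/
theorem dualTensorHom_coaction (ψ : Module.Dual k H) (a : H) :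
    dualTensorHom k H H (Q.dualBimodule.coaction ψ) a = slice ψ (Q.V * (Q.comul a * Q.U)) := by
  rw [← mul_assoc]
  exact Q.dualTensorHom_dualCoaction ψ a

theorem dualBimodule_left (a : H) (ψ : Module.Dual k H) :
    Q.dualBimodule.left a ψ = ψ ∘ₗ LinearMap.mulLeft k (Q.Sinv a) := rfl

theorem dualBimodule_right (a : H) (ψ : Module.Dual k H) :
    Q.dualBimodule.right a ψ = ψ ∘ₗ LinearMap.mulRight k (Q.S a) := rfl

theorem dualTensorHom_lact {N : Type*} [Ring N] [Algebra k N] (a : H) (n : N)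
    (T : Module.Dual k H ⊗[k] N) (x : H) :
    dualTensorHom k H N (Q.dualBimodule.lact (a ⊗ₜ n) T) x =
      n * dualTensorHom k H N T (Q.Sinv a * x) := by
  induction T using TensorProduct.induction_on with
  | zero => simp
  | add u v hu hv => simp only [map_add, LinearMap.add_apply, mul_add, hu, hv]
  | tmul ψ n' => simp [dualBimodule_left]

theorem dualTensorHom_ract {N : Type*} [Ring N] [Algebra k N] (a : H) (n : N)
    (T : Module.Dual k H ⊗[k] N) (x : H) :
    dualTensorHom k H N (Q.dualBimodule.ract (a ⊗ₜ n) T) x =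
      dualTensorHom k H N T (x * Q.S a) * n := by
  induction T using TensorProduct.induction_on with
  | zero => simp
  | add u v hu hv => simp only [map_add, LinearMap.add_apply, add_mul, hu, hv]
  | tmul ψ n' => simp [dualBimodule_right]

/-- `(ρ ⊗ id)(T)` as a map `H → H ⊗ H`, for `T ∈ H^* ⊗ H` regarded as a map `H → H`: it is
`x ↦ (id ⊗ T)(V Δ(x) U)`. -/
theorem dualTensorHom_assoc_coaction (T : Module.Dual k H ⊗[k] H) (x : H) :
    dualTensorHom k H (H ⊗[k] H) (TensorProduct.assoc k (Module.Dual k H) H H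
      (TensorProduct.map Q.dualBimodule.coaction LinearMap.id T)) x =
    TensorProduct.map LinearMap.id (dualTensorHom k H H T) (Q.V * (Q.comul x * Q.U)) := by
  induction T using TensorProduct.induction_on with
  | zero => simp
  | add u v hu hv =>
    simp only [map_add, LinearMap.add_apply, TensorProduct.map_add_right, hu, hv]
  | tmul ψ h =>
    have h1 : ∀ T : Module.Dual k H ⊗[k] H, dualTensorHom k H (H ⊗[k] H)
        (TensorProduct.assoc k (Module.Dual k H) H H (T ⊗ₜ h)) x =
          dualTensorHom k H H T x ⊗ₜ h := by
      intro T
      induction T using TensorProduct.induction_on with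
      | zero => simp
      | add u v hu hv =>
        simp only [map_add, LinearMap.add_apply, TensorProduct.add_tmul, hu, hv]
      | tmul χ h' => simp [TensorProduct.smul_tmul']
    have h2 : ∀ t : H ⊗[k] H, TensorProduct.map LinearMap.id
        (dualTensorHom k H H (ψ ⊗ₜ[k] h)) t = slice ψ t ⊗ₜ h := by
      intro t
      induction t using TensorProduct.induction_on with
      | zero => simp
      | add u v hu hv => simp only [map_add, TensorProduct.add_tmul, hu, hv]
      | tmul a b => simp [TensorProduct.smul_tmul']
    rw [TensorProduct.map_tmul, LinearMap.id_apply, h1, dualTensorHom_coaction, h2]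

/-- The dual of `H` is a quasi-Hopf bimodule. The coaction is a bimodule map by the equivariance of
`V` and `U`, and it is coassociative because both sides evaluate at `x` to the contraction by `ψ` of
`(Δ ⊗ id)(V) φ⁻¹ (id ⊗ Δ)(Δ(x) U) (1 ⊗ U)`. -/
theorem isQuasiHopfBimodule_dual : Q.IsQuasiHopfBimodule Q.dualBimodule where
  coaction_left a ψ := by
    apply dualTensorHom_bijective.injective
    ext x
    have h1 : ∀ w, slice ψ (rcon₂ Q.ΔSinv (LinearMap.mulRight k Q.V ∘ₗ (jL k H).toLinearMap) w *
        (Q.comul x * Q.U)) =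
        dualTensorHom k H H (Q.dualBimodule.lact w (Q.dualBimodule.coaction ψ)) x := by
      intro w
      induction w using TensorProduct.induction_on with
      | zero => simp
      | add u v hu hv => simp only [map_add, add_mul, LinearMap.add_apply, hu, hv]
      | tmul c d =>
        rw [dualTensorHom_lact, dualTensorHom_coaction, ← slice_tmul_one_mul]
        simp [mul_assoc]
    rw [← h1, dualTensorHom_coaction, dualBimodule_left, slice_comp_mulLeft, V_mul_ΔSinv,
      mul_assoc]
  coaction_right a ψ := by
    apply dualTensorHom_bijective.injective
    ext x
    have h1 : ∀ w, slice ψ (Q.V * (Q.comul x *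
        con₂ Q.ΔS (LinearMap.mulLeft k Q.U ∘ₗ (jL k H).toLinearMap) w)) =
        dualTensorHom k H H (Q.dualBimodule.ract w (Q.dualBimodule.coaction ψ)) x := by
      intro w
      induction w using TensorProduct.induction_on with
      | zero => simp
      | add u v hu hv => simp only [map_add, mul_add, LinearMap.add_apply, hu, hv]
      | tmul c d =>
        rw [dualTensorHom_ract, dualTensorHom_coaction, ← slice_mul_tmul_one]
        simp [mul_assoc]
    rw [← h1, dualTensorHom_coaction, dualBimodule_right, slice_comp_mulRight, ΔS_mul_U]
    simp only [mul_assoc]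
  coassoc ψ := by
    apply dualTensorHom_bijective.injective
    ext1 x
    set y := ι₂₃ k H Q.V * Q.Δ₂₃ Q.V with hy
    have h1 : ∀ t, dualTensorHom k H (H ⊗[k] H) (Q.dualBimodule.lact t
        (TensorProduct.assoc k (Module.Dual k H) H H (TensorProduct.map Q.dualBimodule.coaction
          LinearMap.id (Q.dualBimodule.coaction ψ)))) x =
        slice₃ ψ (rcon₂ (Q.Δ₂₃.toLinearMap ∘ₗ Q.ΔSinv)
          (LinearMap.mulRight k y ∘ₗ (ι₁₂ k H).toLinearMap) t *
            (Q.Δ₂₃ (Q.comul x) * (Q.Δ₂₃ Q.U * ι₂₃ k H Q.U))) := by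
      intro t
      induction t using TensorProduct.induction_on with
      | zero => simp
      | add u v hu hv => simp only [map_add, add_mul, LinearMap.add_apply, hu, hv]
      | tmul a n =>
        have h2 : ∀ t, TensorProduct.map LinearMap.id
            (dualTensorHom k H H (Q.dualBimodule.coaction ψ)) t =
            slice₃ ψ (ι₂₃ k H Q.V * (Q.Δ₂₃ t * ι₂₃ k H Q.U)) := by
          intro t
          induction t using TensorProduct.induction_on with
          | zero => simp
          | add u v hu hv => simp only [map_add, mul_add, add_mul, hu, hv]
          | tmul c d => simp [Δ₂₃_tmul, dualTensorHom_coaction]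
        rw [dualTensorHom_lact, dualTensorHom_assoc_coaction, h2, ← slice₃_ι₁₂_mul]
        simp [hy, mul_assoc]
    have h2 : ∀ t, dualTensorHom k H (H ⊗[k] H) (Q.dualBimodule.ract t
        (TensorProduct.map LinearMap.id Q.comul.toLinearMap (Q.dualBimodule.coaction ψ))) x =
        slice₃ ψ (Q.Δ₁₂ Q.V * (Q.Δ₁₂ (Q.comul x) * con₂ (Q.Δ₁₂.toLinearMap ∘ₗ
          LinearMap.mulRight k Q.U ∘ₗ Q.ΔS) (ι₁₂ k H).toLinearMap t)) := by
      intro t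
      induction t using TensorProduct.induction_on with
      | zero => simp
      | add u v hu hv => simp only [map_add, mul_add, LinearMap.add_apply, hu, hv]
      | tmul a n =>
        have h3 : ∀ (T : Module.Dual k H ⊗[k] H) z, dualTensorHom k H (H ⊗[k] H)
            (TensorProduct.map LinearMap.id Q.comul.toLinearMap T) z =
            Q.comul (dualTensorHom k H H T z) := by
          intro T z
          induction T using TensorProduct.induction_on with
          | zero => simp
          | add u v hu hv => simp only [map_add, LinearMap.add_apply, hu, hv]
          | tmul c d => simp
        rw [dualTensorHom_ract, h3, dualTensorHom_coaction, ← slice₃_Δ₁₂, ← slice₃_mul_ι₁₂]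
        simp [mul_assoc]
    -- `Δ₂₃_V_mul_Φ`, solved for `(Δ ⊗ id)(V) φ⁻¹`.
    have h3 : rcon₂ (Q.Δ₂₃.toLinearMap ∘ₗ Q.ΔSinv)
        (LinearMap.mulRight k y ∘ₗ (ι₁₂ k H).toLinearMap) Q.Φ = Q.Δ₁₂ Q.V * Q.φinv := by
      have h4 : ∀ t s, rcon₂ (Q.Δ₂₃.toLinearMap ∘ₗ Q.ΔSinv)
          (LinearMap.mulRight k y ∘ₗ (ι₁₂ k H).toLinearMap) t * Q.Φ =
          rcon₂ (Q.Δ₁₂.toLinearMap ∘ₗ Q.ΔSinv)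
          (LinearMap.mulRight k (y * Q.Φ) ∘ₗ (ι₁₂ k H).toLinearMap) t ∧
          rcon₂ (Q.Δ₁₂.toLinearMap ∘ₗ Q.ΔSinv) (LinearMap.mulRight k
            (rcon₂ (Q.Δ₁₂.toLinearMap ∘ₗ LinearMap.mulLeft k Q.V ∘ₗ Q.ΔSinv)
              (ι₁₂ k H).toLinearMap s) ∘ₗ (ι₁₂ k H).toLinearMap) t =
          rcon₂ (Q.Δ₁₂.toLinearMap ∘ₗ LinearMap.mulLeft k Q.V ∘ₗ Q.ΔSinv)
              (ι₁₂ k H).toLinearMap (t * s) := by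
        intro t s
        constructor
        · induction t using TensorProduct.induction_on with
          | zero => simp
          | add u v hu hv => simp only [map_add, add_mul, hu, hv]
          | tmul a n =>
            simp only [rcon₂_tmul, ΔSinv_apply, LinearMap.comp_apply, LinearMap.mulRight_apply,
              AlgHom.toLinearMap_apply, mul_Δ₂₃_comul_mul_Φ, ← mul_assoc]
        · induction t using TensorProduct.induction_on with
          | zero => simp
          | add u v hu hv => simp only [map_add, add_mul, hu, hv]
          | tmul a n =>
            induction s using TensorProduct.induction_on with
            | zero => simp
            | add u v hu hv =>
              rw [mul_add, map_add, map_add, ← hu, ← hv]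
              simp [mul_add, add_mul]
            | tmul x m => simp [Q.Sinv_mul, mul_assoc]
      have h5 := (h4 Q.Φ Q.φinv).1
      rw [Δ₂₃_V_mul_Φ, (h4 Q.Φ Q.φinv).2, Φ_mul_φinv] at h5
      have h6 := congrArg (· * Q.φinv) h5
      simp only [mul_assoc, Φ_mul_φinv, mul_one] at h6
      rw [h6, Algebra.TensorProduct.one_def]
      simp
    rw [h1, h2, h3, ← φinv_mul_Δ₂₃_U, mul_assoc, Δ₁₂_comul_mul_φinv]
  counit ψ := by
    ext x
    have h1 : ∀ T : Module.Dual k H ⊗[k] H, TensorProduct.rid k (Module.Dual k H)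
        (TensorProduct.map LinearMap.id Q.counit.toLinearMap T) x =
        Q.counit (dualTensorHom k H H T x) := by
      intro T
      induction T using TensorProduct.induction_on with
      | zero => simp
      | add u v hu hv => simp only [map_add, LinearMap.add_apply, hu, hv]
      | tmul c d => simp [mul_comm]
    rw [h1, dualTensorHom_coaction, counit_slice, map_mul Q.εl, map_mul Q.εl, εl_U, εl_V, εl_comul,
      one_mul, mul_one]

end Dual

end QuasiHopfAlgebra

namespace QuasiHopfAlgebra

variable {k H : Type*} [Field k] [Ring H] [Algebra k H] (Q : QuasiHopfAlgebra k H)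

/-! ### The structure theorem for quasi-Hopf bimodules -/

section Structure

variable {M : Type*} [AddCommGroup M] [Module k M] (B : CoactedBimodule k H M)

theorem E_apply (m : M) : Q.E B m = Q.rightβS B (B.lact Q.qR (B.coaction m)) := rfl

theorem rightβS_tmul (m : M) (a : H) : Q.rightβS B (m ⊗ₜ a) = B.right (Q.β * Q.S a) m := rfl

/-- The right action `m ⊗ a ↦ m · a`. -/
def actR : M ⊗[k] H →ₗ[k] M := TensorProduct.lift B.right.flip

@[simp]
theorem actR_tmul (m : M) (a : H) : actR B (m ⊗ₜ a) = B.right a m := rfl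

variable {Q B}

/-- `E(m · a) = ε(a) E(m)`. -/
theorem IsQuasiHopfBimodule.E_right (hB : Q.IsQuasiHopfBimodule B) (a : H) (m : M) :
    Q.E B (B.right a m) = Q.counit a • Q.E B m := by
  have key : ∀ q (T : M ⊗[k] H), Q.rightβS B (B.lact q (B.ract (Q.comul a) T)) =
      Q.counit a • Q.rightβS B (B.lact q T) := by
    intro q T
    induction q using TensorProduct.induction_on with
    | zero => simp
    | add u v hu hv => simp only [map_add, LinearMap.add_apply, smul_add, hu, hv]
    | tmul q₁ q₂ =>
      induction T using TensorProduct.induction_on with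
      | zero => simp
      | add u v hu hv => simp only [map_add, smul_add, hu, hv]
      | tmul n h =>
        have h1 : ∀ w, Q.rightβS B (B.lact (q₁ ⊗ₜ q₂) (B.ract w (n ⊗ₜ h))) =
            B.right (con₂ (mid 1 (AlgHom.id k H) Q.β) Q.S.toLinearMap w * Q.S (q₂ * h))
              (B.left q₁ n) := by
          intro w
          induction w using TensorProduct.induction_on with
          | zero => simp
          | add u v hu hv => simp only [map_add, LinearMap.add_apply, add_mul, hu, hv]
          | tmul c d =>
            simp [rightβS_tmul, B.left_right, ← B.right_mul, Q.S_mul, mul_assoc]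
        rw [h1, Q.isAntipodeAlong_id.right]
        simp [rightβS_tmul]
  rw [E_apply, hB.coaction_right, key, E_apply]

/-- `E(m₍₀₎) · m₍₁₎ = m`. -/
theorem IsQuasiHopfBimodule.actR_E (hB : Q.IsQuasiHopfBimodule B) (m : M) :
    actR B (TensorProduct.map (Q.E B) LinearMap.id (B.coaction m)) = m := by
  -- The contraction `n ⊗ a ⊗ b ↦ n · β S(a) α b`.
  set Θ : M ⊗[k] (H ⊗[k] H) →ₗ[k] M := actR B ∘ₗ TensorProduct.map LinearMap.id
    (con₂ (LinearMap.mulLeft k Q.β ∘ₗ Q.S.toLinearMap) (LinearMap.mulLeft k Q.α)) with hΘ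
  have h1 : ∀ T : M ⊗[k] H, actR B (TensorProduct.map (Q.E B) LinearMap.id T) =
      Θ (B.lact Q.Φ (TensorProduct.assoc k M H H
        (TensorProduct.map B.coaction LinearMap.id T))) := by
    intro T
    induction T using TensorProduct.induction_on with
    | zero => simp
    | add u v hu hv => simp only [map_add, hu, hv]
    | tmul m b =>
      have h2 : ∀ (t : H ⊗[k] (H ⊗[k] H)) (T : M ⊗[k] H), B.right b (Q.rightβS B
          (B.lact (TensorProduct.map LinearMap.id Q.Sinvαmul t) T)) =
          Θ (B.lact t (TensorProduct.assoc k M H H (T ⊗ₜ b))) := by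
        intro t T
        induction T using TensorProduct.induction_on with
        | zero => simp
        | add u v hu hv => simp only [map_add, TensorProduct.add_tmul, hu, hv]
        | tmul n a =>
          induction t using tensor_induction₃ with
          | zero => simp
          | add u v hu hv => simp only [map_add, LinearMap.add_apply, hu, hv]
          | tmul x y z =>
            simp [hΘ, rightβS_tmul, Sinvαmul_tmul, Q.S_mul, ← B.right_mul, mul_assoc]
      rw [TensorProduct.map_tmul, TensorProduct.map_tmul, actR_tmul, E_apply, qR]
      exact h2 _ _
  have h2 : ∀ (t : H ⊗[k] (H ⊗[k] H)) (T : M ⊗[k] H),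
      Θ (B.ract t (TensorProduct.map LinearMap.id Q.comul.toLinearMap T)) =
      B.right (con₃ (mid 1 (AlgHom.id k H) Q.β) Q.S.toLinearMap (mid Q.α (AlgHom.id k H) 1) t)
        (TensorProduct.rid k M (TensorProduct.map LinearMap.id Q.counit.toLinearMap T)) := by
    intro t T
    induction T using TensorProduct.induction_on with
    | zero => simp
    | add u v hu hv => simp only [map_add, hu, hv]
    | tmul n h =>
      induction t using tensor_induction₃ with
      | zero => simp
      | add u v hu hv => simp only [map_add, LinearMap.add_apply, hu, hv]
      | tmul x y z =>
        have h3 : ∀ w : H ⊗[k] H, Θ (B.ract (x ⊗ₜ (y ⊗ₜ z)) (n ⊗ₜ w)) =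
            B.right (x * (Q.β * (Q.S y * (con₂ Q.S.toLinearMap
              (mid Q.α (AlgHom.id k H) 1) w * z)))) n := by
          intro w
          induction w using TensorProduct.induction_on with
          | zero => simp
          | add u v hu hv =>
            simp only [map_add, LinearMap.add_apply, TensorProduct.tmul_add, mul_add, add_mul,
              hu, hv]
          | tmul c d => simp [hΘ, Q.S_mul, ← B.right_mul, mul_assoc]
        rw [TensorProduct.map_tmul, LinearMap.id_apply, AlgHom.toLinearMap_apply, h3,
          Q.isAntipodeAlong_id.left]
        simp [mul_assoc]
  rw [h1, hB.coassoc, h2, Q.isAntipodeAlong_id.zigzag, B.right_one, hB.counit]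

section Projection

variable {N : Type*} [AddCommGroup N] [Module k N] {P : M →ₗ[k] N}

/-- A map `P` with `P(m · a) = ε(a) P(m)` sees only the second factor of a right action. -/
theorem map_ract_comul (hP : ∀ a m, P (B.right a m) = Q.counit a • P m) (a : H)
    (T : M ⊗[k] H) :
    TensorProduct.map P LinearMap.id (B.ract (Q.comul a) T) =
      TensorProduct.map LinearMap.id (LinearMap.mulRight k a)
        (TensorProduct.map P LinearMap.id T) := by
  have h : ∀ w, TensorProduct.map P LinearMap.id (B.ract w T) =
      TensorProduct.map LinearMap.id (LinearMap.mulRight k (Q.εl w))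
        (TensorProduct.map P LinearMap.id T) := by
    intro w
    induction T using TensorProduct.induction_on with
    | zero => simp
    | add u v hu hv => simp only [map_add, hu, hv]
    | tmul m n =>
      induction w using TensorProduct.induction_on with
      | zero => simp
      | add u v hu hv =>
        simp only [map_add, LinearMap.add_apply, hu, hv]
        simp [mul_add, TensorProduct.tmul_add]
      | tmul c d => simp [hP, TensorProduct.smul_tmul']
  rw [h, εl_comul]

/-- `(id ⊗ mulβS)((Δ ⊗ id)(q_R) φ⁻¹) = 1`, a reformulation of `con₃_comul_pR`. -/
theorem map_mulβS_Δ₁₂_qR :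
    TensorProduct.map LinearMap.id Q.mulβS (Q.Δ₁₂ Q.qR * Q.φinv) = 1 := by
  have h : ∀ t u : H ⊗[k] (H ⊗[k] H), TensorProduct.map LinearMap.id Q.mulβS
      (Q.Δ₁₂ (TensorProduct.map LinearMap.id Q.Sinvαmul t) * u) =
      con₃ Q.comul.toLinearMap (LinearMap.mulLeft k
        (TensorProduct.map LinearMap.id Q.mulβS u) ∘ₗ Q.SR) (mid (jR k H Q.α) (jR k H) 1) t := by
    intro t u
    induction t using tensor_induction₃ with
    | zero => simp
    | add u v hu hv => simp only [map_add, add_mul, hu, hv]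
    | tmul x y z =>
      rw [TensorProduct.map_tmul, LinearMap.id_apply, Δ₁₂_tmul, con₃_tmul,
        AlgHom.toLinearMap_apply]
      generalize Q.comul x = w
      induction w using TensorProduct.induction_on with
      | zero => simp
      | add u v hu hv =>
        simp only [map_add, TensorProduct.add_tmul, add_mul, hu, hv]
      | tmul c d =>
        induction u using tensor_induction₃ with
        | zero => simp
        | add u v hu hv =>
          rw [mul_add, map_add, hu, hv]
          simp [mul_add, add_mul]
        | tmul e f g => simp [mulβS_tmul, Sinvαmul_tmul, Q.S_mul, mul_assoc]
  rw [qR, h]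
  exact Q.con₃_comul_pR

/-- `P(E(m)₍₀₎) ⊗ E(m)₍₁₎ = P(m) ⊗ 1` whenever `P(m · a) = ε(a) P(m)`. -/
theorem IsQuasiHopfBimodule.map_coaction_E (hB : Q.IsQuasiHopfBimodule B)
    (hP : ∀ a m, P (B.right a m) = Q.counit a • P m) (m : M) :
    TensorProduct.map P LinearMap.id (B.coaction (Q.E B m)) = P m ⊗ₜ 1 := by
  have h1 : ∀ (q : H ⊗[k] H) (T : M ⊗[k] H),
      TensorProduct.map P LinearMap.id (B.coaction (Q.rightβS B (B.lact q T))) =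
      TensorProduct.map P Q.mulβS (B.lact (Q.Δ₁₂ q) (TensorProduct.assoc k M H H
        (TensorProduct.map B.coaction LinearMap.id T))) := by
    intro q T
    induction T using TensorProduct.induction_on with
    | zero => simp
    | add u v hu hv => simp only [map_add, hu, hv]
    | tmul n h =>
      induction q using TensorProduct.induction_on with
      | zero => simp
      | add u v hu hv => simp only [map_add, LinearMap.add_apply, hu, hv]
      | tmul q₁ q₂ =>
        rw [B.lact_tmul, rightβS_tmul, hB.coaction_right, map_ract_comul hP, hB.coaction_left,
          Δ₁₂_tmul, TensorProduct.map_tmul]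
        generalize Q.comul q₁ = w
        generalize B.coaction n = T
        induction w using TensorProduct.induction_on with
        | zero => simp
        | add u v hu hv =>
          simp only [map_add, TensorProduct.add_tmul, LinearMap.add_apply, hu, hv]
        | tmul c d =>
          induction T using TensorProduct.induction_on with
          | zero => simp
          | add u v hu hv => simp only [map_add, TensorProduct.add_tmul, hu, hv]
          | tmul n a => simp [mulβS_tmul, mul_assoc]
  have h2 : ∀ (u : H ⊗[k] (H ⊗[k] H)) (T : M ⊗[k] (H ⊗[k] H)), Q.ε₁ u = 1 →
      TensorProduct.map P Q.mulβS (B.ract u T) = TensorProduct.map P Q.mulβS T := by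
    intro u T hu
    have h3 : TensorProduct.map P Q.mulβS (B.ract u T) =
        TensorProduct.map P Q.mulβS (B.ract (1 ⊗ₜ Q.ε₁ u) T) := by
      clear hu
      induction T using TensorProduct.induction_on with
      | zero => simp
      | add u v hu hv => simp only [map_add, hu, hv]
      | tmul n t =>
        induction u using TensorProduct.induction_on with
        | zero => simp
        | add u v hu hv =>
          simp only [map_add, LinearMap.add_apply, TensorProduct.tmul_add, hu, hv]
        | tmul c d => simp [hP, B.right_one, TensorProduct.smul_tmul']
    rw [h3, hu]
    clear h3 hu
    induction T using TensorProduct.induction_on with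
    | zero => simp
    | add u v hu hv => simp only [map_add, hu, hv]
    | tmul n t => simp [B.right_one]
  have h3 : ∀ (t : H ⊗[k] (H ⊗[k] H)) (T : M ⊗[k] H),
      TensorProduct.map P Q.mulβS (B.lact t
        (TensorProduct.map LinearMap.id Q.comul.toLinearMap T)) =
      TensorProduct.map (P ∘ₗ B.left.flip (TensorProduct.rid k M
        (TensorProduct.map LinearMap.id Q.counit.toLinearMap T))) Q.mulβS t := by
    intro t T
    induction T using TensorProduct.induction_on with
    | zero => simp
    | add u v hu hv =>
      simp only [map_add, LinearMap.comp_add, TensorProduct.map_add_left, LinearMap.add_apply,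
        hu, hv]
    | tmul n h =>
      induction t using tensor_induction₃ with
      | zero => simp
      | add u v hu hv => simp only [map_add, LinearMap.add_apply, hu, hv]
      | tmul x y z =>
        have h4 : ∀ w : H ⊗[k] H, TensorProduct.map P Q.mulβS
            (B.lact (x ⊗ₜ (y ⊗ₜ z)) (n ⊗ₜ w)) = P (B.left x n) ⊗ₜ
              (y * (con₂ (mid 1 (AlgHom.id k H) Q.β) Q.S.toLinearMap w * Q.S z)) := by
          intro w
          induction w using TensorProduct.induction_on with
          | zero => simp
          | add u v hu hv =>
            simp only [map_add, LinearMap.add_apply, TensorProduct.tmul_add, mul_add, add_mul,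
              hu, hv]
          | tmul c d => simp [mulβS_tmul, Q.S_mul, mul_assoc]
        rw [TensorProduct.map_tmul, LinearMap.id_apply, AlgHom.toLinearMap_apply, h4,
          Q.isAntipodeAlong_id.right]
        simp [mulβS_tmul, TensorProduct.smul_tmul', mul_assoc]
  have h4 : TensorProduct.assoc k M H H
      (TensorProduct.map B.coaction LinearMap.id (B.coaction m)) =
      B.lact Q.φinv (B.ract Q.Φ
        (TensorProduct.map LinearMap.id Q.comul.toLinearMap (B.coaction m))) := by
    rw [← hB.coassoc, ← B.lact_mul, φinv_mul_Φ, B.lact_one]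
  have h5 : ∀ (F : H →ₗ[k] N) (t : H ⊗[k] (H ⊗[k] H)), TensorProduct.map F Q.mulβS t =
      TensorProduct.map F LinearMap.id (TensorProduct.map LinearMap.id Q.mulβS t) := by
    intro F t
    rw [← LinearMap.comp_apply, ← TensorProduct.map_comp, LinearMap.comp_id, LinearMap.id_comp]
  rw [E_apply, h1, h4, ← B.lact_mul, B.lact_ract, h2 _ _ Q.ε₁_Φ, h3, hB.counit, h5,
    map_mulβS_Δ₁₂_qR, Algebra.TensorProduct.one_def]
  simp [B.left_one]

end Projection

variable (Q B) in
/-- The map `E` as a projection of `M` onto the coinvariants. -/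
def coinvariantsProj : M →ₗ[k] Q.coinvariants B :=
  (Q.E B).codRestrict (Q.coinvariants B) fun m => LinearMap.mem_range_self _ m

@[simp]
theorem coe_coinvariantsProj (m : M) : (Q.coinvariantsProj B m : M) = Q.E B m := rfl

theorem map_subtype_map_coinvariantsProj (T : M ⊗[k] H) :
    TensorProduct.map (Q.coinvariants B).subtype LinearMap.id
      (TensorProduct.map (Q.coinvariantsProj B) LinearMap.id T) =
    TensorProduct.map (Q.E B) LinearMap.id T := by
  rw [← LinearMap.comp_apply, ← TensorProduct.map_comp, LinearMap.id_comp]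
  rfl

/-- The structure theorem: `l ⊗ a ↦ l · a` is a linear isomorphism `E(M) ⊗ H ≃ M`, with inverse
`m ↦ E(m₍₀₎) ⊗ m₍₁₎`. -/
def IsQuasiHopfBimodule.coinvariantsTensorEquiv (hB : Q.IsQuasiHopfBimodule B) :
    Q.coinvariants B ⊗[k] H ≃ₗ[k] M := by
  refine LinearEquiv.ofLinearMap
    (actR B ∘ₗ TensorProduct.map (Q.coinvariants B).subtype LinearMap.id)
    (TensorProduct.map (Q.coinvariantsProj B) LinearMap.id ∘ₗ B.coaction) ?_ ?_
  · ext m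
    simp only [LinearMap.comp_apply, map_subtype_map_coinvariantsProj, hB.actR_E,
      LinearMap.id_apply]
  · have hP : ∀ a m, Q.coinvariantsProj B (B.right a m) =
        Q.counit a • Q.coinvariantsProj B m := fun a m => Subtype.ext (hB.E_right a m)
    refine TensorProduct.ext' ?_
    rintro ⟨_, m, rfl⟩ a
    change TensorProduct.map (Q.coinvariantsProj B) LinearMap.id
      (B.coaction (B.right a (Q.E B m))) = Q.coinvariantsProj B m ⊗ₜ a
    rw [hB.coaction_right, map_ract_comul hP, hB.map_coaction_E hP]
    simp

theorem IsQuasiHopfBimodule.coinvariantsTensorEquiv_tmul (hB : Q.IsQuasiHopfBimodule B)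
    (l : Q.coinvariants B) (a : H) :
    hB.coinvariantsTensorEquiv (l ⊗ₜ a) = B.right a l := rfl

end Structure

/-! ### Cointegrals and integrals -/

section Cointegrals

theorem nontrivial (Q : QuasiHopfAlgebra k H) : Nontrivial H := by
  refine ⟨1, 0, fun h => one_ne_zero (α := k) ?_⟩
  rw [← map_one Q.counit, h, map_zero]

/-- A Frobenius form `ω` identifies the left integrals with the line spanned by `ε`, through
`l ↦ ω(· l)`. -/
theorem mem_leftIntegrals_iff {ω : Module.Dual k H} (hω : IsNondegenerateFunctional ω) (l : H) :
    l ∈ Q.leftIntegrals ↔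
      ((LinearMap.mul k H).compr₂ ω).flip l ∈ k ∙ Q.counit.toLinearMap := by
  rw [Submodule.mem_span_singleton]
  constructor
  · intro hl
    refine ⟨ω l, LinearMap.ext fun a => ?_⟩
    have := hl a
    simp [this, mul_comm]
  · rintro ⟨c, hc⟩ a
    have hc' : ∀ x, ω (x * l) = c * Q.counit x := fun x => (LinearMap.congr_fun hc x).symm
    refine sub_eq_zero.1 (hω.2 _ fun x => ?_)
    change ω (x * (a * l - Q.counit a • l)) = 0
    simp only [mul_sub, map_sub, mul_smul_comm,
      map_smul, smul_eq_mul, ← mul_assoc, hc', map_mul]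
    ring

theorem mem_rightIntegrals_iff {ω : Module.Dual k H} (hω : IsNondegenerateFunctional ω) (l : H) :
    l ∈ Q.rightIntegrals ↔
      (LinearMap.mul k H).compr₂ ω l ∈ k ∙ Q.counit.toLinearMap := by
  rw [Submodule.mem_span_singleton]
  constructor
  · intro hl
    refine ⟨ω l, LinearMap.ext fun a => ?_⟩
    have := hl a
    simp [this, mul_comm]
  · rintro ⟨c, hc⟩ a
    have hc' : ∀ x, ω (l * x) = c * Q.counit x := fun x => (LinearMap.congr_fun hc x).symm
    refine sub_eq_zero.1 (hω.1 _ fun x => ?_)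
    change ω ((l * a - Q.counit a • l) * x) = 0
    simp only [sub_mul, map_sub, smul_mul_assoc,
      map_smul, smul_eq_mul, mul_assoc, hc', map_mul]
    ring

variable [FiniteDimensional k H]

theorem finrank_leftCointegrals : Module.finrank k Q.leftCointegrals = 1 := by
  have := Q.nontrivial
  have h := Q.isQuasiHopfBimodule_dual.coinvariantsTensorEquiv.finrank_eq
  rw [Module.finrank_tensorProduct, Subspace.dual_finrank_eq] at h
  exact Nat.eq_of_mul_eq_mul_right (Module.finrank_pos (R := k) (M := H)) (by rw [one_mul]; exact h)

/-- In finite dimension a bilinear form separating on the right is nondegenerate. -/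
theorem nondegenerate_of_separatingRight {b : H →ₗ[k] H →ₗ[k] k} (hb : b.SeparatingRight) :
    b.Nondegenerate := by
  refine ⟨fun x hx => ?_, hb⟩
  have hinj : Function.Injective b.flip :=
    LinearMap.ker_eq_bot.1 (LinearMap.separatingRight_iff_flip_ker_eq_bot.1 hb)
  have hsurj : Function.Surjective b.flip :=
    (LinearMap.injective_iff_surjective_of_finrank_eq_finrank
      (Subspace.dual_finrank_eq (K := k) (V := H)).symm).1 hinj
  refine (Module.forall_dual_apply_eq_zero_iff k x).1 fun g => ?_
  obtain ⟨y, rfl⟩ := hsurj g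
  exact hx y

theorem isNondegenerateFunctional_of_mem {lam : Module.Dual k H}
    (hlam : lam ∈ Q.leftCointegrals) (h0 : lam ≠ 0) : IsNondegenerateFunctional lam := by
  refine nondegenerate_of_separatingRight fun b hb => ?_
  obtain ⟨a, rfl⟩ := Q.S.surjective b
  set l : Q.coinvariants Q.dualBimodule := ⟨lam, hlam⟩ with hl
  have hl0 : l ≠ 0 := fun h => h0 (congrArg Subtype.val h)
  have h1 : l ⊗ₜ[k] a = 0 := by
    rw [← Q.isQuasiHopfBimodule_dual.coinvariantsTensorEquiv.map_eq_zero_iff,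
      IsQuasiHopfBimodule.coinvariantsTensorEquiv_tmul]
    ext x
    exact hb x
  obtain ⟨g, hg⟩ : ∃ g : Module.Dual k (Q.coinvariants Q.dualBimodule), g l ≠ 0 := by
    by_contra! h
    exact hl0 ((Module.forall_dual_apply_eq_zero_iff k l).1 h)
  have h2 := congrArg (TensorProduct.lid k H ∘ TensorProduct.map g LinearMap.id) h1
  simp only [Function.comp_apply, TensorProduct.map_tmul, LinearMap.id_apply,
    TensorProduct.lid_tmul, map_zero] at h2
  rw [(smul_eq_zero.1 h2).resolve_left hg, map_zero]

/-- A subspace corresponding to the line spanned by `ε` under an injection `H → H^*` is a line. -/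
theorem finrank_eq_one_of_mem_iff {I : Submodule k H} {F : H →ₗ[k] Module.Dual k H}
    (hF : Function.Injective F) (hI : ∀ l, l ∈ I ↔ F l ∈ k ∙ Q.counit.toLinearMap) :
    Module.finrank k I = 1 := by
  have hε : Q.counit.toLinearMap ≠ 0 := fun h =>
    one_ne_zero (α := k) (by simpa using LinearMap.congr_fun h 1)
  set e : H ≃ₗ[k] Module.Dual k H := LinearEquiv.ofInjectiveOfFinrankEq F hF
    (Subspace.dual_finrank_eq (K := k) (V := H)).symm with he
  have h : I.map e.toLinearMap = k ∙ Q.counit.toLinearMap := by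
    ext g
    rw [Submodule.mem_map]
    constructor
    · rintro ⟨l, hl, rfl⟩
      exact (hI l).1 hl
    · intro hg
      refine ⟨e.symm g, (hI _).2 ?_, e.apply_symm_apply g⟩
      change e (e.symm g) ∈ _
      rwa [e.apply_symm_apply]
  rw [← LinearEquiv.finrank_map_eq e I, ← finrank_span_singleton (K := k) hε, ← h]

theorem finrank_leftIntegrals {ω : Module.Dual k H} (hω : IsNondegenerateFunctional ω) :
    Module.finrank k Q.leftIntegrals = 1 :=
  Q.finrank_eq_one_of_mem_iff
    (LinearMap.ker_eq_bot.1 (LinearMap.separatingRight_iff_flip_ker_eq_bot.1 hω.2))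
    (Q.mem_leftIntegrals_iff hω)

theorem finrank_rightIntegrals {ω : Module.Dual k H} (hω : IsNondegenerateFunctional ω) :
    Module.finrank k Q.rightIntegrals = 1 :=
  Q.finrank_eq_one_of_mem_iff
    (LinearMap.ker_eq_bot.1 (LinearMap.separatingLeft_iff_ker_eq_bot.1 hω.1))
    (Q.mem_rightIntegrals_iff hω)

end Cointegrals

end QuasiHopfAlgebra

end

theorem theorem3p6 {k H : Type*} [Field k] [Ring H] [Algebra k H] [FiniteDimensional k H]
    (Q : QuasiHopfAlgebra k H) :
    Module.finrank k Q.leftCointegrals = 1 ∧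
    (∀ lam ∈ Q.leftCointegrals, lam ≠ 0 → IsNondegenerateFunctional lam) ∧
    IsFrobeniusAlgebra k H ∧
    Module.finrank k Q.leftIntegrals = 1 ∧
    Module.finrank k Q.rightIntegrals = 1 := by
  obtain ⟨⟨ω, hω⟩, hω0, -⟩ := finrank_eq_one_iff'.1 Q.finrank_leftCointegrals
  have hnd := Q.isNondegenerateFunctional_of_mem hω fun h => hω0 (Subtype.ext h)
  exact ⟨Q.finrank_leftCointegrals, fun _ => Q.isNondegenerateFunctional_of_mem,
    ⟨inferInstance, ω, hnd⟩, Q.finrank_leftIntegrals hnd, Q.finrank_rightIntegrals hnd⟩
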